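/- Let $\mathbb K=\mathbb R$ or $\mathbb C$. For $u:\mathbb Z^2\to\mathbb K$ write $u_{p,q}=u(i+p,j+q)$, and let $T_{\rm i},T_{\rm j}$ be the forward shifts in $i$ and $j$. Consider the equation $$u_{1,1}=F(u,u_{1,0},u_{0,1}),\qquad F_{u}\ne0,\quad F_{u_{1,0}}\ne0,\quad F_{u_{0,1}}\ne0, \tag{1}$$ where $F$ is a (single-valued) analytic function on an open set $D\subseteq\mathbb K^3$, and suppose that $$\varphi\bigl(u_{1,0},F(u,u_{1,0},u_{0,1})\bigr)=\psi(u,u_{0,1})\quad\text{on } D,$$ i.e. $T_{\rm i}(\varphi(u,u_{0,1}))=\psi(u,u_{0,1})$ by virtue of (1), where $\varphi(w,z)$, $\psi(w,z)$ are analytic on an open set $E\subseteq\mathbb K^2$ containing all the pairs $(u,u_{0,1})$ and $(u_{1,0},F(u,u_{1,0},u_{0,1}))$ that occur here, and $\varphi_w\psi_z-\varphi_z\psi_w\ne0$ on $E$. *Local setting.* Fix a non-empty set $S$ of solutions $u:\mathbb Z^2\to\mathbb K$ of (1), with all triples $(u_{i,j},u_{i+1,j},u_{i,j+1})$ in $D$,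 which is connected in the topology of pointwise convergence and is mapped onto itself by both lattice shifts. Everything is considered near $S$. A function of finitely many quantities near $S$ means a scalar function defined near $S$ that, near each member of $S$, is a quotient of two analytic functions of these quantities with a denominator that is not identically zero; identities between such functions are understood outside the zero sets of non-zero analytic functions of finitely many dynamical variables, and $\ne 0$ for such a function means: not identically zero near any member of $S$. The dynamical variables are $u_{k,0}$, $u_{0,l}$ ($k,l\in\mathbb Z$); $g[u]$ denotes a function of finitely many of them, and $T_{\rm i}$, $T_{\rm j}$ act on $g[u]$ by shifting and eliminating mixed shifts $u_{p,q}$, $pq\neq0$, by means of (1). Equation (1) is *Darboux integrable* if there are non-constant functions $I[u]$ and $J[u]$ with $T_{\rm j}(I)=I$ and $T_{\rm i}(J)=J$. It is *uniquely solvable for $u_{1,0}$* if $F(x,y,z)=F(x,y',z)$ with $(x,y,z),(x,y',z)\in D$ implies $y=y'$. For a function $\phi(u,u_{0,1})$, the equation $u_t=g(u_{0,n},\dots,u_{0,k})$ *admits the difference substitution* $v=\phi(u,u_{0,1})$ into $v_t=\hat g(v_{0,n},\dots,v_{0,k})$ if $\phi_u\,\phi_{u_{0,1}}\ne0$ at every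 member of $S$ and $$\phi_{u}\,g+\phi_{u_{0,1}}\,T_{\rm j}(g)=\hat g\bigl(T_{\rm j}^{n}(\phi),\dots,T_{\rm j}^{k}(\phi)\bigr).$$ The substitution $v=\phi(u,u_{0,1})$ is *of Miura type* if there are operators $$R=\sum_{q=0}^{r}\lambda_q(u_{0,\varrho},\dots,u_{0,s})\,T_{\rm j}^q,\quad \lambda_r\ne0,\qquad \hat R=\sum_{q=0}^{r+1}\hat\lambda_q(v_{0,\hat\varrho},\dots,v_{0,\hat s})\,T_{\rm j}^q$$ such that for every integer $p$ and every function $\xi$ of finitely many arguments the equation $u_t=R\bigl(\xi(T_{\rm j}^p(\phi),T_{\rm j}^{p+1}(\phi),\dots)\bigr)$ admits the substitution $v=\phi(u,u_{0,1})$ into the equation $v_t=\hat R\bigl(\xi(v_{0,p},v_{0,p+1},\dots)\bigr)$. (Functions of the $v_{0,b}$ are taken along $S$, with $v_{0,b}=T_{\rm j}^b(\phi)$.) **Corollary.** If the equation (1) is uniquely solvable for $u_{1,0}$ and Darboux integrable, then $v=\varphi(u,u_{0,1})$ and $w=\psi(u,u_{0,1})$ are Miura-type substitutions. -/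

import Mathlib

open Filter Topology

namespace QuadGraph

variable {𝕜 : Type*} [RCLike 𝕜]

/-- The lattice shift `u_{p,q} ↦ u_{p+a,q+b}`. Thus `T_i` is composition with `shift 1 0`, and
`T_j` is composition with `shift 0 1`. -/
def shift (a b : ℤ) (u : ℤ × ℤ → 𝕜) : ℤ × ℤ → 𝕜 := fun p => u (p.1 + a, p.2 + b)

/-- The triple `(u_{i,j}, u_{i+1,j}, u_{i,j+1})`. -/
def corner (u : ℤ × ℤ → 𝕜) (i j : ℤ) : 𝕜 × 𝕜 × 𝕜 := (u (i, j), u (i + 1, j), u (i, j + 1))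

/-- `u_{1,1} = F(u, u_{1,0}, u_{0,1})`, with `F` a single-valued analytic function on the open set
`D`, all of whose first partial derivatives are non-zero. -/
structure IsEquation (D : Set (𝕜 × 𝕜 × 𝕜)) (F : 𝕜 × 𝕜 × 𝕜 → 𝕜) : Prop where
  isOpen : IsOpen D
  analytic : AnalyticOnNhd 𝕜 F D
  deriv_u : ∀ x y z, (x, y, z) ∈ D → deriv (fun t => F (t, y, z)) x ≠ 0
  deriv_u10 : ∀ x y z, (x, y, z) ∈ D → deriv (fun t => F (x, t, z)) y ≠ 0
  deriv_u01 : ∀ x y z, (x, y, z) ∈ D → deriv (fun t => F (x, y, t)) z ≠ 0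

/-- The partial derivative in the first variable. -/
noncomputable def d₁ (f : 𝕜 × 𝕜 → 𝕜) (w z : 𝕜) : 𝕜 := deriv (fun t => f (t, z)) w

/-- The partial derivative in the second variable. -/
noncomputable def d₂ (f : 𝕜 × 𝕜 → 𝕜) (w z : 𝕜) : 𝕜 := deriv (fun t => f (w, t)) z

/-- The equation has the form `T_i(φ(u, u_{0,1})) = ψ(u, u_{0,1})`, that is,
`φ(u_{1,0}, F(u, u_{1,0}, u_{0,1})) = ψ(u, u_{0,1})`, where `φ` and `ψ` are analytic on the open
set `E` and have a non-vanishing Jacobian there. -/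
structure HasForm (D : Set (𝕜 × 𝕜 × 𝕜)) (F : 𝕜 × 𝕜 × 𝕜 → 𝕜)
    (E : Set (𝕜 × 𝕜)) (φ ψ : 𝕜 × 𝕜 → 𝕜) : Prop where
  isOpen : IsOpen E
  analytic_φ : AnalyticOnNhd 𝕜 φ E
  analytic_ψ : AnalyticOnNhd 𝕜 ψ E
  jacobian : ∀ w z, (w, z) ∈ E → d₁ φ w z * d₂ ψ w z - d₂ φ w z * d₁ ψ w z ≠ 0
  mem_left : ∀ x y z, (x, y, z) ∈ D → (y, F (x, y, z)) ∈ E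
  mem_right : ∀ x y z, (x, y, z) ∈ D → (x, z) ∈ E
  relation : ∀ x y z, (x, y, z) ∈ D → φ (y, F (x, y, z)) = ψ (x, z)

/-- The equation is uniquely solvable for `u_{1,0}`: the function
`u_{1,-1} = F̂(u, u_{1,0}, u_{0,-1})` that the equation defines is single-valued. -/
def UniquelySolvable (D : Set (𝕜 × 𝕜 × 𝕜)) (F : 𝕜 × 𝕜 × 𝕜 → 𝕜) : Prop :=
  ∀ x y y' z, (x, y, z) ∈ D → (x, y', z) ∈ D → F (x, y, z) = F (x, y', z) → y = y'

/-- The equation holds for `u` on the elementary square with lower left vertex `(i, j)`. -/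
def SolvesAt (D : Set (𝕜 × 𝕜 × 𝕜)) (F : 𝕜 × 𝕜 × 𝕜 → 𝕜) (u : ℤ × ℤ → 𝕜) (i j : ℤ) : Prop :=
  corner u i j ∈ D ∧ u (i + 1, j + 1) = F (corner u i j)

/-- The solutions near which everything is considered: a non-empty connected set of solutions
(for the topology of pointwise convergence) that is mapped onto itself by both lattice shifts.
Shift invariance is what allows one and the same function to be evaluated at `u` and at the shifts
of `u`; connectedness makes a function near these solutions one analytic function, not a collection
of unrelated ones. -/
structure IsBase (D : Set (𝕜 × 𝕜 × 𝕜)) (F : 𝕜 × 𝕜 × 𝕜 → 𝕜) (S : Set (ℤ × ℤ → 𝕜)) : Prop where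
  connected : IsConnected S
  shift_i : shift 1 0 '' S = S
  shift_j : shift 0 1 '' S = S
  solves : ∀ s ∈ S, ∀ i j, SolvesAt D F s i j

/-- `P u` holds for all `u` close to `s` outside of the zero set of some analytic function, not
identically zero near `s`, of finitely many of the dynamical variables `u_{k,0}`, `u_{0,l}`. -/
def GenericallyNear (s : ℤ × ℤ → 𝕜) (P : (ℤ × ℤ → 𝕜) → Prop) : Prop :=
  ∃ K : Finset (ℤ × ℤ), (∀ p ∈ K, p.1 = 0 ∨ p.2 = 0) ∧ ∃ B : (K → 𝕜) → 𝕜,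
    AnalyticAt 𝕜 B (fun p => s p) ∧ (∃ᶠ y in 𝓝 (fun p : K => s p), B y ≠ 0) ∧
    ∀ᶠ u in 𝓝 s, B (fun p => u p) ≠ 0 → P u

/-- Near every member of `S`, `g` is a function of the finitely many quantities `x i`: a quotient
of two analytic functions of these quantities, the denominator not being identically zero.
(The value of `g` where the denominator vanishes is irrelevant.) -/
def IsFunctionOf (S : Set (ℤ × ℤ → 𝕜)) {ι : Type} [Fintype ι] (x : ι → (ℤ × ℤ → 𝕜) → 𝕜)
    (g : (ℤ × ℤ → 𝕜) → 𝕜) : Prop :=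
  ∀ s ∈ S, ∃ A B : (ι → 𝕜) → 𝕜, AnalyticAt 𝕜 A (fun i => x i s) ∧
    AnalyticAt 𝕜 B (fun i => x i s) ∧ (∃ᶠ y in 𝓝 (fun i => x i s), B y ≠ 0) ∧
    ∀ᶠ u in 𝓝 s, B (fun i => x i u) ≠ 0 → g u = A (fun i => x i u) / B (fun i => x i u)

/-- `g[u]`: a function of finitely many dynamical variables `u_{k,0}`, `u_{0,l}`. -/
def IsFunctionOfDynamical (S : Set (ℤ × ℤ → 𝕜)) (g : (ℤ × ℤ → 𝕜) → 𝕜) : Prop :=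
  ∃ K : Finset (ℤ × ℤ), (∀ p ∈ K, p.1 = 0 ∨ p.2 = 0) ∧
    IsFunctionOf S (fun (p : K) (u : ℤ × ℤ → 𝕜) => u p) g

/-- `g(u_{0,a}, …, u_{0,b})`. -/
def IsFunctionOfColumn (S : Set (ℤ × ℤ → 𝕜)) (a b : ℤ) (g : (ℤ × ℤ → 𝕜) → 𝕜) : Prop :=
  IsFunctionOf S (fun (k : Finset.Icc a b) (u : ℤ × ℤ → 𝕜) => u (0, k)) g

/-- `g(v_{0,a}, …, v_{0,b})` with `v_{0,k} = T_j^k(φ(u, u_{0,1})) = φ(u_{0,k}, u_{0,k+1})`. -/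
def IsFunctionOfSubst (S : Set (ℤ × ℤ → 𝕜)) (φ : 𝕜 × 𝕜 → 𝕜) (a b : ℤ)
    (g : (ℤ × ℤ → 𝕜) → 𝕜) : Prop :=
  IsFunctionOf S (fun (k : Finset.Icc a b) (u : ℤ × ℤ → 𝕜) => φ (u (0, k), u (0, k + 1))) g

/-- The shift of `g` by `(a, b)` by virtue of the equation equals `g`: after the elimination of the
mixed shifts, `g[u_{·+a,·+b}]` and `g[u]` are the same function of the dynamical variables.
The elimination uses the equation on finitely many squares only. -/
def ShiftInvariant (D : Set (𝕜 × 𝕜 × 𝕜)) (F : 𝕜 × 𝕜 × 𝕜 → 𝕜) (S : Set (ℤ × ℤ → 𝕜)) (a b : ℤ)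
    (g : (ℤ × ℤ → 𝕜) → 𝕜) : Prop :=
  ∀ s ∈ S, ∃ N : ℤ, GenericallyNear s fun u =>
    (∀ i j, |i| ≤ N → |j| ≤ N → SolvesAt D F u i j) → g (shift a b u) = g u

/-- `g[u]` depends essentially on at least one dynamical variable, i.e. it is not a constant. -/
def Essential (S : Set (ℤ × ℤ → 𝕜)) (g : (ℤ × ℤ → 𝕜) → 𝕜) : Prop :=
  ∀ C : 𝕜, ¬ ∀ s ∈ S, GenericallyNear s fun u => g u = C

/-- Darboux integrability: there are an `i`-integral `I[u]`, `T_j(I) = I`, and a `j`-integral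
`J[u]`, `T_i(J) = J`. -/
def DarbouxIntegrable (D : Set (𝕜 × 𝕜 × 𝕜)) (F : 𝕜 × 𝕜 × 𝕜 → 𝕜) (S : Set (ℤ × ℤ → 𝕜)) : Prop :=
  (∃ I, IsFunctionOfDynamical S I ∧ Essential S I ∧ ShiftInvariant D F S 0 1 I) ∧
  (∃ J, IsFunctionOfDynamical S J ∧ Essential S J ∧ ShiftInvariant D F S 1 0 J)

/-- The operator `∑_{q=0}^{r} λ_q T_j^q` applied to `h`. -/
def applyOp (r : ℕ) (lam : ℕ → (ℤ × ℤ → 𝕜) → 𝕜) (h : (ℤ × ℤ → 𝕜) → 𝕜) :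
    (ℤ × ℤ → 𝕜) → 𝕜 :=
  fun u => ∑ q ∈ Finset.range (r + 1), lam q u * h (shift 0 q u)

/-- The equation `u_t = g(u_{0,n}, …, u_{0,k})` admits the difference substitution
`v = φ(u, u_{0,1})` into `v_t = ĝ(v_{0,n}, …, v_{0,k})`: both partial derivatives of `φ` are
non-zero, and `φ_u g + φ_{u_{0,1}} T_j(g) = ĝ(T_j^n(φ), …, T_j^k(φ))`. The function `ghat` is `ĝ`
with `v_{0,b} = T_j^b(φ)` put in. -/
def AdmitsSubstitution (S : Set (ℤ × ℤ → 𝕜)) (φ : 𝕜 × 𝕜 → 𝕜)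
    (g ghat : (ℤ × ℤ → 𝕜) → 𝕜) : Prop :=
  (∀ s ∈ S, d₁ φ (s (0, 0)) (s (0, 1)) ≠ 0 ∧ d₂ φ (s (0, 0)) (s (0, 1)) ≠ 0) ∧
  (∃ n k : ℤ, n ≤ k ∧ IsFunctionOfColumn S n k g ∧ IsFunctionOfSubst S φ n k ghat) ∧
  ∀ s ∈ S, GenericallyNear s fun u =>
    d₁ φ (u (0, 0)) (u (0, 1)) * g u + d₂ φ (u (0, 0)) (u (0, 1)) * g (shift 0 1 u) = ghat u

/-- `v = φ(u, u_{0,1})` is a Miura-type substitution: there are operators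
`R = ∑_{q=0}^{r} λ_q(u_{0,a}, …, u_{0,b}) T_j^q` with `λ_r ≠ 0` and
`R̂ = ∑_{q=0}^{r+1} λ̂_q(v_{0,c}, …, v_{0,d}) T_j^q` such that, for every integer `p` and every
function `ξ` of finitely many arguments, the equation `u_t = R(ξ(T_j^p(φ), T_j^{p+1}(φ), …))`
admits the substitution `v = φ(u, u_{0,1})` into `v_t = R̂(ξ(v_{0,p}, v_{0,p+1}, …))`. -/
def IsMiuraType (S : Set (ℤ × ℤ → 𝕜)) (φ : 𝕜 × 𝕜 → 𝕜) : Prop :=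
  ∃ (r : ℕ) (a b c d : ℤ) (lam lamhat : ℕ → (ℤ × ℤ → 𝕜) → 𝕜),
    (∀ q ≤ r, IsFunctionOfColumn S a b (lam q)) ∧
    (∀ s ∈ S, ¬ GenericallyNear s fun u => lam r u = 0) ∧
    (∀ q ≤ r + 1, IsFunctionOfSubst S φ c d (lamhat q)) ∧
    ∀ (p : ℤ) (t : ℕ) (ξ : (ℤ × ℤ → 𝕜) → 𝕜), IsFunctionOfSubst S φ 0 t ξ →
      AdmitsSubstitution S φ (applyOp r lam fun u => ξ (shift 0 p u))
        (applyOp (r + 1) lamhat fun u => ξ (shift 0 p u))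

end QuadGraph

/-! Write α, β, γ for the derivatives of F in u_{1,0}, u_{0,1}, u. The linearized equation is T_i
T_j(g) = α T_i(g) + β T_j(g) + γ g. The heart of the proof is an operator R = ∑ λ_q T_j^q, with λ_q
functions of the column variables u_{0,l} only, such that R(ξ) solves the linearized equation
whenever T_i(ξ) = ξ. In coefficients: T_i T_j(λ_{q-1}) = α T_i(λ_q) + β T_j(λ_{q-1}) + γ λ_q.

Given R, put λ̂_q = φ_u λ_q + φ_{u_{0,1}} T_j(λ_{q-1}). Differentiating φ(u_{1,0}, F) = ψ turns the
coefficient equation into T_i(λ̂_q) = ψ_u λ_q + ψ_{u_{0,1}} T_j(λ_{q-1}), which again involves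
column variables only. A column function h whose shift T_i(h) is a column function depends only on
the quantities T_j^k(φ). Indeed, T_i(h) does not change with u_{1,0}, and pulled back by T_i this
says that h is constant along the curves on which all T_j^k(φ) are constant
(`CrossField.sum_dd_eq_zero`, `RegularAt.exists_quotient`). So λ̂_q is a function of the v_{0,b},
and it is the coefficient of R̂ for φ. Since T_i maps T_j^k(φ) to T_j^k(ψ), the same function
evaluated on ψ gives the coefficient for ψ (`solMeroVia_right`).

To obtain R, set y_q = T_j^{-q}(λ_q) and σ = T_i. One needs a finitely supported, non-zero solution
of σ(y_{q-1}) = α_q σ(y_q) + β_q y_{q-1} + γ_q y_q, with α_q = T_j^{-q}(α) and so on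
(`exists_finite_solution`). Forget that the entries Y_{q,k} should be σ^k(y_q): for k < n this is a
finite linear system with more unknowns than equations. In a solution of shortest support the top
entry determines everything. The i-integral gives a linear relation of order n along the row,
compatible with the linearized equation (`CrossField.exists_relation`); it extends the solution to k
= n. The j-integral gives μ with T_i(μ) = T_j^{-1}(β) μ (`CrossField.exists_multiplier`), the right
normalization of the top entry. Comparing the solution with its σ-shift then forces Y_{q,1} =
σ(Y_{q,0}) by uniqueness. That the λ_q are column functions follows by descending induction on q
(`CrossField.isColumn_of_T_one`).

All this algebra takes place in a difference field with partial derivations (`CrossField`). It is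
realized by germs, at generic solutions near S, of quotients of analytic functions of the dynamical
variables. Connectedness of S makes the germs a field, and `exists_isExt`, which solves the equation
locally from arbitrary values on the axes, makes the dynamical variables independent. -/

namespace QuadGraph

/-! ### Analytic germs in finitely many lattice coordinates and their partial derivatives. -/

variable {𝕜 : Type*} [RCLike 𝕜]

/-- The restriction of a lattice function to a finite set of vertices. -/
def res (L : Finset (ℤ × ℤ)) (u : ℤ × ℤ → 𝕜) : L → 𝕜 := fun p => u p

theorem continuous_res (L : Finset (ℤ × ℤ)) : Continuous (res L : (ℤ × ℤ → 𝕜) → L → 𝕜) :=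
  continuous_pi fun p => continuous_apply (p : ℤ × ℤ)

/-- A vector on `L` extends to the lattice by the values of `s`, continuously, so restriction is
open at `s`. Statements about germs thus pass between the lattice functions and a finite-dimensional
space, where the identity theorem is available. -/
theorem map_res_nhds (L : Finset (ℤ × ℤ)) (s : ℤ × ℤ → 𝕜) :
    map (res L) (𝓝 s) = 𝓝 (res L s) := by
  classical
  refine le_antisymm (continuous_res L).continuousAt ?_
  let σ : (L → 𝕜) → (ℤ × ℤ → 𝕜) := fun y p => if h : p ∈ L then y ⟨p, h⟩ else s p
  have hσ : Continuous σ := by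
    refine continuous_pi fun p => ?_
    by_cases h : p ∈ L
    · simpa [σ, h] using continuous_apply (⟨p, h⟩ : L)
    · simpa [σ, h] using continuous_const
  have hs : σ (res L s) = s := by
    funext p; simp [σ, res]
  have hr : ∀ y, res L (σ y) = y := by
    intro y; funext p; simp [σ, res]
  intro V hV
  have h1 : Tendsto σ (𝓝 (res L s)) (𝓝 s) := by
    have := hσ.tendsto (res L s); rwa [hs] at this
  filter_upwards [h1 hV] with y hy
  simpa [hr] using hy

section AnalyticIn

variable {E G : Type*} [NormedAddCommGroup E] [NormedSpace 𝕜 E]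
  [NormedAddCommGroup G] [NormedSpace 𝕜 G]

/-- Near `s`, `f` is an analytic function of finitely many coordinates `u p`, `p ∈ K`. -/
def AnalyticIn (K : Set (ℤ × ℤ)) (s : ℤ × ℤ → 𝕜) (f : (ℤ × ℤ → 𝕜) → E) : Prop :=
  ∃ L : Finset (ℤ × ℤ), (L : Set (ℤ × ℤ)) ⊆ K ∧ ∃ A : (L → 𝕜) → E,
    AnalyticAt 𝕜 A (res L s) ∧ ∀ᶠ u in 𝓝 s, f u = A (res L u)

variable {K K' : Set (ℤ × ℤ)} {s : ℤ × ℤ → 𝕜} {f g : (ℤ × ℤ → 𝕜) → E}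

theorem AnalyticIn.mono (h : AnalyticIn K s f) (hK : K ⊆ K') : AnalyticIn K' s f := by
  obtain ⟨L, hL, A, hA⟩ := h
  exact ⟨L, hL.trans hK, A, hA⟩

theorem AnalyticIn.congr (h : AnalyticIn K s f) (hg : g =ᶠ[𝓝 s] f) : AnalyticIn K s g := by
  obtain ⟨L, hL, A, hA, he⟩ := h
  exact ⟨L, hL, A, hA, by filter_upwards [he, hg] with u h1 h2; rw [h2, h1]⟩

theorem AnalyticIn.const (K : Set (ℤ × ℤ)) (s : ℤ × ℤ → 𝕜) (c : E) :
    AnalyticIn K s fun _ => c :=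
  ⟨∅, by simp, fun _ => c, analyticAt_const, Eventually.of_forall fun _ => rfl⟩

theorem AnalyticIn.coord {p : ℤ × ℤ} (hp : p ∈ K) : AnalyticIn K s fun u => u p :=
  ⟨{p}, by simpa using hp, fun y => y ⟨p, by simp⟩,
    (ContinuousLinearMap.proj (R := 𝕜) (φ := fun _ : ({p} : Finset (ℤ × ℤ)) => 𝕜)
      ⟨p, by simp⟩).analyticAt _, Eventually.of_forall fun _ => rfl⟩

/-- The restriction from a finite set to a subset. -/
def resSub {L L' : Finset (ℤ × ℤ)} (h : L ⊆ L') : (L' → 𝕜) →L[𝕜] (L → 𝕜) :=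
  ContinuousLinearMap.pi fun p => ContinuousLinearMap.proj ⟨p, h p.2⟩

theorem resSub_res {L L' : Finset (ℤ × ℤ)} (h : L ⊆ L') (u : ℤ × ℤ → 𝕜) :
    resSub h (res L' u) = res L u := rfl

theorem analyticAt_comp_resSub {L L' : Finset (ℤ × ℤ)} (h : L ⊆ L') {A : (L → 𝕜) → E}
    (hA : AnalyticAt 𝕜 A (res L s)) :
    AnalyticAt 𝕜 (fun y => A (resSub h y)) (res L' s) :=
  AnalyticAt.fun_comp (g := A) (by rwa [resSub_res]) ((resSub (𝕜 := 𝕜) h).analyticAt _)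

theorem AnalyticIn.prodMk {g : (ℤ × ℤ → 𝕜) → G} (hf : AnalyticIn K s f)
    (hg : AnalyticIn K s g) : AnalyticIn K s fun u => (f u, g u) := by
  classical
  obtain ⟨L, hL, A, hA, hAe⟩ := hf
  obtain ⟨L', hL', B, hB, hBe⟩ := hg
  refine ⟨L ∪ L', by simp [hL, hL'], fun y => (A (resSub Finset.subset_union_left y),
    B (resSub Finset.subset_union_right y)), ?_, ?_⟩
  · exact (analyticAt_comp_resSub Finset.subset_union_left hA).prod
      (analyticAt_comp_resSub Finset.subset_union_right hB)
  · filter_upwards [hAe, hBe] with u h1 h2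
    rw [h1, h2]; rfl

theorem AnalyticIn.pi {ι : Type*} [Fintype ι] {f : ι → (ℤ × ℤ → 𝕜) → 𝕜}
    (hf : ∀ i, AnalyticIn K s (f i)) : AnalyticIn K s fun u i => f i u := by
  classical
  choose L hL A hA hAe using hf
  have hsub : ∀ i, L i ⊆ Finset.univ.biUnion L := fun i =>
    Finset.subset_biUnion_of_mem L (Finset.mem_univ i)
  refine ⟨Finset.univ.biUnion L, ?_, fun y i => A i (resSub (hsub i) y), ?_, ?_⟩
  · intro p hp
    simp only [Finset.coe_biUnion, Set.mem_iUnion] at hp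
    obtain ⟨i, _, hi⟩ := hp
    exact hL i hi
  · exact AnalyticAt.pi fun i => analyticAt_comp_resSub (hsub i) (hA i)
  · filter_upwards [eventually_all.2 hAe] with u hu
    funext i
    rw [hu i]; rfl

theorem AnalyticIn.continuousAt (hf : AnalyticIn K s f) : ContinuousAt f s := by
  obtain ⟨L, _, A, hA, he⟩ := hf
  have : ContinuousAt (fun u => A (res L u)) s :=
    ContinuousAt.comp (g := A) hA.continuousAt (continuous_res L).continuousAt
  exact this.congr (he.mono fun u h => h.symm)

theorem AnalyticIn.comp {H : E → G} (hH : AnalyticAt 𝕜 H (f s)) (hf : AnalyticIn K s f) :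
    AnalyticIn K s fun u => H (f u) := by
  obtain ⟨L, hL, A, hA, he⟩ := hf
  refine ⟨L, hL, fun y => H (A y), ?_, he.mono fun u h => congrArg H h⟩
  rw [he.self_of_nhds] at hH
  exact hH.fun_comp hA

theorem AnalyticIn.add (hf : AnalyticIn K s f) (hg : AnalyticIn K s g) :
    AnalyticIn K s fun u => f u + g u :=
  AnalyticIn.comp (H := fun y : E × E => y.1 + y.2) (analyticAt_fst.add analyticAt_snd)
    (hf.prodMk hg)

theorem AnalyticIn.sub (hf : AnalyticIn K s f) (hg : AnalyticIn K s g) :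
    AnalyticIn K s fun u => f u - g u :=
  AnalyticIn.comp (H := fun y : E × E => y.1 - y.2) (analyticAt_fst.sub analyticAt_snd)
    (hf.prodMk hg)

theorem AnalyticIn.neg (hf : AnalyticIn K s f) : AnalyticIn K s fun u => - f u :=
  AnalyticIn.comp (H := fun y : E => -y) analyticAt_id.neg hf

theorem AnalyticIn.eventually [CompleteSpace E] (hf : AnalyticIn K s f) : ∀ᶠ t in 𝓝 s, AnalyticIn K t f := by
  obtain ⟨L, hL, A, hA, he⟩ := hf
  have h1 : ∀ᶠ t in 𝓝 s, AnalyticAt 𝕜 A (res L t) :=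
    (continuous_res L).continuousAt.eventually hA.eventually_analyticAt
  filter_upwards [h1, he.eventually_nhds] with t h2 h3
  exact ⟨L, hL, A, h2, h3⟩

theorem AnalyticIn.comp_map {Ψ : (ℤ × ℤ → 𝕜) → (ℤ × ℤ → 𝕜)} (hf : AnalyticIn K (Ψ s) f)
    (hΨ : ContinuousAt Ψ s) (h : ∀ p ∈ K, AnalyticIn K' s fun u => Ψ u p) :
    AnalyticIn K' s fun u => f (Ψ u) := by
  obtain ⟨L, hL, A, hA, he⟩ := hf
  have h1 : AnalyticIn K' s fun u => res L (Ψ u) :=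
    AnalyticIn.pi fun p : L => h p (hL p.2)
  exact (AnalyticIn.comp (f := fun u => res L (Ψ u)) (H := A) hA h1).congr (hΨ.eventually he)

/-- A function of coordinates that a map leaves unchanged is unchanged by that map. -/
theorem AnalyticIn.eventually_map_eq {Ψ : (ℤ × ℤ → 𝕜) → (ℤ × ℤ → 𝕜)} (hf : AnalyticIn K s f)
    (hΨ : Tendsto Ψ (𝓝 s) (𝓝 s)) (h : ∀ p ∈ K, ∀ᶠ u in 𝓝 s, Ψ u p = u p) :
    ∀ᶠ u in 𝓝 s, f (Ψ u) = f u := by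
  obtain ⟨L, hL, A, hA, he⟩ := hf
  have h1 : ∀ᶠ u in 𝓝 s, ∀ p : L, Ψ u p = u p := eventually_all.2 fun p => h p (hL p.2)
  filter_upwards [he, hΨ.eventually he, h1] with u h2 h3 h4
  rw [h2, h3]
  congr 1
  exact funext h4

/-- A local version for two maps. -/
theorem AnalyticIn.eventually_eq_of_eqOn (hf : AnalyticIn K s f) {α : Type*} {l : Filter α}
    {Ψ Φ : α → (ℤ × ℤ → 𝕜)}
    (hΨ : Tendsto Ψ l (𝓝 s)) (hΦ : Tendsto Φ l (𝓝 s))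
    (h : ∀ p ∈ K, ∀ᶠ u in l, Ψ u p = Φ u p) :
    ∀ᶠ u in l, f (Ψ u) = f (Φ u) := by
  obtain ⟨L, hL, A, hA, he⟩ := hf
  have h1 : ∀ᶠ u in l, ∀ p : L, Ψ u p = Φ u p := eventually_all.2 fun p => h p (hL p.2)
  filter_upwards [hΦ.eventually he, hΨ.eventually he, h1] with u h2 h3 h4
  rw [h2, h3]
  congr 1
  exact funext h4

end AnalyticIn

section Scalar

variable {K K' : Set (ℤ × ℤ)} {s : ℤ × ℤ → 𝕜} {f g : (ℤ × ℤ → 𝕜) → 𝕜}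

theorem AnalyticIn.mul (hf : AnalyticIn K s f) (hg : AnalyticIn K s g) :
    AnalyticIn K s fun u => f u * g u :=
  AnalyticIn.comp (H := fun y : 𝕜 × 𝕜 => y.1 * y.2) (analyticAt_fst.mul analyticAt_snd)
    (hf.prodMk hg)

theorem AnalyticIn.div (hf : AnalyticIn K s f) (hg : AnalyticIn K s g) (h0 : g s ≠ 0) :
    AnalyticIn K s fun u => f u / g u :=
  AnalyticIn.comp (H := fun y : 𝕜 × 𝕜 => y.1 / y.2) (analyticAt_fst.div analyticAt_snd h0)
    (hf.prodMk hg)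

theorem AnalyticIn.pow (hf : AnalyticIn K s f) (n : ℕ) : AnalyticIn K s fun u => f u ^ n :=
  AnalyticIn.comp (H := fun y : 𝕜 => y ^ n) (analyticAt_id.pow n) hf

theorem AnalyticIn.finsetSum {ι : Type*} (I : Finset ι) {f : ι → (ℤ × ℤ → 𝕜) → 𝕜}
    (h : ∀ i ∈ I, AnalyticIn K s (f i)) : AnalyticIn K s fun u => ∑ i ∈ I, f i u := by
  classical
  induction I using Finset.induction_on with
  | empty => simpa using AnalyticIn.const K s (0 : 𝕜)
  | insert i I hi ih =>
    simp only [Finset.sum_insert hi]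
    exact (h i (by simp)).add (ih fun j hj => h j (by simp [hj]))

theorem AnalyticIn.finsetProd {ι : Type*} (I : Finset ι) {f : ι → (ℤ × ℤ → 𝕜) → 𝕜}
    (h : ∀ i ∈ I, AnalyticIn K s (f i)) : AnalyticIn K s fun u => ∏ i ∈ I, f i u := by
  classical
  induction I using Finset.induction_on with
  | empty => simpa using AnalyticIn.const K s (1 : 𝕜)
  | insert i I hi ih =>
    simp only [Finset.prod_insert hi]
    exact (h i (by simp)).mul (ih fun j hj => h j (by simp [hj]))

/-- If the germ of `f` at `s` is non-zero, so are the germs at nearby points. -/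
theorem AnalyticIn.eventually_frequently_ne (hf : AnalyticIn K s f)
    (h0 : ∃ᶠ u in 𝓝 s, f u ≠ 0) : ∀ᶠ t in 𝓝 s, ∃ᶠ u in 𝓝 t, f u ≠ 0 := by
  obtain ⟨L, hL, A, hA, he⟩ := hf
  obtain ⟨ε, hε, hb⟩ := Metric.eventually_nhds_iff_ball.1 hA.eventually_analyticAt
  have h1 : ∀ᶠ t in 𝓝 s, res L t ∈ Metric.ball (res L s) ε :=
    (continuous_res L).continuousAt.eventually (Metric.ball_mem_nhds _ hε)
  filter_upwards [h1, he.eventually_nhds] with t h2 h3 h4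
  simp only [not_not] at h4
  -- If the germ at `t` were zero, the identity theorem on a ball around `res L s` would make the
  -- germ at `s` zero.
  have h5 : ∀ᶠ y in 𝓝 (res L t), A y = 0 := by
    rw [← map_res_nhds]
    rw [eventually_map]
    filter_upwards [h3, h4] with u h6 h7
    rw [← h6, h7]
  have h6 : AnalyticOnNhd 𝕜 A (Metric.ball (res L s) ε) := fun y hy => hb y hy
  have h7 := h6.eqOn_zero_of_preconnected_of_eventuallyEq_zero
    (convex_ball (res L s) ε).isPreconnected h2 h5
  apply h0
  filter_upwards [h1, he] with u h8 h9
  simp only [not_not]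
  rw [h9, h7 h8]; rfl

/-- Germs form a domain: near a point where `f` is non-zero it stays so by continuity, and the germ
of `g` at that point is still non-zero. This is what allows finitely many exceptional zero sets to
be merged into one. -/
theorem AnalyticIn.frequently_mul_ne (hf : AnalyticIn K s f) (hg : AnalyticIn K' s g)
    (h0 : ∃ᶠ u in 𝓝 s, f u ≠ 0) (h1 : ∃ᶠ u in 𝓝 s, g u ≠ 0) :
    ∃ᶠ u in 𝓝 s, f u * g u ≠ 0 := by
  intro h
  simp only [not_not] at h
  obtain ⟨u, hu, h2, h3, h4⟩ := (h0.and_eventually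
    ((hg.eventually_frequently_ne h1).and (hf.eventually.and h.eventually_nhds))).exists
  have h5 : ∀ᶠ v in 𝓝 u, f v ≠ 0 := h3.continuousAt.eventually_ne hu
  obtain ⟨v, hv, h6, h7⟩ := (h2.and_eventually (h5.and h4)).exists
  exact mul_ne_zero h6 hv h7

/-- Otherwise `h * (f - g)` would be a non-zero germ, although it vanishes identically. It removes
the exceptional set from an identity between analytic functions. -/
theorem AnalyticIn.eventually_eq_of_mul_eq {h : (ℤ × ℤ → 𝕜) → 𝕜} (hf : AnalyticIn K s f)
    (hg : AnalyticIn K s g) (hh : AnalyticIn K' s h) (h0 : ∃ᶠ u in 𝓝 s, h u ≠ 0)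
    (he : ∀ᶠ u in 𝓝 s, h u ≠ 0 → f u = g u) : ∀ᶠ u in 𝓝 s, f u = g u := by
  by_contra hc
  have h1 : ∃ᶠ u in 𝓝 s, f u - g u ≠ 0 := by
    refine Frequently.mono (show ∃ᶠ u in 𝓝 s, f u ≠ g u from fun h => hc (h.mono fun u hu => not_not.1 hu)) fun u hu => sub_ne_zero.2 hu
  obtain ⟨u, hu, hu'⟩ := ((hh.frequently_mul_ne (hf.sub hg) h0 h1).and_eventually he).exists
  exact hu (by rw [hu' (left_ne_zero_of_mul hu), sub_self, mul_zero])

/-- The partial derivative in the direction of the coordinate `u p`. -/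
noncomputable def pd (p : ℤ × ℤ) (f : (ℤ × ℤ → 𝕜) → 𝕜) (u : ℤ × ℤ → 𝕜) : 𝕜 :=
  deriv (fun t => f (Function.update u p t)) (u p)

theorem hasDerivAt_comp_of_res {L : Finset (ℤ × ℤ)} {A : (L → 𝕜) → 𝕜} {u : ℤ × ℤ → 𝕜}
    (hA : AnalyticAt 𝕜 A (res L u)) (he : ∀ᶠ v in 𝓝 u, f v = A (res L v))
    {γ : 𝕜 → (ℤ × ℤ → 𝕜)} {t : 𝕜} {w : ℤ × ℤ → 𝕜} (hγ : γ t = u) (hc : ContinuousAt γ t)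
    (hd : ∀ p ∈ L, HasDerivAt (fun x => γ x p) (w p) t) :
    HasDerivAt (fun x => f (γ x)) (fderiv 𝕜 A (res L u) (res L w)) t := by
  have h1 : HasDerivAt (fun x => res L (γ x)) (res L w) t :=
    hasDerivAt_pi.2 fun p => hd p p.2
  have h2 : HasFDerivAt A (fderiv 𝕜 A (res L u)) (res L (γ t)) := by
    rw [hγ]; exact hA.differentiableAt.hasFDerivAt
  refine (h2.comp_hasDerivAt t h1).congr_of_eventuallyEq ?_
  rw [← hγ] at he
  filter_upwards [hc.eventually he] with x hx using hx

theorem hasDerivAt_update_apply (u : ℤ × ℤ → 𝕜) (p q : ℤ × ℤ) :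
    HasDerivAt (fun t => Function.update u p t q) ((Pi.single p 1 : ℤ × ℤ → 𝕜) q) (u p) := by
  by_cases h : q = p
  · subst h
    simpa using hasDerivAt_id' (u q)
  · simpa [h] using hasDerivAt_const (u p) (u q)

theorem continuous_update_right (u : ℤ × ℤ → 𝕜) (p : ℤ × ℤ) :
    Continuous fun t => Function.update u p t :=
  continuous_const.update p continuous_id

theorem pd_eq_of_res {L : Finset (ℤ × ℤ)} {A : (L → 𝕜) → 𝕜} {u : ℤ × ℤ → 𝕜} (p : ℤ × ℤ)
    (hA : AnalyticAt 𝕜 A (res L u)) (he : ∀ᶠ v in 𝓝 u, f v = A (res L v)) :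
    HasDerivAt (fun t => f (Function.update u p t))
      (fderiv 𝕜 A (res L u) (res L (Pi.single p 1))) (u p) :=
  hasDerivAt_comp_of_res hA he (by simp) (continuous_update_right u p).continuousAt
    fun q _ => hasDerivAt_update_apply u p q

theorem AnalyticIn.hasDerivAt_pd {u : ℤ × ℤ → 𝕜} (hf : AnalyticIn K u f) (p : ℤ × ℤ) :
    HasDerivAt (fun t => f (Function.update u p t)) (pd p f u) (u p) := by
  obtain ⟨L, _, A, hA, he⟩ := hf
  exact (pd_eq_of_res p hA he).differentiableAt.hasDerivAt

theorem AnalyticIn.pd (hf : AnalyticIn K s f) (p : ℤ × ℤ) : AnalyticIn K s (pd p f) := by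
  obtain ⟨L, hL, A, hA, he⟩ := hf
  refine ⟨L, hL, fun y => fderiv 𝕜 A y (res L (Pi.single p 1)), ?_, ?_⟩
  · exact ((ContinuousLinearMap.apply 𝕜 𝕜 (res L (Pi.single p (1 : 𝕜)))).analyticAt _).fun_comp
      (g := fun l : (L → 𝕜) →L[𝕜] 𝕜 => l (res L (Pi.single p (1 : 𝕜)))) hA.fderiv
  · have h1 : ∀ᶠ t in 𝓝 s, AnalyticAt 𝕜 A (res L t) :=
      (continuous_res L).continuousAt.eventually hA.eventually_analyticAt
    filter_upwards [h1, he.eventually_nhds] with u h2 h3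
    exact (pd_eq_of_res p h2 h3).deriv

/-- The chain rule along a curve. -/
theorem AnalyticIn.hasDerivAt_comp {Λ : Finset (ℤ × ℤ)} {u : ℤ × ℤ → 𝕜}
    (hf : AnalyticIn (Λ : Set (ℤ × ℤ)) u f)
    {γ : 𝕜 → (ℤ × ℤ → 𝕜)} {t : 𝕜} {w : ℤ × ℤ → 𝕜} (hγ : γ t = u) (hc : ContinuousAt γ t)
    (hd : ∀ p ∈ Λ, HasDerivAt (fun x => γ x p) (w p) t) :
    HasDerivAt (fun x => f (γ x)) (∑ p ∈ Λ, QuadGraph.pd p f u * w p) t := by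
  classical
  obtain ⟨L, hL, A, hA, he⟩ := hf
  have hL' : L ⊆ Λ := by exact_mod_cast hL
  convert hasDerivAt_comp_of_res hA he hγ hc fun p hp => hd p (hL' hp) using 1
  have h1 : ∀ p, QuadGraph.pd p f u = fderiv 𝕜 A (res L u) (res L (Pi.single p 1)) := fun p =>
    (pd_eq_of_res p hA he).deriv
  have h2 : res L w = ∑ p ∈ Λ, w p • (res L (Pi.single p 1)) := by
    funext q
    simp only [res, Finset.sum_apply, Pi.smul_apply, smul_eq_mul]
    rw [Finset.sum_eq_single (q : ℤ × ℤ)]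
    · simp
    · intro b _ hb
      rw [Pi.single_eq_of_ne (Ne.symm hb), mul_zero]
    · intro h; exact absurd (hL' q.2) h
  rw [h2, map_sum]
  refine Finset.sum_congr rfl fun p _ => ?_
  rw [map_smul, smul_eq_mul, h1, mul_comm]

theorem pd_congr {u : ℤ × ℤ → 𝕜} (h : f =ᶠ[𝓝 u] g) (p : ℤ × ℤ) : pd p f u = pd p g u := by
  refine Filter.EventuallyEq.deriv_eq ?_
  have h1 : Tendsto (fun t => Function.update u p t) (𝓝 (u p)) (𝓝 u) := by
    have := (continuous_update_right u p).tendsto (u p)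
    rwa [Function.update_eq_self] at this
  exact h1.eventually h

theorem pd_add {u : ℤ × ℤ → 𝕜} (hf : AnalyticIn K u f) (hg : AnalyticIn K' u g) (p : ℤ × ℤ) :
    pd p (fun v => f v + g v) u = pd p f u + pd p g u :=
  ((hf.hasDerivAt_pd p).add (hg.hasDerivAt_pd p)).deriv

theorem pd_mul {u : ℤ × ℤ → 𝕜} (hf : AnalyticIn K u f) (hg : AnalyticIn K' u g) (p : ℤ × ℤ) :
    pd p (fun v => f v * g v) u = pd p f u * g u + f u * pd p g u := by
  have := ((hf.hasDerivAt_pd p).fun_mul (hg.hasDerivAt_pd p)).deriv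
  simpa only [pd, Function.update_eq_self] using this

theorem pd_div {u : ℤ × ℤ → 𝕜} (hf : AnalyticIn K u f) (hg : AnalyticIn K' u g) (h0 : g u ≠ 0)
    (p : ℤ × ℤ) :
    pd p (fun v => f v / g v) u = (pd p f u * g u - f u * pd p g u) / g u ^ 2 := by
  have := ((hf.hasDerivAt_pd p).fun_div (hg.hasDerivAt_pd p) (by simpa using h0)).deriv
  simpa only [pd, Function.update_eq_self] using this

theorem pd_coord (p q : ℤ × ℤ) (u : ℤ × ℤ → 𝕜) :
    pd p (fun v => v q) u = if q = p then 1 else 0 := by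
  rw [pd, (hasDerivAt_update_apply u p q).deriv, Pi.single_apply]

/-- A function of coordinates in `K` does not change in other directions. -/
theorem AnalyticIn.pd_eq_zero {u : ℤ × ℤ → 𝕜} (hf : AnalyticIn K u f) {p : ℤ × ℤ} (hp : p ∉ K) :
    QuadGraph.pd p f u = 0 := by
  obtain ⟨L, hL, A, hA, he⟩ := hf
  rw [QuadGraph.pd, (pd_eq_of_res p hA he).deriv]
  have : res L (Pi.single p (1 : 𝕜)) = 0 := by
    funext q
    have : (q : ℤ × ℤ) ≠ p := fun h => hp (h ▸ hL q.2)
    simp [res, this]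
  rw [this, map_zero]

end Scalar

end QuadGraph

/-! ### Convex neighbourhoods, the identity theorem, removal of a variable, gluing. -/

namespace QuadGraph

variable {𝕜 : Type*} [RCLike 𝕜]

/-- The vertices with coordinates of absolute value at most `n`. -/
noncomputable def window (n : ℕ) : Finset (ℤ × ℤ) :=
  Finset.Icc (-(n : ℤ)) n ×ˢ Finset.Icc (-(n : ℤ)) n

theorem mem_window {n : ℕ} {p : ℤ × ℤ} : p ∈ window n ↔ |p.1| ≤ n ∧ |p.2| ≤ n := by
  simp [window, abs_le]

theorem window_mono {m n : ℕ} (h : m ≤ n) : window m ⊆ window n := by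
  intro p hp
  rw [mem_window] at hp ⊢
  have : (m : ℤ) ≤ n := by exact_mod_cast h
  exact ⟨hp.1.trans this, hp.2.trans this⟩

theorem eventually_mem_window (p : ℤ × ℤ) : ∀ᶠ n : ℕ in atTop, p ∈ window n := by
  filter_upwards [eventually_ge_atTop (max p.1.natAbs p.2.natAbs)] with n hn
  rw [mem_window]
  have := max_le_iff.1 hn
  rw [Int.abs_eq_natAbs, Int.abs_eq_natAbs]
  omega

/-- A basis of convex neighbourhoods. -/
def box (s : ℤ × ℤ → 𝕜) (n : ℕ) : Set (ℤ × ℤ → 𝕜) :=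
  {u | ∀ q ∈ window n, ‖u q - s q‖ < (2⁻¹ : ℝ) ^ n}

theorem self_mem_box (s : ℤ × ℤ → 𝕜) (n : ℕ) : s ∈ box s n := by
  intro q _; simp

theorem isOpen_box (s : ℤ × ℤ → 𝕜) (n : ℕ) : IsOpen (box s n) := by
  have : box s n = ⋂ q ∈ window n, {u | ‖u q - s q‖ < (2⁻¹ : ℝ) ^ n} := by
    ext u; simp [box]
  rw [this]
  refine isOpen_biInter_finset fun q _ => isOpen_lt ?_ continuous_const
  exact ((continuous_apply q).sub continuous_const).norm

theorem box_mem_nhds (s : ℤ × ℤ → 𝕜) (n : ℕ) : box s n ∈ 𝓝 s :=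
  (isOpen_box s n).mem_nhds (self_mem_box s n)

theorem box_anti (s : ℤ × ℤ → 𝕜) {m n : ℕ} (h : m ≤ n) : box s n ⊆ box s m := fun _ hu q hq =>
  (hu q (window_mono h hq)).trans_le (pow_le_pow_of_le_one (by norm_num) (by norm_num) h)

theorem exists_box_subset {s : ℤ × ℤ → 𝕜} {U : Set (ℤ × ℤ → 𝕜)} (hU : U ∈ 𝓝 s) :
    ∃ n, box s n ⊆ U := by
  rw [nhds_pi, Filter.mem_pi'] at hU
  obtain ⟨I, t, ht, hI⟩ := hU
  have h1 : ∀ᶠ n : ℕ in atTop, ∀ i ∈ I, i ∈ window n ∧ Metric.ball (s i) ((2⁻¹ : ℝ) ^ n) ⊆ t i := by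
    rw [eventually_all_finset]
    intro i _
    obtain ⟨ε, hε, hb⟩ := Metric.mem_nhds_iff.1 (ht i)
    have h2 : ∀ᶠ n : ℕ in atTop, (2⁻¹ : ℝ) ^ n < ε :=
      (tendsto_pow_atTop_nhds_zero_of_lt_one (by norm_num) (by norm_num)).eventually_lt_const hε
    filter_upwards [eventually_mem_window i, h2] with n h3 h4
    exact ⟨h3, (Metric.ball_subset_ball h4.le).trans hb⟩
  obtain ⟨n, hn⟩ := h1.exists
  refine ⟨n, fun u hu => hI fun i hi => (hn i hi).2 ?_⟩
  rw [Metric.mem_ball, dist_eq_norm]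
  exact hu i (hn i hi).1

theorem exists_box_forall {s : ℤ × ℤ → 𝕜} {P : (ℤ × ℤ → 𝕜) → Prop} (h : ∀ᶠ u in 𝓝 s, P u) :
    ∃ n, ∀ u ∈ box s n, P u :=
  exists_box_subset h

theorem convex_box (s : ℤ × ℤ → 𝕜) (n : ℕ) : Convex ℝ (box s n) := by
  have : box s n = ⋂ q ∈ window n,
      (LinearMap.proj (R := ℝ) (φ := fun _ : ℤ × ℤ => 𝕜) q) ⁻¹'
        Metric.ball (s q) ((2⁻¹ : ℝ) ^ n) := by
    ext u; simp [box, dist_eq_norm]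
  rw [this]
  exact convex_iInter₂ fun q _ => (convex_ball _ _).linear_preimage _

theorem update_mem_box {s u v : ℤ × ℤ → 𝕜} {n : ℕ} (hu : u ∈ box s n) (hv : v ∈ box s n)
    (p : ℤ × ℤ) : Function.update u p (v p) ∈ box s n := by
  intro q hq
  by_cases h : q = p
  · subst h; simpa using hv q hq
  · simpa [h] using hu q hq

/-- The triangle inequality with three radii, each at most a quarter of the radius of the large box.
It confines an overlap of two boxes to a region where both local functions are analytic. -/
theorem mem_box_and_subset {s t u : ℤ × ℤ → 𝕜} {m n : ℕ} (hmn : m ≤ n) (hs : u ∈ box s (m + 2))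
    (ht : u ∈ box t (n + 2)) : t ∈ box s m ∧ box t (n + 2) ⊆ box s m := by
  have h4 : (2⁻¹ : ℝ) ^ (n + 2) ≤ (2⁻¹ : ℝ) ^ (m + 2) :=
    pow_le_pow_of_le_one (by norm_num) (by norm_num) (by omega)
  have h5 : (2⁻¹ : ℝ) ^ (m + 2) = 2⁻¹ ^ m / 4 := by rw [pow_add]; norm_num; ring
  have h6 : (0 : ℝ) < 2⁻¹ ^ m := by positivity
  have key : ∀ v ∈ box t (n + 2), v ∈ box s m := by
    intro v hv q hq
    have h1 := hs q (window_mono (by omega) hq)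
    have h2 := ht q (window_mono (by omega) hq)
    have h3 := hv q (window_mono (by omega) hq)
    have h7 : ‖v q - s q‖ ≤ ‖v q - t q‖ + ‖u q - t q‖ + ‖u q - s q‖ := by
      calc ‖v q - s q‖ = ‖(v q - t q) - (u q - t q) + (u q - s q)‖ := by congr 1; ring
        _ ≤ _ := (norm_add_le _ _).trans (by gcongr; exact norm_sub_le _ _)
    linarith
  exact ⟨key t (self_mem_box t _), key⟩

/-- The identity theorem. -/
theorem eventually_eq_zero_of_isPreconnected {U : Set (ℤ × ℤ → 𝕜)} (hU : IsPreconnected U)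
    {f : (ℤ × ℤ → 𝕜) → 𝕜} {K : Set (ℤ × ℤ)} (hf : ∀ u ∈ U, AnalyticIn K u f)
    {s : ℤ × ℤ → 𝕜} (hs : s ∈ U) (h0 : ∀ᶠ u in 𝓝 s, f u = 0) :
    ∀ u ∈ U, ∀ᶠ v in 𝓝 u, f v = 0 := by
  refine hU.subset_of_closure_inter_subset (u := {u | ∀ᶠ v in 𝓝 u, f v = 0})
    isOpen_setOfPred_eventually_nhds ⟨s, hs, h0⟩ ?_
  rintro t ⟨h1, h2⟩
  by_contra h3
  have h4 : ∃ᶠ v in 𝓝 t, f v ≠ 0 := fun h => h3 (h.mono fun _ hv => not_not.1 hv)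
  have h5 := (hf t h2).eventually_frequently_ne h4
  obtain ⟨v, hv, hv'⟩ := ((mem_closure_iff_frequently.1 h1).and_eventually h5).exists
  exact hv' (hv.mono fun _ h => not_not.2 h)

/-- If a quotient of analytic functions does not change in the direction of the coordinate `u p`,
it is a quotient of analytic functions of the other coordinates. -/
theorem exists_quotient_without {K : Set (ℤ × ℤ)} {p : ℤ × ℤ}
    {s : ℤ × ℤ → 𝕜} {A B : (ℤ × ℤ → 𝕜) → 𝕜} (hA : AnalyticIn (insert p K) s A)
    (hB : AnalyticIn (insert p K) s B) (hB0 : ∃ᶠ u in 𝓝 s, B u ≠ 0)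
    (h : ∀ᶠ u in 𝓝 s, pd p A u * B u = A u * pd p B u) :
    ∃ A' B', AnalyticIn K s A' ∧ AnalyticIn K s B' ∧ (∃ᶠ u in 𝓝 s, B' u ≠ 0) ∧
      ∀ᶠ u in 𝓝 s, A u * B' u = A' u * B u := by
  obtain ⟨n, hn⟩ := exists_box_forall (hA.eventually.and (hB.eventually.and h))
  obtain ⟨u₀, hu₀, hu₀'⟩ := (hB0.and_eventually (box_mem_nhds s n)).exists
  set Ψ : (ℤ × ℤ → 𝕜) → (ℤ × ℤ → 𝕜) := fun u => Function.update u p (u₀ p) with hΨ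
  have hc : Continuous Ψ := continuous_id.update p continuous_const
  have hmem : ∀ u ∈ box s n, Ψ u ∈ box s n := fun u hu => update_mem_box hu hu₀' p
  have hK : ∀ (u : ℤ × ℤ → 𝕜), ∀ q ∈ insert p K, AnalyticIn K u fun v => Ψ v q := by
    intro u q hq
    by_cases hqp : q = p
    · subst hqp; simpa [Ψ] using AnalyticIn.const K u (u₀ q)
    · have hq' : q ∈ K := Set.mem_of_mem_insert_of_ne hq hqp
      simpa [Ψ, hqp] using AnalyticIn.coord (s := u) hq'
  have hA' : ∀ u ∈ box s n, AnalyticIn K u fun v => A (Ψ v) := fun u hu =>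
    (hn _ (hmem u hu)).1.comp_map hc.continuousAt (hK u)
  have hB' : ∀ u ∈ box s n, AnalyticIn K u fun v => B (Ψ v) := fun u hu =>
    (hn _ (hmem u hu)).2.1.comp_map hc.continuousAt (hK u)
  have hconn : IsPreconnected (box s n) := (convex_box s n).isPreconnected
  have hΨ₀ : Ψ u₀ = u₀ := Function.update_eq_self _ _
  refine ⟨_, _, hA' s (self_mem_box s n), hB' s (self_mem_box s n), ?_, ?_⟩
  · intro h0
    simp only [not_not] at h0
    have := (eventually_eq_zero_of_isPreconnected hconn hB' (self_mem_box s n) h0 u₀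
      hu₀').self_of_nhds
    rw [hΨ₀] at this
    exact hu₀ this
  · have hB₀ : ∀ᶠ u in 𝓝 u₀, B u ≠ 0 := (hn u₀ hu₀').2.1.continuousAt.eventually_ne hu₀
    obtain ⟨m, hm⟩ := exists_box_forall (hB₀.and ((isOpen_box s n).mem_nhds hu₀'))
    -- Near `u₀` one may divide by `B`: the quotient has zero derivative along the segment from `u`
    -- to `Ψ u`, hence equal values at its ends. The identity then spreads over the box to `s`.
    have hloc : ∀ᶠ u in 𝓝 u₀, A u * B (Ψ u) - A (Ψ u) * B u = 0 := by
      filter_upwards [box_mem_nhds u₀ m] with u hu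
      have hcv : Convex ℝ {t : 𝕜 | Function.update u p t ∈ box u₀ m} := by
        intro x hx y hy a b ha hb hab
        have := convex_box u₀ m hx hy ha hb hab
        refine Set.mem_ofPred_eq ▸ ?_
        convert this using 1
        funext q
        by_cases hq : q = p
        · subst hq; simp
        · simp [hq, ← add_smul, hab]
      have hder : ∀ t ∈ {t : 𝕜 | Function.update u p t ∈ box u₀ m},
          HasDerivWithinAt (fun t => A (Function.update u p t) / B (Function.update u p t)) 0
            {t : 𝕜 | Function.update u p t ∈ box u₀ m} t := by
        intro t ht
        obtain ⟨hv1, hv2⟩ := hm _ ht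
        obtain ⟨hv3, hv4, hv5⟩ := hn _ hv2
        have h1 := (hv3.hasDerivAt_pd p).fun_div (hv4.hasDerivAt_pd p) (by simpa using hv1)
        simp only [Function.update_idem, Function.update_self] at h1
        rw [hv5, sub_self, zero_div] at h1
        exact h1.hasDerivWithinAt
      have h2 := hcv.norm_image_sub_le_of_norm_hasDerivWithin_le (C := 0) hder (by simp)
        (x := u p) (y := u₀ p) (by simpa using hu) (update_mem_box hu (self_mem_box u₀ m) p)
      rw [zero_mul, norm_le_zero_iff, sub_eq_zero] at h2
      simp only [Function.update_eq_self] at h2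
      have h3 : B (Ψ u) ≠ 0 := (hm _ (update_mem_box hu (self_mem_box u₀ m) p)).1
      have h4 : B u ≠ 0 := (hm _ hu).1
      rw [div_eq_div_iff h3 h4] at h2
      rw [← h2, sub_self]
    have hAn : ∀ u ∈ box s n, AnalyticIn Set.univ u
        fun u => A u * B (Ψ u) - A (Ψ u) * B u := fun u hu =>
      (((hn u hu).1.mono (Set.subset_univ _)).mul ((hB' u hu).mono (Set.subset_univ _))).sub
        (((hA' u hu).mono (Set.subset_univ _)).mul ((hn u hu).2.1.mono (Set.subset_univ _)))
    exact (eventually_eq_zero_of_isPreconnected hconn hAn hu₀' hloc s (self_mem_box s n)).mono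
      fun u hu => sub_eq_zero.1 hu

/-- Coherent families of quotients of analytic functions near the members of `S` come from one
function. -/
theorem exists_glue {S : Set (ℤ × ℤ → 𝕜)} {n d : (ℤ × ℤ → 𝕜) → (ℤ × ℤ → 𝕜) → 𝕜}
    (hn : ∀ s ∈ S, AnalyticIn Set.univ s (n s)) (hd : ∀ s ∈ S, AnalyticIn Set.univ s (d s))
    (hco : ∀ s ∈ S, ∀ᶠ t in 𝓝 s, t ∈ S → ∀ᶠ u in 𝓝 t, n s u * d t u = n t u * d s u) :
    ∃ g : (ℤ × ℤ → 𝕜) → 𝕜, ∀ s ∈ S, ∀ᶠ u in 𝓝 s, d s u ≠ 0 → g u = n s u / d s u := by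
  classical
  have h1 : ∀ s ∈ S, ∃ m, ∀ u ∈ box s m, AnalyticIn Set.univ u (n s) ∧
      AnalyticIn Set.univ u (d s) ∧ (u ∈ S → ∀ᶠ v in 𝓝 u, n s v * d u v = n u v * d s v) :=
    fun s hs => exists_box_forall
      ((hn s hs).eventually.and ((hd s hs).eventually.and (hco s hs)))
  choose! m hm using h1
  -- Coherence is assumed only near `t`; the identity theorem on the smaller box extends it to the
  -- whole overlap. After that, the value obtained from any member of `S` with non-zero denominator
  -- is the same.
  have key : ∀ s ∈ S, ∀ t ∈ S, m s ≤ m t → ∀ u, u ∈ box s (m s + 2) → u ∈ box t (m t + 2) →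
      n s u * d t u = n t u * d s u := by
    intro s hs t ht hst u hus hut
    obtain ⟨h2, h3⟩ := mem_box_and_subset hst hus hut
    have h4 := (hm s hs t h2).2.2 ht
    have hAn : ∀ v ∈ box t (m t + 2), AnalyticIn Set.univ v
        fun v => n s v * d t v - n t v * d s v := fun v hv =>
      have a := hm s hs v (h3 hv)
      have b := hm t ht v (box_anti t (by omega) hv)
      (a.1.mul b.2.1).sub (b.1.mul a.2.1)
    exact sub_eq_zero.1 (eventually_eq_zero_of_isPreconnected
      (convex_box t (m t + 2)).isPreconnected hAn (self_mem_box t _)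
      (h4.mono fun v hv => sub_eq_zero.2 hv) u hut).self_of_nhds
  have key' : ∀ s ∈ S, ∀ t ∈ S, ∀ u, u ∈ box s (m s + 2) → u ∈ box t (m t + 2) →
      n s u * d t u = n t u * d s u := by
    intro s hs t ht u hus hut
    rcases le_total (m s) (m t) with h | h
    · exact key s hs t ht h u hus hut
    · exact (key t ht s hs h u hut hus).symm
  refine ⟨fun u => if h : ∃ s ∈ S, u ∈ box s (m s + 2) ∧ d s u ≠ 0 then
    n h.choose u / d h.choose u else 0, fun s hs => ?_⟩
  filter_upwards [box_mem_nhds s (m s + 2)] with u hu hdu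
  have h : ∃ s ∈ S, u ∈ box s (m s + 2) ∧ d s u ≠ 0 := ⟨s, hs, hu, hdu⟩
  rw [dif_pos h]
  obtain ⟨ht, htu, htd⟩ := h.choose_spec
  rw [div_eq_div_iff htd hdu]
  exact key' _ ht s hs u htu hu

end QuadGraph

/-! ### The implicit function theorem and the local solution with given values on the axes. -/

namespace QuadGraph

variable {𝕜 : Type*} [RCLike 𝕜]

/-- The linear map `(v, y) ↦ (v, l v + c y)` with `c ≠ 0` as an equivalence. -/
noncomputable def shearEquiv {E : Type*} [NormedAddCommGroup E] [NormedSpace 𝕜 E] (l : E →L[𝕜] 𝕜)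
    (c : 𝕜) (hc : c ≠ 0) : (E × 𝕜) ≃L[𝕜] (E × 𝕜) :=
  ContinuousLinearEquiv.equivOfInverse
    ((ContinuousLinearMap.fst 𝕜 E 𝕜).prod
      (l.comp (ContinuousLinearMap.fst 𝕜 E 𝕜) + c • ContinuousLinearMap.snd 𝕜 E 𝕜))
    ((ContinuousLinearMap.fst 𝕜 E 𝕜).prod
      (c⁻¹ • (ContinuousLinearMap.snd 𝕜 E 𝕜 - l.comp (ContinuousLinearMap.fst 𝕜 E 𝕜))))
    (fun x => by ext <;> simp [hc])
    (fun x => by ext <;> simp [hc])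

/-- The analytic implicit function theorem for one scalar equation. -/
theorem exists_implicit {E : Type*} [NormedAddCommGroup E] [NormedSpace 𝕜 E] [CompleteSpace E]
    {H : E × 𝕜 → 𝕜} {a : E} {b : 𝕜} (hH : AnalyticAt 𝕜 H (a, b))
    (h0 : deriv (fun t => H (a, t)) b ≠ 0) :
    ∃ Z : E × 𝕜 → 𝕜, AnalyticAt 𝕜 Z (a, H (a, b)) ∧ Z (a, H (a, b)) = b ∧
      (∀ᶠ q in 𝓝 (a, b), Z (q.1, H q) = q.2) ∧
      ∀ᶠ q in 𝓝 (a, H (a, b)), H (q.1, Z q) = q.2 := by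
  set D := fderiv 𝕜 H (a, b) with hD
  have hstr : HasStrictFDerivAt H D (a, b) := hH.hasStrictFDerivAt
  set c := D (0, 1) with hc
  have hc0 : c ≠ 0 := by
    have h1 : HasDerivAt (fun t => ((a, t) : E × 𝕜)) (0, 1) b :=
      (hasDerivAt_const b a).prodMk (hasDerivAt_id' b)
    have h2 := hstr.hasFDerivAt.comp_hasDerivAt b h1
    have h3 : deriv (fun t => H (a, t)) b = c := h2.deriv
    rwa [h3] at h0
  -- The inverse function theorem is applied to `(x, y) ↦ (x, H (x, y))`; the second component of
  -- the local inverse is the implicit function.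
  set f : E × 𝕜 → E × 𝕜 := fun q => (q.1, H q) with hf
  let L := shearEquiv (D.comp (ContinuousLinearMap.inl 𝕜 E 𝕜)) c hc0
  have hfd : HasStrictFDerivAt f (L : (E × 𝕜) →L[𝕜] (E × 𝕜)) (a, b) := by
    have h1 : HasStrictFDerivAt f ((ContinuousLinearMap.fst 𝕜 E 𝕜).prod D) (a, b) :=
      hasStrictFDerivAt_fst.prodMk hstr
    convert h1 using 1
    ext x <;> simp [L, shearEquiv, hc]
    exact map_zero D
  have hfa : AnalyticAt 𝕜 f (a, b) := analyticAt_fst.prod hH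
  set Φ := hfd.toOpenPartialHomeomorph f with hΦ
  have hmem : (a, b) ∈ Φ.source := hfd.mem_toOpenPartialHomeomorph_source
  have hΦf : ⇑Φ = f := hfd.toOpenPartialHomeomorph_coe
  have hsymm : AnalyticAt 𝕜 Φ.symm (f (a, b)) := by
    have := Φ.analyticAt_symm' (i := L) hmem (by rw [hΦf]; exact hfa)
      (by rw [hΦf]; exact hfd.hasFDerivAt.fderiv)
    rwa [hΦf] at this
  have hleft : ∀ᶠ q in 𝓝 (a, b), Φ.symm (f q) = q := by
    have := Φ.eventually_left_inverse hmem
    rwa [hΦf] at this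
  have hright : ∀ᶠ q in 𝓝 (f (a, b)), f (Φ.symm q) = q := by
    have := Φ.eventually_right_inverse' hmem
    rwa [hΦf] at this
  refine ⟨fun q => (Φ.symm q).2, analyticAt_snd.fun_comp hsymm, ?_, ?_, ?_⟩
  · exact congrArg Prod.snd hleft.self_of_nhds
  · exact hleft.mono fun q hq => congrArg Prod.snd hq
  · refine hright.mono fun q hq => ?_
    have h1 : (f (Φ.symm q)).1 = q.1 := by rw [hq]
    have h2 : (f (Φ.symm q)).2 = q.2 := by rw [hq]
    change (Φ.symm q).1 = q.1 at h1
    change H (Φ.symm q) = q.2 at h2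
    rw [← h2, ← h1]

section Extension

@[fun_prop]
theorem analyticAt_fst_comp {E G H : Type*} [NormedAddCommGroup E] [NormedSpace 𝕜 E]
    [NormedAddCommGroup G] [NormedSpace 𝕜 G] [NormedAddCommGroup H] [NormedSpace 𝕜 H]
    {f : E → G × H} {x : E} (hf : AnalyticAt 𝕜 f x) : AnalyticAt 𝕜 (fun y => (f y).1) x :=
  AnalyticAt.fun_comp (g := Prod.fst) analyticAt_fst hf

@[fun_prop]
theorem analyticAt_snd_comp {E G H : Type*} [NormedAddCommGroup E] [NormedSpace 𝕜 E]
    [NormedAddCommGroup G] [NormedSpace 𝕜 G] [NormedAddCommGroup H] [NormedSpace 𝕜 H]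
    {f : E → G × H} {x : E} (hf : AnalyticAt 𝕜 f x) : AnalyticAt 𝕜 (fun y => (f y).2) x :=
  AnalyticAt.fun_comp (g := Prod.snd) analyticAt_snd hf

variable {D : Set (𝕜 × 𝕜 × 𝕜)} {F : 𝕜 × 𝕜 × 𝕜 → 𝕜}

theorem eventually_corner_mem (hF : IsEquation D F) {s : ℤ × ℤ → 𝕜} {i j : ℤ}
    (hs : SolvesAt D F s i j) : ∀ᶠ u in 𝓝 s, corner u i j ∈ D := by
  have hc : Continuous fun u : ℤ × ℤ → 𝕜 => corner u i j :=
    (continuous_apply _).prodMk ((continuous_apply _).prodMk (continuous_apply _))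
  exact hc.continuousAt.eventually (hF.isOpen.mem_nhds hs.1)

theorem exists_solve_u11 (hF : IsEquation D F) {s : ℤ × ℤ → 𝕜} {i j : ℤ}
    (hs : SolvesAt D F s i j) : ∃ Z : 𝕜 × 𝕜 × 𝕜 → 𝕜,
      AnalyticAt 𝕜 Z (s (i, j), s (i + 1, j), s (i, j + 1)) ∧
      ∀ᶠ u in 𝓝 s, SolvesAt D F u i j ↔
        u (i + 1, j + 1) = Z (u (i, j), u (i + 1, j), u (i, j + 1)) := by
  refine ⟨F, hF.analytic _ hs.1, ?_⟩
  filter_upwards [eventually_corner_mem hF hs] with u hu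
  exact ⟨fun h => h.2, fun h => ⟨hu, h⟩⟩

/-- Solving the equation on a square for the vertex at which `F ∘ e` is differentiated. -/
theorem exists_solve_aux (hF : IsEquation D F) {s : ℤ × ℤ → 𝕜} {i j : ℤ}
    (hs : SolvesAt D F s i j) {e : (𝕜 × 𝕜) × 𝕜 → 𝕜 × 𝕜 × 𝕜} {p q r : ℤ × ℤ}
    (he : AnalyticAt 𝕜 e ((s p, s q), s r))
    (hc : ∀ u : ℤ × ℤ → 𝕜, e ((u p, u q), u r) = corner u i j)
    (h0 : deriv (fun t => F (e ((s p, s q), t))) (s r) ≠ 0) :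
    ∃ Z : (𝕜 × 𝕜) × 𝕜 → 𝕜, AnalyticAt 𝕜 Z ((s p, s q), s (i + 1, j + 1)) ∧
      ∀ᶠ u in 𝓝 s, SolvesAt D F u i j ↔
        u r = Z ((u p, u q), u (i + 1, j + 1)) := by
  have hFa : AnalyticAt 𝕜 F (e ((s p, s q), s r)) := by rw [hc]; exact hF.analytic _ hs.1
  obtain ⟨Z, hZ, hZ0, hl, hr⟩ := exists_implicit (H := fun x => F (e x))
    (a := (s p, s q)) (b := s r) (hFa.fun_comp he) h0
  rw [hc, ← hs.2] at hZ hZ0 hr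
  refine ⟨Z, hZ, ?_⟩
  have c1 : Continuous fun u : ℤ × ℤ → 𝕜 => ((u p, u q), u r) :=
    ((continuous_apply _).prodMk (continuous_apply _)).prodMk (continuous_apply _)
  have c2 : Continuous fun u : ℤ × ℤ → 𝕜 => ((u p, u q), u (i + 1, j + 1)) :=
    ((continuous_apply _).prodMk (continuous_apply _)).prodMk (continuous_apply _)
  filter_upwards [eventually_corner_mem hF hs, c1.continuousAt.eventually hl,
    c2.continuousAt.eventually hr] with u h1 h2 h3
  constructor
  · intro h
    rw [hc, ← h.2] at h2
    exact h2.symm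
  · intro h
    rw [← h, hc] at h3
    exact ⟨h1, h3.symm⟩

/-- The sign attached to a quadrant. -/
def sgn (σ : Bool) : ℤ := if σ then 1 else -1

/-- The vertex `(±k, ±l)`. -/
def vertex (σ τ : Bool) (k l : ℕ) : ℤ × ℤ := (sgn σ * k, sgn τ * l)

/-- The lower left coordinate of the segment from `±k` to `±(k + 1)`. -/
def lower (σ : Bool) (k : ℕ) : ℤ := if σ then k else -k - 1

/-- In each quadrant the square must be solved for the vertex farthest from the origin. This is
u_{1,1}, u_{0,1}, u_{1,0} or u, according to the quadrant. The first case is the equation itself,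
the other three use the three non-vanishing derivatives of `F`. -/
theorem exists_solve (hF : IsEquation D F) {s : ℤ × ℤ → 𝕜} (hs : ∀ i j, SolvesAt D F s i j)
    (σ τ : Bool) (k l : ℕ) : ∃ Z : 𝕜 × 𝕜 × 𝕜 → 𝕜,
      AnalyticAt 𝕜 Z (s (vertex σ τ k l), s (vertex σ τ (k + 1) l), s (vertex σ τ k (l + 1))) ∧
      ∀ᶠ u in 𝓝 s, SolvesAt D F u (lower σ k) (lower τ l) ↔ u (vertex σ τ (k + 1) (l + 1)) =
        Z (u (vertex σ τ k l), u (vertex σ τ (k + 1) l), u (vertex σ τ k (l + 1))) := by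
  have hA : ∀ n : ℕ, (-(n : ℤ) - 1 + 1) = -n := fun n => by ring
  have hB : ∀ n : ℕ, (-1 + -(n : ℤ)) = -n - 1 := fun n => by ring
  have hneg : ∀ n : ℕ, (-((n : ℤ) + 1)) = -n - 1 := fun n => by ring
  cases σ <;> cases τ
  · obtain ⟨Z, hZ, h⟩ := exists_solve_aux hF (hs (-k - 1) (-l - 1))
      (e := fun x => (x.2, x.1.1, x.1.2)) (p := (-k - 1 + 1, -l - 1)) (q := (-k - 1, -l - 1 + 1))
      (r := (-k - 1, -l - 1)) (by fun_prop) (fun u => rfl)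
      (hF.deriv_u _ _ _ (hs (-k - 1) (-l - 1)).1)
    simp only [hA] at hZ h
    refine ⟨fun x => Z ((x.2.2, x.2.1), x.1), ?_, ?_⟩
    · simp only [vertex, sgn, Bool.false_eq_true, if_false, Nat.cast_add, Nat.cast_one, neg_mul,
        one_mul, hneg]
      exact AnalyticAt.fun_comp (g := Z) hZ (by fun_prop)
    · simpa [vertex, sgn, lower, hneg, hB] using h
  · obtain ⟨Z, hZ, h⟩ := exists_solve_aux hF (hs (-k - 1) l)
      (e := fun x => (x.1.1, x.1.2, x.2)) (p := (-k - 1, (l : ℤ))) (q := (-k - 1 + 1, (l : ℤ)))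
      (r := (-k - 1, (l : ℤ) + 1)) (by fun_prop) (fun u => rfl)
      (hF.deriv_u01 _ _ _ (hs (-k - 1) l).1)
    simp only [hA] at hZ h
    refine ⟨fun x => Z ((x.2.1, x.1), x.2.2), ?_, ?_⟩
    · simp only [vertex, sgn, Bool.false_eq_true, if_false, Nat.cast_add, Nat.cast_one, neg_mul,
        one_mul, hneg, if_true]
      exact AnalyticAt.fun_comp (g := Z) hZ (by fun_prop)
    · simpa [vertex, sgn, lower, hneg, hB] using h
  · obtain ⟨Z, hZ, h⟩ := exists_solve_aux hF (hs k (-l - 1))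
      (e := fun x => (x.1.1, x.2, x.1.2)) (p := ((k : ℤ), -l - 1)) (q := ((k : ℤ), -l - 1 + 1))
      (r := ((k : ℤ) + 1, -l - 1)) (by fun_prop) (fun u => rfl)
      (hF.deriv_u10 _ _ _ (hs k (-l - 1)).1)
    simp only [hA] at hZ h
    refine ⟨fun x => Z ((x.2.2, x.1), x.2.1), ?_, ?_⟩
    · simp only [vertex, sgn, Bool.false_eq_true, if_false, Nat.cast_add, Nat.cast_one, neg_mul,
        one_mul, hneg, if_true]
      exact AnalyticAt.fun_comp (g := Z) hZ (by fun_prop)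
    · simpa [vertex, sgn, lower, hneg, hB] using h
  · obtain ⟨Z, hZ, h⟩ := exists_solve_u11 hF (hs k l)
    refine ⟨Z, ?_, ?_⟩
    · simpa [vertex, sgn] using hZ
    · simpa [vertex, sgn, lower] using h

/-- The values at the vertices of a quadrant that the values on the coordinate axes determine. -/
def extQuadrant (Z : ℕ → ℕ → 𝕜 × 𝕜 × 𝕜 → 𝕜) (σ τ : Bool) (u : ℤ × ℤ → 𝕜) : ℕ → ℕ → 𝕜
  | 0, l => u (vertex σ τ 0 l)
  | k + 1, 0 => u (vertex σ τ (k + 1) 0)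
  | k + 1, l + 1 => Z k l (extQuadrant Z σ τ u k l, extQuadrant Z σ τ u (k + 1) l,
      extQuadrant Z σ τ u k (l + 1))
termination_by k l => k + l

/-- The vertices of a window that lie on the coordinate axes. -/
noncomputable def cross (n : ℕ) : Finset (ℤ × ℤ) := {p ∈ window n | p.1 = 0 ∨ p.2 = 0}

theorem mem_cross {n : ℕ} {p : ℤ × ℤ} : p ∈ cross n ↔ p ∈ window n ∧ (p.1 = 0 ∨ p.2 = 0) := by
  simp [cross]

theorem cross_mono {m n : ℕ} (h : m ≤ n) : cross m ⊆ cross n := fun p hp => by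
  rw [mem_cross] at hp ⊢; exact ⟨window_mono h hp.1, hp.2⟩

/-- Near `s`, the map `e` replaces the values outside of the coordinate axes in such a way that the
equation becomes satisfied. -/
structure IsExt (D : Set (𝕜 × 𝕜 × 𝕜)) (F : 𝕜 × 𝕜 × 𝕜 → 𝕜) (s : ℤ × ℤ → 𝕜)
    (e : (ℤ × ℤ → 𝕜) → (ℤ × ℤ → 𝕜)) : Prop where
  analyticIn : ∀ (n : ℕ), ∀ p ∈ window n, AnalyticIn (cross n : Set (ℤ × ℤ)) s fun u => e u p
  apply_axis : ∀ u p, (p.1 = 0 ∨ p.2 = 0) → e u p = u p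
  apply_self : e s = s
  solves : ∀ i j, ∀ᶠ u in 𝓝 s, SolvesAt D F (e u) i j
  apply_eq : ∀ n : ℕ, ∀ᶠ u in 𝓝 s, (∀ i j, |i| ≤ (n : ℤ) → |j| ≤ (n : ℤ) → SolvesAt D F u i j) →
    ∀ p ∈ window n, e u p = u p

theorem vertex_mem_window {σ τ : Bool} {k l n : ℕ} :
    vertex σ τ k l ∈ window n ↔ k ≤ n ∧ l ≤ n := by
  rw [mem_window]
  cases σ <;> cases τ <;> simp [vertex, sgn]

theorem vertex_axis {σ τ : Bool} {k l : ℕ} :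
    ((vertex σ τ k l).1 = 0 ∨ (vertex σ τ k l).2 = 0) ↔ k = 0 ∨ l = 0 := by
  cases σ <;> cases τ <;> simp [vertex, sgn]

theorem eq_vertex (p : ℤ × ℤ) :
    p = vertex (decide (0 ≤ p.1)) (decide (0 ≤ p.2)) p.1.natAbs p.2.natAbs := by
  obtain ⟨a, b⟩ := p
  have h : ∀ a : ℤ, a = sgn (decide (0 ≤ a)) * a.natAbs := by
    intro a
    by_cases h : 0 ≤ a
    · simp [sgn, h, abs_of_nonneg]
    · simp [sgn, h, abs_of_neg (not_le.1 h)]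
  exact Prod.ext (h a) (h b)

theorem exists_lower (i : ℤ) : ∃ σ k, i = lower σ k := by
  by_cases h : 0 ≤ i
  · exact ⟨true, i.natAbs, by simp only [lower, if_true]; omega⟩
  · exact ⟨false, (-i - 1).natAbs, by simp only [lower, Bool.false_eq_true, if_false]; omega⟩

/-- The values on the axes are arbitrary, and each quadrant is filled square by square away from the
origin. Hence a solution near `s` is determined, on any window, by the dynamical variables, and
these are independent. This map performs the elimination of mixed shifts. -/
theorem exists_isExt (hF : IsEquation D F) {s : ℤ × ℤ → 𝕜} (hs : ∀ i j, SolvesAt D F s i j) :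
    ∃ e, IsExt D F s e := by
  choose Z hZ hsol using fun σ τ k l => exists_solve hF hs σ τ k l
  have E0 : ∀ σ τ (u : ℤ × ℤ → 𝕜) l, extQuadrant (Z σ τ) σ τ u 0 l = u (vertex σ τ 0 l) :=
    fun σ τ u l => by rw [extQuadrant]
  have E0' : ∀ σ τ (u : ℤ × ℤ → 𝕜) k, extQuadrant (Z σ τ) σ τ u k 0 = u (vertex σ τ k 0) := by
    intro σ τ u k
    cases k
    · rw [extQuadrant]
    · rw [extQuadrant]
  have E1 : ∀ σ τ (u : ℤ × ℤ → 𝕜) k l, extQuadrant (Z σ τ) σ τ u (k + 1) (l + 1) =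
      Z σ τ k l (extQuadrant (Z σ τ) σ τ u k l, extQuadrant (Z σ τ) σ τ u (k + 1) l,
      extQuadrant (Z σ τ) σ τ u k (l + 1)) := fun σ τ u k l => by rw [extQuadrant]
  -- `n` bounds `k + l`, the order in which the squares are solved; the same induction is used for
  -- analyticity and for uniqueness below.
  have hself : ∀ σ τ n k l, k + l ≤ n → extQuadrant (Z σ τ) σ τ s k l = s (vertex σ τ k l) := by
    intro σ τ n
    induction n with
    | zero => intro k l h; obtain rfl : k = 0 := by omega
              exact E0 ..
    | succ n ih =>
      intro k l h
      rcases k with _ | k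
      · exact E0 ..
      rcases l with _ | l
      · exact E0' ..
      rw [E1, ih _ _ (by omega), ih _ _ (by omega), ih _ _ (by omega)]
      exact ((hsol σ τ k l).self_of_nhds.1 (hs _ _)).symm
  have hAn : ∀ σ τ n N k l, k + l ≤ n → k ≤ N → l ≤ N → AnalyticIn (cross N : Set (ℤ × ℤ)) s
      fun u => extQuadrant (Z σ τ) σ τ u k l := by
    intro σ τ n N
    have hax : ∀ k l, k ≤ N → l ≤ N → (k = 0 ∨ l = 0) → AnalyticIn (cross N : Set (ℤ × ℤ)) s
        fun u => u (vertex σ τ k l) := fun k l hk hl h =>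
      AnalyticIn.coord (mem_cross.2 ⟨vertex_mem_window.2 ⟨hk, hl⟩, vertex_axis.2 h⟩)
    induction n with
    | zero =>
      intro k l h hk hl
      obtain rfl : k = 0 := by omega
      simpa only [E0] using hax 0 l hk hl (Or.inl rfl)
    | succ n ih =>
      intro k l h hk hl
      rcases k with _ | k
      · simpa only [E0] using hax 0 l hk hl (Or.inl rfl)
      rcases l with _ | l
      · simpa only [E0'] using hax (k + 1) 0 hk hl (Or.inr rfl)
      simp only [E1]
      refine AnalyticIn.comp (H := Z σ τ k l) ?_ ((ih k l (by omega) (by omega) (by omega)).prodMk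
        ((ih (k + 1) l (by omega) (by omega) (by omega)).prodMk
          (ih k (l + 1) (by omega) (by omega) (by omega))))
      rw [hself σ τ _ _ _ le_rfl, hself σ τ _ _ _ le_rfl, hself σ τ _ _ _ le_rfl]
      exact hZ σ τ k l
  let e : (ℤ × ℤ → 𝕜) → (ℤ × ℤ → 𝕜) := fun u p =>
    extQuadrant (Z (decide (0 ≤ p.1)) (decide (0 ≤ p.2))) (decide (0 ≤ p.1)) (decide (0 ≤ p.2)) u
      p.1.natAbs p.2.natAbs
  have haxis : ∀ u p, (p.1 = 0 ∨ p.2 = 0) → e u p = u p := by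
    intro u p hp
    rw [eq_vertex p, vertex_axis] at hp
    have h2 : u p = u (vertex (decide (0 ≤ p.1)) (decide (0 ≤ p.2)) p.1.natAbs p.2.natAbs) :=
      congrArg u (eq_vertex p)
    rw [h2]
    rcases hp with hp | hp
    · simp only [e, hp, E0]
    · simp only [e, hp, E0']
  have hsgn : ∀ σ (k : ℕ), k ≠ 0 → decide (0 ≤ sgn σ * k) = σ := by
    intro σ k hk
    have : 0 < k := Nat.pos_of_ne_zero hk
    cases σ
    · simp [sgn]; omega
    · simp [sgn]
  have habs : ∀ σ (k : ℕ), (sgn σ * (k : ℤ)).natAbs = k := by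
    intro σ k
    cases σ <;> simp [sgn]
  -- A vertex on an axis belongs to several quadrants, and `e` picks the sign of a zero coordinate
  -- arbitrarily. All choices agree, because the recursion returns the value of `u` there.
  have he : ∀ u σ τ k l, e u (vertex σ τ k l) = extQuadrant (Z σ τ) σ τ u k l := by
    intro u σ τ k l
    by_cases hk : k = 0
    · rw [haxis u _ (vertex_axis.2 (Or.inl hk)), hk, E0]
    by_cases hl : l = 0
    · rw [haxis u _ (vertex_axis.2 (Or.inr hl)), hl, E0']
    simp only [e, vertex, hsgn σ k hk, hsgn τ l hl, habs]
  have heself : e s = s := by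
    funext p
    have h2 : s p = s (vertex (decide (0 ≤ p.1)) (decide (0 ≤ p.2)) p.1.natAbs p.2.natAbs) :=
      congrArg s (eq_vertex p)
    rw [h2]
    exact hself _ _ _ _ _ le_rfl
  have hean : ∀ (n : ℕ), ∀ p ∈ window n, AnalyticIn (cross n : Set (ℤ × ℤ)) s fun u => e u p := by
    intro n p hp
    rw [eq_vertex p, vertex_mem_window] at hp
    exact hAn _ _ _ n _ _ le_rfl hp.1 hp.2
  have hcont : Tendsto e (𝓝 s) (𝓝 s) := by
    have : ContinuousAt e s := continuousAt_pi.2 fun p => by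
      obtain ⟨n, hn⟩ := (eventually_mem_window p).exists
      exact (hean n p hn).continuousAt
    rw [ContinuousAt, heself] at this
    exact this
  refine ⟨e, hean, haxis, heself, ?_, ?_⟩
  · intro i j
    obtain ⟨σ, k, rfl⟩ := exists_lower i
    obtain ⟨τ, l, rfl⟩ := exists_lower j
    filter_upwards [hcont.eventually (hsol σ τ k l)] with u hu
    rw [hu]
    simp only [he, E1]
  · intro n
    have h1 : ∀ σ τ m k l, k + l ≤ m → k ≤ n → l ≤ n → ∀ᶠ u in 𝓝 s,
        (∀ i j, |i| ≤ (n : ℤ) → |j| ≤ (n : ℤ) → SolvesAt D F u i j) →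
        extQuadrant (Z σ τ) σ τ u k l = u (vertex σ τ k l) := by
      intro σ τ m
      induction m with
      | zero =>
        intro k l h hk hl
        obtain rfl : k = 0 := by omega
        exact Eventually.of_forall fun u _ => E0 ..
      | succ m ih =>
        intro k l h hk hl
        rcases k with _ | k
        · exact Eventually.of_forall fun u _ => E0 ..
        rcases l with _ | l
        · exact Eventually.of_forall fun u _ => E0' ..
        filter_upwards [hsol σ τ k l, ih k l (by omega) (by omega) (by omega),
          ih (k + 1) l (by omega) (by omega) (by omega),
          ih k (l + 1) (by omega) (by omega) (by omega)] with u hu h2 h3 h4 hw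
        rw [E1, h2 hw, h3 hw, h4 hw]
        refine (hu.1 (hw _ _ ?_ ?_)).symm
        · cases σ <;> simp [lower, abs_le] <;> omega
        · cases τ <;> simp [lower, abs_le] <;> omega
    have h2 : ∀ᶠ u in 𝓝 s, ∀ p ∈ window n,
        (∀ i j, |i| ≤ (n : ℤ) → |j| ≤ (n : ℤ) → SolvesAt D F u i j) → e u p = u p := by
      rw [eventually_all_finset]
      intro p hp
      rw [eq_vertex p, vertex_mem_window] at hp
      filter_upwards [h1 (decide (0 ≤ p.1)) (decide (0 ≤ p.2)) _ _ _ le_rfl hp.1 hp.2] with u hu hw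
      have h2 : u p = u (vertex (decide (0 ≤ p.1)) (decide (0 ≤ p.2)) p.1.natAbs p.2.natAbs) :=
        congrArg u (eq_vertex p)
      rw [h2]
      exact hu hw
    filter_upwards [h2] with u hu hw p hp using hu p hp hw

theorem IsExt.tendsto {s : ℤ × ℤ → 𝕜} {e : (ℤ × ℤ → 𝕜) → (ℤ × ℤ → 𝕜)} (he : IsExt D F s e) :
    Tendsto e (𝓝 s) (𝓝 s) := by
  have : ContinuousAt e s := continuousAt_pi.2 fun p => by
    obtain ⟨n, hn⟩ := (eventually_mem_window p).exists
    exact (he.analyticIn n p hn).continuousAt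
  rw [ContinuousAt, he.apply_self] at this
  exact this

end Extension

end QuadGraph

/-! ### Lattice shifts and generic solutions near a member of `S`. -/

namespace QuadGraph

variable {𝕜 : Type*} [RCLike 𝕜]

theorem shift_apply (a b : ℤ) (u : ℤ × ℤ → 𝕜) (p : ℤ × ℤ) :
    shift a b u p = u (p.1 + a, p.2 + b) := rfl

theorem shift_shift (a b c d : ℤ) (u : ℤ × ℤ → 𝕜) :
    shift a b (shift c d u) = shift (a + c) (b + d) u := by
  funext p; simp [shift, add_assoc]

theorem shift_zero (u : ℤ × ℤ → 𝕜) : shift 0 0 u = u := by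
  funext p; simp [shift]

theorem continuous_shift (a b : ℤ) : Continuous (shift a b : (ℤ × ℤ → 𝕜) → ℤ × ℤ → 𝕜) :=
  continuous_pi fun p => continuous_apply (p.1 + a, p.2 + b)

variable {D : Set (𝕜 × 𝕜 × 𝕜)} {F : 𝕜 × 𝕜 × 𝕜 → 𝕜} {S : Set (ℤ × ℤ → 𝕜)}

theorem IsBase.shift_mem (hS : IsBase D F S) {s : ℤ × ℤ → 𝕜} (hs : s ∈ S) (a b : ℤ) :
    shift a b s ∈ S := by
  have h1 : ∀ (n : ℕ) (s : ℤ × ℤ → 𝕜), s ∈ S →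
      shift n 0 s ∈ S ∧ shift (-n) 0 s ∈ S ∧ shift 0 n s ∈ S ∧ shift 0 (-n) s ∈ S := by
    intro n
    induction n with
    | zero => intro s hs; simpa [shift_zero] using hs
    | succ n ih =>
      intro s hs
      obtain ⟨a1, a2, a3, a4⟩ := ih s hs
      refine ⟨?_, ?_, ?_, ?_⟩
      · have := Set.mem_image_of_mem (shift 1 0) a1
        rw [hS.shift_i, shift_shift] at this
        convert this using 2 <;> push_cast <;> ring
      · rw [← hS.shift_i] at a2
        obtain ⟨t, ht, h⟩ := a2
        have : shift (-1) 0 (shift 1 0 t) = shift (-1) 0 (shift (-n) 0 s) := by rw [h]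
        rw [shift_shift, shift_shift] at this
        norm_num [shift_zero] at this
        rw [this] at ht
        convert ht using 2; push_cast; ring
      · have := Set.mem_image_of_mem (shift 0 1) a3
        rw [hS.shift_j, shift_shift] at this
        convert this using 2 <;> push_cast <;> ring
      · rw [← hS.shift_j] at a4
        obtain ⟨t, ht, h⟩ := a4
        have : shift 0 (-1) (shift 0 1 t) = shift 0 (-1) (shift 0 (-n) s) := by rw [h]
        rw [shift_shift, shift_shift] at this
        norm_num [shift_zero] at this
        rw [this] at ht
        convert ht using 2; push_cast; ring
  have h2 : shift a 0 (shift 0 b s) ∈ S := by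
    have hb : shift 0 b s ∈ S := by
      rcases Int.eq_nat_or_neg b with ⟨n, rfl | rfl⟩
      · exact (h1 n s hs).2.2.1
      · exact (h1 n s hs).2.2.2
    rcases Int.eq_nat_or_neg a with ⟨n, rfl | rfl⟩
    · exact (h1 n _ hb).1
    · exact (h1 n _ hb).2.1
  simpa [shift_shift] using h2

/-- The union of the coordinate axes. -/
def axes : Set (ℤ × ℤ) := {p | p.1 = 0 ∨ p.2 = 0}

theorem mem_axes {p : ℤ × ℤ} : p ∈ axes ↔ p.1 = 0 ∨ p.2 = 0 := Iff.rfl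

theorem cross_subset_axes (n : ℕ) : (cross n : Set (ℤ × ℤ)) ⊆ axes := fun _ hp =>
  (mem_cross.1 hp).2

theorem genericallyNear_iff {s : ℤ × ℤ → 𝕜} {P : (ℤ × ℤ → 𝕜) → Prop} :
    GenericallyNear s P ↔ ∃ b : (ℤ × ℤ → 𝕜) → 𝕜, AnalyticIn axes s b ∧
      (∃ᶠ u in 𝓝 s, b u ≠ 0) ∧ ∀ᶠ u in 𝓝 s, b u ≠ 0 → P u := by
  constructor
  · rintro ⟨K, hK, B, hB, hB0, h⟩
    refine ⟨fun u => B (res K u), ⟨K, hK, B, hB, Eventually.of_forall fun _ => rfl⟩, ?_, h⟩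
    change ∃ᶠ y in 𝓝 (res K s), B y ≠ 0 at hB0
    rw [← map_res_nhds, frequently_map] at hB0
    exact hB0
  · rintro ⟨b, ⟨K, hK, B, hB, he⟩, hb0, h⟩
    refine ⟨K, hK, B, hB, ?_, ?_⟩
    · change ∃ᶠ y in 𝓝 (res K s), B y ≠ 0
      rw [← map_res_nhds, frequently_map]
      exact (hb0.and_eventually he).mono fun u hu => hu.2 ▸ hu.1
    · filter_upwards [h, he] with u h1 h2 h3
      exact h1 (by rw [h2]; exact h3)

/-- The equation holds on the squares of a window. -/
def SolvesOn (D : Set (𝕜 × 𝕜 × 𝕜)) (F : 𝕜 × 𝕜 × 𝕜 → 𝕜) (n : ℕ) (u : ℤ × ℤ → 𝕜) : Prop :=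
  ∀ i j, |i| ≤ (n : ℤ) → |j| ≤ (n : ℤ) → SolvesAt D F u i j

theorem SolvesOn.mono {m n : ℕ} (h : m ≤ n) {u : ℤ × ℤ → 𝕜} (hu : SolvesOn D F n u) :
    SolvesOn D F m u := fun i j hi hj =>
  hu i j (hi.trans (by exact_mod_cast h)) (hj.trans (by exact_mod_cast h))

theorem solvesAt_shift {a b i j : ℤ} {u : ℤ × ℤ → 𝕜} :
    SolvesAt D F (shift a b u) i j ↔ SolvesAt D F u (i + a) (j + b) := by
  have h1 : corner (shift a b u) i j = corner u (i + a) (j + b) := by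
    simp only [corner, shift, add_right_comm]
  unfold SolvesAt
  rw [h1]
  simp only [shift, add_right_comm]

theorem SolvesOn.shift {n : ℕ} {a b : ℤ} {u : ℤ × ℤ → 𝕜}
    (hu : SolvesOn D F (n + a.natAbs + b.natAbs) u) : SolvesOn D F n (shift a b u) := by
  intro i j hi hj
  rw [solvesAt_shift]
  refine hu _ _ ?_ ?_
  · have := abs_add_le i a; have := Int.natCast_natAbs a; have := abs_nonneg b
    have := Int.natCast_natAbs b; push_cast; omega
  · have := abs_add_le j b; have := Int.natCast_natAbs a; have := abs_nonneg a
    have := Int.natCast_natAbs b; push_cast; omega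

theorem IsExt.solvesOn {s : ℤ × ℤ → 𝕜} {e : (ℤ × ℤ → 𝕜) → (ℤ × ℤ → 𝕜)} (he : IsExt D F s e)
    (n : ℕ) : ∀ᶠ u in 𝓝 s, SolvesOn D F n (e u) := by
  have h : ∀ᶠ u in 𝓝 s, ∀ p ∈ window n, SolvesAt D F (e u) p.1 p.2 := by
    rw [eventually_all_finset]
    exact fun p _ => he.solves p.1 p.2
  filter_upwards [h] with u hu i j hi hj
  exact hu (i, j) (mem_window.2 ⟨hi, hj⟩)

theorem IsExt.analyticIn_axes {s : ℤ × ℤ → 𝕜} {e : (ℤ × ℤ → 𝕜) → (ℤ × ℤ → 𝕜)}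
    (he : IsExt D F s e) (p : ℤ × ℤ) : AnalyticIn axes s fun u => e u p := by
  obtain ⟨n, hn⟩ := (eventually_mem_window p).exists
  exact (he.analyticIn n p hn).mono (cross_subset_axes n)

/-- Generic points near `s` that satisfy the equation on a sufficiently large window. -/
def solFilter (D : Set (𝕜 × 𝕜 × 𝕜)) (F : 𝕜 × 𝕜 × 𝕜 → 𝕜) (s : ℤ × ℤ → 𝕜) :
    Filter (ℤ × ℤ → 𝕜) where
  sets := {P | ∃ n : ℕ, ∃ b : (ℤ × ℤ → 𝕜) → 𝕜, AnalyticIn axes s b ∧ (∃ᶠ u in 𝓝 s, b u ≠ 0) ∧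
    ∀ᶠ u in 𝓝 s, b u ≠ 0 → SolvesOn D F n u → u ∈ P}
  univ_sets := ⟨0, fun _ => 1, AnalyticIn.const _ _ _,
    (Eventually.of_forall fun _ => one_ne_zero).frequently, by simp⟩
  sets_of_superset := by
    rintro P Q ⟨n, b, hb, hb0, h⟩ hPQ
    exact ⟨n, b, hb, hb0, h.mono fun u hu h1 h2 => hPQ (hu h1 h2)⟩
  inter_sets := by
    rintro P Q ⟨n, b, hb, hb0, h⟩ ⟨m, c, hc, hc0, h'⟩
    refine ⟨max n m, fun u => b u * c u, hb.mul hc, hb.frequently_mul_ne hc hb0 hc0, ?_⟩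
    filter_upwards [h, h'] with u h1 h2 h3 h4
    exact ⟨h1 (left_ne_zero_of_mul h3) (h4.mono (le_max_left _ _)),
      h2 (right_ne_zero_of_mul h3) (h4.mono (le_max_right _ _))⟩

variable {s : ℤ × ℤ → 𝕜}

theorem eventually_solFilter {P : (ℤ × ℤ → 𝕜) → Prop} : (∀ᶠ u in solFilter D F s, P u) ↔
    ∃ n : ℕ, ∃ b : (ℤ × ℤ → 𝕜) → 𝕜, AnalyticIn axes s b ∧ (∃ᶠ u in 𝓝 s, b u ≠ 0) ∧
      ∀ᶠ u in 𝓝 s, b u ≠ 0 → SolvesOn D F n u → P u := Iff.rfl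

theorem solFilter_le_nhds : solFilter D F s ≤ 𝓝 s := fun P hP =>
  eventually_solFilter.2 ⟨0, fun _ => 1, AnalyticIn.const _ _ _,
    (Eventually.of_forall fun _ => one_ne_zero).frequently,
    (show ∀ᶠ u in 𝓝 s, u ∈ P from hP).mono fun _ h _ _ => h⟩

theorem eventually_solvesOn (n : ℕ) : ∀ᶠ u in solFilter D F s, SolvesOn D F n u :=
  eventually_solFilter.2 ⟨n, fun _ => 1, AnalyticIn.const _ _ _,
    (Eventually.of_forall fun _ => one_ne_zero).frequently,
    Eventually.of_forall fun _ _ h => h⟩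

theorem AnalyticIn.eventually_ne {b : (ℤ × ℤ → 𝕜) → 𝕜} (hb : AnalyticIn axes s b)
    (h0 : ∃ᶠ u in 𝓝 s, b u ≠ 0) : ∀ᶠ u in solFilter D F s, b u ≠ 0 :=
  eventually_solFilter.2 ⟨0, b, hb, h0, Eventually.of_forall fun _ h _ => h⟩

theorem GenericallyNear.eventually {P : (ℤ × ℤ → 𝕜) → Prop} {N : ℤ}
    (h : GenericallyNear s fun u => (∀ i j, |i| ≤ N → |j| ≤ N → SolvesAt D F u i j) → P u) :
    ∀ᶠ u in solFilter D F s, P u := by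
  obtain ⟨b, hb, hb0, h⟩ := genericallyNear_iff.1 h
  refine eventually_solFilter.2 ⟨N.natAbs, b, hb, hb0, h.mono fun u hu h1 h2 => hu h1 ?_⟩
  exact fun i j hi hj => h2 i j (hi.trans Int.le_natAbs) (hj.trans Int.le_natAbs)

theorem IsExt.eventually_eq {e : (ℤ × ℤ → 𝕜) → (ℤ × ℤ → 𝕜)} (he : IsExt D F s e) (p : ℤ × ℤ) :
    ∀ᶠ u in solFilter D F s, e u p = u p := by
  obtain ⟨n, hn⟩ := (eventually_mem_window p).exists
  filter_upwards [eventually_solvesOn n, solFilter_le_nhds (he.apply_eq n)] with u h1 h2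
  exact h2 h1 p hn

/-- Extension turns every nearby `u` into a solution on the required window without moving the
dynamical variables, so the exceptional set stays the same. -/
theorem IsExt.eventually_comp {e : (ℤ × ℤ → 𝕜) → (ℤ × ℤ → 𝕜)} (he : IsExt D F s e)
    {P : (ℤ × ℤ → 𝕜) → Prop} (h : ∀ᶠ u in solFilter D F s, P u) :
    ∃ b : (ℤ × ℤ → 𝕜) → 𝕜, AnalyticIn axes s b ∧ (∃ᶠ u in 𝓝 s, b u ≠ 0) ∧
      ∀ᶠ u in 𝓝 s, b u ≠ 0 → P (e u) := by
  obtain ⟨n, b, hb, hb0, h⟩ := eventually_solFilter.1 h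
  refine ⟨b, hb, hb0, ?_⟩
  filter_upwards [he.tendsto.eventually h, he.solvesOn n,
    hb.eventually_map_eq he.tendsto fun p hp =>
      Eventually.of_forall fun u => he.apply_axis u p hp] with u h1 h2 h3 h4
  exact h1 (by rwa [h3]) h2

/-- Analytic functions of dynamical variables that agree on solutions are equal. -/
theorem AnalyticIn.eventuallyEq_of_solFilter (hF : IsEquation D F)
    (hs : ∀ i j, SolvesAt D F s i j) {f g : (ℤ × ℤ → 𝕜) → 𝕜} (hf : AnalyticIn axes s f)
    (hg : AnalyticIn axes s g) (h : f =ᶠ[solFilter D F s] g) : f =ᶠ[𝓝 s] g := by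
  obtain ⟨e, he⟩ := exists_isExt hF hs
  obtain ⟨b, hb, hb0, h1⟩ := he.eventually_comp h
  refine hf.eventually_eq_of_mul_eq hg hb hb0 ?_
  filter_upwards [h1, hf.eventually_map_eq he.tendsto fun p hp =>
      Eventually.of_forall fun u => he.apply_axis u p hp,
    hg.eventually_map_eq he.tendsto fun p hp =>
      Eventually.of_forall fun u => he.apply_axis u p hp] with u h2 h3 h4 h5
  rw [← h3, ← h4, h2 h5]

/-- Otherwise the constants 0 and 1 would agree on generic solutions, hence near `s`. -/
theorem solFilter_neBot (hF : IsEquation D F) (hs : ∀ i j, SolvesAt D F s i j) :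
    (solFilter D F s).NeBot := by
  refine ⟨fun h => ?_⟩
  have h1 : (fun _ => 0 : (ℤ × ℤ → 𝕜) → 𝕜) =ᶠ[𝓝 s] fun _ => 1 :=
    (AnalyticIn.const axes s (0 : 𝕜)).eventuallyEq_of_solFilter hF hs (AnalyticIn.const axes s 1)
      (by rw [h]; exact Filter.EventuallyEq.of_eq rfl |>.trans (by simp [EventuallyEq]))
  exact zero_ne_one h1.self_of_nhds

theorem eventually_eventually_solFilter {P : (ℤ × ℤ → 𝕜) → Prop}
    (h : ∀ᶠ u in solFilter D F s, P u) : ∀ᶠ t in 𝓝 s, ∀ᶠ u in solFilter D F t, P u := by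
  obtain ⟨n, b, hb, hb0, h⟩ := eventually_solFilter.1 h
  filter_upwards [hb.eventually, hb.eventually_frequently_ne hb0, h.eventually_nhds]
    with t h1 h2 h3
  exact eventually_solFilter.2 ⟨n, b, h1, h2, h3⟩

theorem analyticIn_shift_ext {e : (ℤ × ℤ → 𝕜) → (ℤ × ℤ → 𝕜)} (he : IsExt D F s e) {a b : ℤ}
    {m : ℕ} {K : Set (ℤ × ℤ)} {f : (ℤ × ℤ → 𝕜) → 𝕜}
    (hK : ∀ p ∈ K, (p.1 + a, p.2 + b) ∈ window m)
    (hf : AnalyticIn K (shift a b s) f) :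
    AnalyticIn (cross m : Set (ℤ × ℤ)) s fun u => f (shift a b (e u)) := by
  have hc : ContinuousAt e s := by
    have := he.tendsto
    rwa [← he.apply_self, ContinuousAt, he.apply_self, he.apply_self] 
  refine AnalyticIn.comp_map (Ψ := fun u => shift a b (e u)) (K := K) ?_
    ((continuous_shift a b).continuousAt.comp hc) fun p hp => he.analyticIn m _ (hK p hp)
  rwa [he.apply_self]

/-- On the dynamical variables, extending and then shifting is locally invertible: the inverse is to
extend at the shifted solution and shift back. So a non-zero function cannot become zero by virtue
of the equation. -/
theorem frequently_shift_ext (hF : IsEquation D F) (hS : IsBase D F S) (hs : s ∈ S)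
    {e : (ℤ × ℤ → 𝕜) → (ℤ × ℤ → 𝕜)} (he : IsExt D F s e) {a b : ℤ}
    {f : (ℤ × ℤ → 𝕜) → 𝕜} (hf : AnalyticIn axes (shift a b s) f)
    (h0 : ∃ᶠ u in 𝓝 (shift a b s), f u ≠ 0) : ∃ᶠ u in 𝓝 s, f (shift a b (e u)) ≠ 0 := by
  obtain ⟨e', he'⟩ := exists_isExt hF (hS.solves _ (hS.shift_mem hs a b))
  intro h
  simp only [not_not] at h
  have hT : Tendsto (fun v => shift (-a) (-b) (e' v)) (𝓝 (shift a b s)) (𝓝 s) := by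
    have := (continuous_shift (-a) (-b)).continuousAt.tendsto.comp he'.tendsto
    simpa [shift_shift, shift_zero, Function.comp_def] using this
  have h1 : ∀ᶠ v in 𝓝 (shift a b s), f (shift a b (e (shift (-a) (-b) (e' v)))) = f (e' v) := by
    refine hf.eventually_eq_of_eqOn
      (Ψ := fun v => shift a b (e (shift (-a) (-b) (e' v)))) (Φ := e') ?_ he'.tendsto ?_
    · exact ((continuous_shift a b).continuousAt.tendsto.comp he.tendsto).comp hT
    · intro p _
      obtain ⟨n, hn⟩ := (eventually_mem_window (p.1 + a, p.2 + b)).exists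
      filter_upwards [hT.eventually (he.apply_eq n),
        he'.solvesOn (n + (-a).natAbs + (-b).natAbs)] with v h2 h3
      rw [shift_apply, h2 h3.shift _ hn, shift_apply]
      simp
  apply h0
  filter_upwards [h1, hT.eventually h, hf.eventually_map_eq he'.tendsto fun p hp =>
      Eventually.of_forall fun u => he'.apply_axis u p hp] with v h2 h3 h4
  rw [← h4, ← h2, h3]
  simp

theorem IsExt.eventually_shift_eq {e : (ℤ × ℤ → 𝕜) → (ℤ × ℤ → 𝕜)} (he : IsExt D F s e)
    {a b : ℤ} {K : Set (ℤ × ℤ)} {f : (ℤ × ℤ → 𝕜) → 𝕜} (hf : AnalyticIn K (shift a b s) f) :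
    ∀ᶠ u in solFilter D F s, f (shift a b (e u)) = f (shift a b u) := by
  have hT : Tendsto (shift a b) (𝓝 s) (𝓝 (shift a b s)) := (continuous_shift a b).continuousAt
  exact hf.eventually_eq_of_eqOn (Ψ := fun u => shift a b (e u)) (Φ := fun u => shift a b u)
    ((hT.comp he.tendsto).mono_left solFilter_le_nhds) (hT.mono_left solFilter_le_nhds)
    fun p _ => he.eventually_eq _

/-- An exceptional set `f = 0` near the shifted solution pulls back to the zero set of `f` after
shift and elimination, which is again a non-zero analytic function of the dynamical variables. This
makes the shifts act on germs. -/
theorem tendsto_shift_solFilter (hF : IsEquation D F) (hS : IsBase D F S) (hs : s ∈ S) (a b : ℤ) :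
    Tendsto (shift a b) (solFilter D F s) (solFilter D F (shift a b s)) := by
  refine tendsto_iff_eventually.2 fun P hP => ?_
  obtain ⟨n, f, hf, hf0, h⟩ := eventually_solFilter.1 hP
  obtain ⟨e, he⟩ := exists_isExt hF (hS.solves s hs)
  have hT : Tendsto (shift a b) (𝓝 s) (𝓝 (shift a b s)) := (continuous_shift a b).continuousAt
  have h1 : AnalyticIn axes s fun u => f (shift a b (e u)) := by
    refine AnalyticIn.comp_map (Ψ := fun u => shift a b (e u)) (K := axes) ?_ ?_
      fun p hp => he.analyticIn_axes _
    · rwa [he.apply_self]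
    · have := hT.comp he.tendsto
      rw [ContinuousAt, he.apply_self]; exact this
  have h2 := h1.eventually_ne (D := D) (F := F) (frequently_shift_ext hF hS hs he hf hf0)
  filter_upwards [h2, he.eventually_shift_eq hf, solFilter_le_nhds (hT.eventually h),
    eventually_solvesOn (n + a.natAbs + b.natAbs)] with u h3 h4 h5 h6
  rw [h4] at h3
  exact h5 h3 h6.shift

end QuadGraph

/-! ### Meromorphic functions of the dynamical variables, the chain rule for shifts, the linearized
equation. -/

namespace QuadGraph

variable {𝕜 : Type*} [RCLike 𝕜]
variable {D : Set (𝕜 × 𝕜 × 𝕜)} {F : 𝕜 × 𝕜 × 𝕜 → 𝕜} {S : Set (ℤ × ℤ → 𝕜)}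
  {s : ℤ × ℤ → 𝕜} {K K' : Set (ℤ × ℤ)}

/-- Generic points near `s`. -/
def genFilter (s : ℤ × ℤ → 𝕜) : Filter (ℤ × ℤ → 𝕜) where
  sets := {P | ∃ b : (ℤ × ℤ → 𝕜) → 𝕜, AnalyticIn axes s b ∧ (∃ᶠ u in 𝓝 s, b u ≠ 0) ∧
    ∀ᶠ u in 𝓝 s, b u ≠ 0 → u ∈ P}
  univ_sets := ⟨fun _ => 1, AnalyticIn.const _ _ _,
    (Eventually.of_forall fun _ => one_ne_zero).frequently, by simp⟩
  sets_of_superset := by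
    rintro P Q ⟨b, hb, hb0, h⟩ hPQ
    exact ⟨b, hb, hb0, h.mono fun u hu h1 => hPQ (hu h1)⟩
  inter_sets := by
    rintro P Q ⟨b, hb, hb0, h⟩ ⟨c, hc, hc0, h'⟩
    refine ⟨fun u => b u * c u, hb.mul hc, hb.frequently_mul_ne hc hb0 hc0, ?_⟩
    filter_upwards [h, h'] with u h1 h2 h3
    exact ⟨h1 (left_ne_zero_of_mul h3), h2 (right_ne_zero_of_mul h3)⟩

theorem eventually_genFilter {P : (ℤ × ℤ → 𝕜) → Prop} : (∀ᶠ u in genFilter s, P u) ↔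
    ∃ b : (ℤ × ℤ → 𝕜) → 𝕜, AnalyticIn axes s b ∧ (∃ᶠ u in 𝓝 s, b u ≠ 0) ∧
      ∀ᶠ u in 𝓝 s, b u ≠ 0 → P u := Iff.rfl

theorem genericallyNear_iff_genFilter {P : (ℤ × ℤ → 𝕜) → Prop} :
    GenericallyNear s P ↔ ∀ᶠ u in genFilter s, P u := genericallyNear_iff

theorem genFilter_le_nhds : genFilter s ≤ 𝓝 s := fun P hP =>
  eventually_genFilter.2 ⟨fun _ => 1, AnalyticIn.const _ _ _,
    (Eventually.of_forall fun _ => one_ne_zero).frequently,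
    (show ∀ᶠ u in 𝓝 s, u ∈ P from hP).mono fun _ h _ => h⟩

theorem solFilter_le_genFilter : solFilter D F s ≤ genFilter s := by
  intro P hP
  obtain ⟨b, hb, hb0, h⟩ := eventually_genFilter.1 hP
  exact eventually_solFilter.2 ⟨0, b, hb, hb0, h.mono fun u h1 h2 _ => h1 h2⟩

theorem AnalyticIn.eventually_ne_genFilter {b : (ℤ × ℤ → 𝕜) → 𝕜} (hK : K ⊆ axes)
    (hb : AnalyticIn K s b)
    (h0 : ∃ᶠ u in 𝓝 s, b u ≠ 0) : ∀ᶠ u in genFilter s, b u ≠ 0 :=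
  eventually_genFilter.2 ⟨b, hb.mono hK, h0, Eventually.of_forall fun _ h => h⟩

/-- The complement of the exceptional set is open. Hence generic identities hold on neighbourhoods
and may be differentiated; on solutions alone this would fail, as solutions are not open. -/
theorem eventually_genFilter_nhds {P : (ℤ × ℤ → 𝕜) → Prop} (h : ∀ᶠ u in genFilter s, P u) :
    ∀ᶠ u in genFilter s, ∀ᶠ v in 𝓝 u, P v := by
  obtain ⟨b, hb, hb0, h⟩ := eventually_genFilter.1 h
  refine eventually_genFilter.2 ⟨b, hb, hb0, ?_⟩
  filter_upwards [h.eventually_nhds, hb.eventually] with u h1 h2 h3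
  filter_upwards [h1, h2.continuousAt.eventually_ne h3] with v h4 h5 using h4 h5

theorem IsExt.eventually_genFilter {e : (ℤ × ℤ → 𝕜) → (ℤ × ℤ → 𝕜)} (he : IsExt D F s e)
    {P : (ℤ × ℤ → 𝕜) → Prop} (h : ∀ᶠ u in solFilter D F s, P u) :
    ∀ᶠ u in genFilter s, P (e u) :=
  QuadGraph.eventually_genFilter.2 (he.eventually_comp h)

/-- Near `s`, `g` is a quotient of analytic functions of finitely many `u p`, `p ∈ K`. -/
def MeroIn (K : Set (ℤ × ℤ)) (s : ℤ × ℤ → 𝕜) (g : (ℤ × ℤ → 𝕜) → 𝕜) : Prop :=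
  ∃ A B : (ℤ × ℤ → 𝕜) → 𝕜, AnalyticIn K s A ∧ AnalyticIn K s B ∧ (∃ᶠ u in 𝓝 s, B u ≠ 0) ∧
    ∀ᶠ u in 𝓝 s, B u ≠ 0 → g u = A u / B u

variable {f g : (ℤ × ℤ → 𝕜) → 𝕜}

theorem MeroIn.mono (h : MeroIn K s f) (hK : K ⊆ K') : MeroIn K' s f := by
  obtain ⟨A, B, hA, hB, h⟩ := h
  exact ⟨A, B, hA.mono hK, hB.mono hK, h⟩

theorem AnalyticIn.meroIn (h : AnalyticIn K s f) : MeroIn K s f :=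
  ⟨f, fun _ => 1, h, AnalyticIn.const _ _ _,
    (Eventually.of_forall fun _ => one_ne_zero).frequently, by simp⟩

theorem MeroIn.add (hf : MeroIn K s f) (hg : MeroIn K s g) : MeroIn K s fun u => f u + g u := by
  obtain ⟨A, B, hA, hB, hB0, h⟩ := hf
  obtain ⟨A', B', hA', hB', hB0', h'⟩ := hg
  refine ⟨fun u => A u * B' u + B u * A' u, fun u => B u * B' u, (hA.mul hB').add (hB.mul hA'),
    hB.mul hB', hB.frequently_mul_ne hB' hB0 hB0', ?_⟩
  filter_upwards [h, h'] with u h1 h2 h3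
  have h4 := left_ne_zero_of_mul h3
  have h5 := right_ne_zero_of_mul h3
  rw [h1 h4, h2 h5, div_add_div _ _ h4 h5]

theorem MeroIn.mul (hf : MeroIn K s f) (hg : MeroIn K s g) : MeroIn K s fun u => f u * g u := by
  obtain ⟨A, B, hA, hB, hB0, h⟩ := hf
  obtain ⟨A', B', hA', hB', hB0', h'⟩ := hg
  refine ⟨fun u => A u * A' u, fun u => B u * B' u, hA.mul hA',
    hB.mul hB', hB.frequently_mul_ne hB' hB0 hB0', ?_⟩
  filter_upwards [h, h'] with u h1 h2 h3
  rw [h1 (left_ne_zero_of_mul h3), h2 (right_ne_zero_of_mul h3), div_mul_div_comm]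

theorem MeroIn.neg (hf : MeroIn K s f) : MeroIn K s fun u => - f u := by
  simpa using (AnalyticIn.const K s (-1 : 𝕜)).meroIn.mul hf

theorem MeroIn.inv (hf : MeroIn K s f) : MeroIn K s fun u => (f u)⁻¹ := by
  obtain ⟨A, B, hA, hB, hB0, h⟩ := hf
  by_cases hA0 : ∃ᶠ u in 𝓝 s, A u ≠ 0
  -- The fraction `B / A` is expanded by `B` so that a non-zero denominator also certifies `B u ≠
  -- 0`, where the formula for `f` is known.
  · refine ⟨fun u => B u * B u, fun u => A u * B u, hB.mul hB, hA.mul hB,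
      hA.frequently_mul_ne hB hA0 hB0, ?_⟩
    filter_upwards [h] with u h1 h2
    have h4 := left_ne_zero_of_mul h2
    have h5 := right_ne_zero_of_mul h2
    rw [h1 h5]
    field_simp
  -- A function that is generically zero has inverse 0, in accordance with `0⁻¹ = 0`.
  · simp only [not_frequently, not_not] at hA0
    refine ⟨fun _ => 0, B, AnalyticIn.const _ _ _, hB, hB0, ?_⟩
    filter_upwards [h, hA0] with u h1 h2 h3
    rw [h1 h3, h2]; simp

theorem MeroIn.finsetSum {ι : Type*} (I : Finset ι) {f : ι → (ℤ × ℤ → 𝕜) → 𝕜}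
    (h : ∀ i ∈ I, MeroIn K s (f i)) : MeroIn K s fun u => ∑ i ∈ I, f i u := by
  classical
  induction I using Finset.induction_on with
  | empty => simpa using (AnalyticIn.const K s (0 : 𝕜)).meroIn
  | insert i I hi ih =>
    simp only [Finset.sum_insert hi]
    exact (h i (by simp)).add (ih fun j hj => h j (by simp [hj]))

theorem MeroIn.eventually_pd {A B : (ℤ × ℤ → 𝕜) → 𝕜} (hA : AnalyticIn K s A)
    (hB : AnalyticIn K s B) (h : ∀ᶠ u in 𝓝 s, B u ≠ 0 → g u = A u / B u) (p : ℤ × ℤ) :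
    ∀ᶠ u in 𝓝 s, B u ≠ 0 → pd p g u = (pd p A u * B u - A u * pd p B u) / B u ^ 2 := by
  filter_upwards [hA.eventually, hB.eventually, h.eventually_nhds] with u h1 h2 h3 h4
  have h5 : g =ᶠ[𝓝 u] fun v => A v / B v := by
    filter_upwards [h3, h2.continuousAt.eventually_ne h4] with v h6 h7 using h6 h7
  rw [pd_congr h5, pd_div h1 h2 h4]

theorem MeroIn.pd (h : MeroIn K s g) (p : ℤ × ℤ) : MeroIn K s (pd p g) := by
  obtain ⟨A, B, hA, hB, hB0, h⟩ := h
  refine ⟨_, _, ((hA.pd p).mul hB).sub (hA.mul (hB.pd p)), hB.pow 2, ?_, ?_⟩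
  · exact hB0.mono fun u hu => pow_ne_zero 2 hu
  · filter_upwards [MeroIn.eventually_pd hA hB h p] with u h1 h2
    exact h1 fun h3 => h2 (by simp [h3])

theorem MeroIn.eventually_analyticIn (hK : K ⊆ axes) (h : MeroIn K s g) :
    ∀ᶠ u in genFilter s, AnalyticIn K u g := by
  obtain ⟨A, B, hA, hB, hB0, h⟩ := h
  filter_upwards [hB.eventually_ne_genFilter hK hB0, genFilter_le_nhds hA.eventually,
    genFilter_le_nhds hB.eventually, genFilter_le_nhds h.eventually_nhds] with u h1 h2 h3 h4
  refine (h2.div h3 h1).congr ?_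
  filter_upwards [h4, h3.continuousAt.eventually_ne h1] with v h5 h6 using h5 h6

theorem MeroIn.eq_zero_or (hK : K ⊆ axes) (h : MeroIn K s g) :
    (∀ᶠ u in genFilter s, g u = 0) ∨ ∀ᶠ u in genFilter s, g u ≠ 0 := by
  obtain ⟨A, B, hA, hB, hB0, h⟩ := h
  by_cases hA0 : ∃ᶠ u in 𝓝 s, A u ≠ 0
  · right
    filter_upwards [hB.eventually_ne_genFilter hK hB0, hA.eventually_ne_genFilter hK hA0,
      genFilter_le_nhds h] with u h1 h2 h3
    rw [h3 h1]
    exact div_ne_zero h2 h1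
  · left
    simp only [not_frequently, not_not] at hA0
    filter_upwards [hB.eventually_ne_genFilter hK hB0, genFilter_le_nhds hA0,
      genFilter_le_nhds h] with u h1 h2 h3
    rw [h3 h1, h2, zero_div]

theorem MeroIn.eventually_ext (hK : K ⊆ axes) (h : MeroIn K s g)
    {e : (ℤ × ℤ → 𝕜) → (ℤ × ℤ → 𝕜)} (he : IsExt D F s e) :
    ∀ᶠ u in genFilter s, g (e u) = g u := by
  obtain ⟨A, B, hA, hB, hB0, h⟩ := h
  filter_upwards [hB.eventually_ne_genFilter hK hB0, genFilter_le_nhds h,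
    genFilter_le_nhds (he.tendsto.eventually h),
    genFilter_le_nhds (hA.eventually_map_eq he.tendsto fun p hp =>
      Eventually.of_forall fun u => he.apply_axis u p (hK hp)),
    genFilter_le_nhds (hB.eventually_map_eq he.tendsto fun p hp =>
      Eventually.of_forall fun u => he.apply_axis u p (hK hp))] with u h1 h2 h3 h4 h5
  rw [h5, h4] at h3
  rw [h2 h1, h3 h1]

/-- Functions of dynamical variables that agree on solutions agree. -/
theorem MeroIn.eventuallyEq (hF : IsEquation D F) (hs : ∀ i j, SolvesAt D F s i j)
    (hf : MeroIn axes s f) (hg : MeroIn axes s g) (h : f =ᶠ[solFilter D F s] g) :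
    f =ᶠ[genFilter s] g := by
  obtain ⟨e, he⟩ := exists_isExt hF hs
  filter_upwards [hf.eventually_ext subset_rfl he, hg.eventually_ext subset_rfl he,
    he.eventually_genFilter h] with u h1 h2 h3
  rw [← h1, ← h2, h3]

theorem eventually_pd_congr_genFilter (h : f =ᶠ[genFilter s] g) (p : ℤ × ℤ) :
    pd p f =ᶠ[genFilter s] pd p g :=
  (eventually_genFilter_nhds h).mono fun _ hu => pd_congr hu p

theorem tendsto_shift_nhds (a b : ℤ) (s : ℤ × ℤ → 𝕜) :
    Tendsto (shift a b) (𝓝 s) (𝓝 (shift a b s)) := (continuous_shift a b).continuousAt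

theorem frequently_shift {a b : ℤ} {P : (ℤ × ℤ → 𝕜) → Prop}
    (h : ∃ᶠ u in 𝓝 (shift a b s), P u) : ∃ᶠ u in 𝓝 s, P (shift a b u) := by
  have h1 := tendsto_shift_nhds (-a) (-b) (shift a b s)
  rw [shift_shift, neg_add_cancel, neg_add_cancel, shift_zero] at h1
  refine h1.frequently (h.mono fun u hu => ?_)
  rw [shift_shift, add_neg_cancel, add_neg_cancel, shift_zero]
  exact hu

theorem AnalyticIn.shift {a b : ℤ} {E : Type*} [NormedAddCommGroup E] [NormedSpace 𝕜 E]
    {f : (ℤ × ℤ → 𝕜) → E} (h : AnalyticIn K (shift a b s) f)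
    (hK : ∀ p ∈ K, (p.1 + a, p.2 + b) ∈ K') : AnalyticIn K' s fun u => f (shift a b u) :=
  AnalyticIn.comp_map (Ψ := QuadGraph.shift a b) h (continuous_shift a b).continuousAt
    fun p hp => AnalyticIn.coord (hK p hp)

theorem MeroIn.shift {a b : ℤ} (h : MeroIn K (shift a b s) g)
    (hK : ∀ p ∈ K, (p.1 + a, p.2 + b) ∈ K') : MeroIn K' s fun u => g (shift a b u) := by
  obtain ⟨A, B, hA, hB, hB0, h⟩ := h
  exact ⟨_, _, hA.shift hK, hB.shift hK, frequently_shift hB0,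
    (tendsto_shift_nhds a b s).eventually h⟩

/-- Quotients of analytic functions that agree on solutions with one and the same function can be
glued. -/
theorem exists_eventually_eq_div (hF : IsEquation D F) (hS : IsBase D F S)
    {A B : (ℤ × ℤ → 𝕜) → (ℤ × ℤ → 𝕜) → 𝕜} (hA : ∀ s ∈ S, AnalyticIn axes s (A s))
    (hB : ∀ s ∈ S, AnalyticIn axes s (B s)) (hB0 : ∀ s ∈ S, ∃ᶠ u in 𝓝 s, B s u ≠ 0)
    (hg : ∀ s ∈ S, ∀ᶠ u in solFilter D F s, g u = A s u / B s u) :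
    ∃ g' : (ℤ × ℤ → 𝕜) → 𝕜, (∀ s ∈ S, ∀ᶠ u in 𝓝 s, B s u ≠ 0 → g' u = A s u / B s u) ∧
      ∀ s ∈ S, g' =ᶠ[solFilter D F s] g := by
  -- On generic solutions near `t` both quotients equal `g`; cross-multiplied, this is an identity
  -- of analytic functions of dynamical variables, hence it holds near `t` without the equation.
  have hco : ∀ s ∈ S, ∀ᶠ t in 𝓝 s, t ∈ S → ∀ᶠ u in 𝓝 t, A s u * B t u = A t u * B s u := by
    intro s hs
    filter_upwards [(hA s hs).eventually, (hB s hs).eventually,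
      (hB s hs).eventually_frequently_ne (hB0 s hs),
      eventually_eventually_solFilter (hg s hs)] with t h1 h2 h3 h4 ht
    refine ((h1.mul (hB t ht)).eventuallyEq_of_solFilter hF (hS.solves t ht)
      ((hA t ht).mul h2) ?_)
    filter_upwards [h4, hg t ht, (hB t ht).eventually_ne (hB0 t ht), h2.eventually_ne h3]
      with u h5 h6 h7 h8
    rw [h5, div_eq_div_iff h8 h7] at h6
    exact h6
  obtain ⟨g', hg'⟩ := exists_glue (fun s hs => (hA s hs).mono (Set.subset_univ _))
    (fun s hs => (hB s hs).mono (Set.subset_univ _)) hco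
  refine ⟨g', hg', fun s hs => ?_⟩
  filter_upwards [hg s hs, solFilter_le_nhds (hg' s hs), (hB s hs).eventually_ne (hB0 s hs)]
    with u h1 h2 h3
  rw [h1, h2 h3]

/-- A function that near each member of `S` agrees on solutions with a quotient of analytic
functions agrees on solutions with one that is such a quotient everywhere near `S`. -/
theorem exists_meroIn (hF : IsEquation D F) (hS : IsBase D F S) (hK : K ⊆ axes)
    (h : ∀ s ∈ S, ∃ A B : (ℤ × ℤ → 𝕜) → 𝕜, AnalyticIn K s A ∧ AnalyticIn K s B ∧
      (∃ᶠ u in 𝓝 s, B u ≠ 0) ∧ ∀ᶠ u in solFilter D F s, g u = A u / B u) :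
    ∃ g' : (ℤ × ℤ → 𝕜) → 𝕜, (∀ s ∈ S, MeroIn K s g') ∧
      ∀ s ∈ S, g' =ᶠ[solFilter D F s] g := by
  choose! A B hA hB hB0 hg using h
  obtain ⟨g', h1, h2⟩ := exists_eventually_eq_div hF hS (fun s hs => (hA s hs).mono hK)
    (fun s hs => (hB s hs).mono hK) hB0 hg
  exact ⟨g', fun s hs => ⟨A s, B s, hA s hs, hB s hs, hB0 s hs, h1 s hs⟩, h2⟩

/-- The chain rule for partial derivatives. -/
theorem AnalyticIn.eventually_pd_comp {Λ : Finset (ℤ × ℤ)}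
    {Ψ : (ℤ × ℤ → 𝕜) → (ℤ × ℤ → 𝕜)} (hf : AnalyticIn (Λ : Set (ℤ × ℤ)) (Ψ s) f)
    (hΨ : ContinuousAt Ψ s) (h : ∀ q ∈ Λ, AnalyticIn K s fun u => Ψ u q) (p : ℤ × ℤ) :
    ∀ᶠ u in 𝓝 s, QuadGraph.pd p (fun v => f (Ψ v)) u =
      ∑ q ∈ Λ, QuadGraph.pd q f (Ψ u) * QuadGraph.pd p (fun v => Ψ v q) u := by
  classical
  obtain ⟨L, hL, A, hA, he⟩ := hf
  have hL' : L ⊆ Λ := by exact_mod_cast hL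
  have h1 : ∀ᶠ w in 𝓝 (Ψ s), AnalyticIn (Λ : Set (ℤ × ℤ)) w (fun v => A (res L v)) :=
    AnalyticIn.eventually ⟨L, hL, A, hA, Eventually.of_forall fun _ => rfl⟩
  have h2 : ∀ᶠ u in 𝓝 s, ∀ q ∈ Λ, AnalyticIn K u fun v => Ψ v q := by
    rw [eventually_all_finset]
    exact fun q hq => (h q hq).eventually
  filter_upwards [(hΨ.eventually he).eventually_nhds, hΨ.eventually h1, h2,
    hΨ.eventually he.eventually_nhds] with u h3 h4 h5 h6
  -- Nothing is known about the other components of `Ψ` near `u`, so the curve moves only those in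
  -- `Λ`, the only ones on which `f` depends.
  let γ : 𝕜 → (ℤ × ℤ → 𝕜) := fun t q => if q ∈ Λ then Ψ (Function.update u p t) q else Ψ u q
  have hγ : γ (u p) = Ψ u := by
    funext q; simp [γ]
  have hd : ∀ q ∈ Λ, HasDerivAt (fun t => γ t q) (QuadGraph.pd p (fun v => Ψ v q) u) (u p) := by
    intro q hq
    simpa [γ, hq] using (h5 q hq).hasDerivAt_pd p
  have hc : ContinuousAt γ (u p) := by
    refine continuousAt_pi.2 fun q => ?_
    by_cases hq : q ∈ Λ
    · exact (hd q hq).continuousAt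
    · simpa [γ, hq] using continuousAt_const
  have h7 := h4.hasDerivAt_comp hγ hc hd (w := fun q => QuadGraph.pd p (fun v => Ψ v q) u)
  have h8 : QuadGraph.pd p (fun v => f (Ψ v)) u = QuadGraph.pd p (fun v => A (res L (Ψ v))) u :=
    pd_congr h3 p
  have h9 : ∀ t, A (res L (γ t)) = A (res L (Ψ (Function.update u p t))) := by
    intro t
    congr 1
    funext q
    simp [res, γ, hL' q.2]
  simp only [h9] at h7
  rw [h8, QuadGraph.pd, h7.deriv]
  refine Finset.sum_congr rfl fun q _ => ?_
  rw [pd_congr h6 q]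

theorem IsExt.continuousAt {e : (ℤ × ℤ → 𝕜) → (ℤ × ℤ → 𝕜)} (he : IsExt D F s e) :
    ContinuousAt e s := by
  have := he.tendsto
  rwa [ContinuousAt, he.apply_self]

/-- The chain rule for shifts by virtue of the equation. -/
theorem eventually_pd_shift (hF : IsEquation D F) (hS : IsBase D F S) (hs : s ∈ S) {a b : ℤ}
    {n : ℕ} (hg : MeroIn (cross n : Set (ℤ × ℤ)) (shift a b s) g) (hf : MeroIn axes s f)
    (hfg : ∀ᶠ u in solFilter D F s, f u = g (shift a b u))
    {x : ℤ × ℤ → (ℤ × ℤ → 𝕜) → 𝕜} (hx : ∀ q ∈ cross n, MeroIn axes s (x q))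
    (hxe : ∀ q ∈ cross n, ∀ᶠ u in solFilter D F s, x q u = u (q.1 + a, q.2 + b)) (p : ℤ × ℤ) :
    ∀ᶠ u in solFilter D F s, pd p f u = ∑ q ∈ cross n, pd q g (shift a b u) * pd p (x q) u := by
  obtain ⟨e, he⟩ := exists_isExt hF (hS.solves s hs)
  obtain ⟨A, B, hA, hB, hB0, h⟩ := hg
  have hT := tendsto_shift_nhds a b s
  have hc : ContinuousAt (fun u => shift a b (e u)) s :=
    (continuous_shift a b).continuousAt.comp he.continuousAt
  have hes : shift a b s = shift a b (e s) := by rw [he.apply_self]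
  have hcomp : ∀ {G : (ℤ × ℤ → 𝕜) → 𝕜},
      AnalyticIn (cross n : Set (ℤ × ℤ)) (shift a b s) G →
      AnalyticIn axes s (fun u => G (shift a b (e u))) ∧
      (∀ᶠ u in 𝓝 s, pd p (fun v => G (shift a b (e v))) u = ∑ q ∈ cross n,
        pd q G (shift a b (e u)) * pd p (fun v => e v (q.1 + a, q.2 + b)) u) := by
    intro G hG
    rw [hes] at hG
    exact ⟨AnalyticIn.comp_map (Ψ := fun u => shift a b (e u)) hG hc
        fun q _ => he.analyticIn_axes _,
      AnalyticIn.eventually_pd_comp (Ψ := fun u => shift a b (e u)) hG hc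
        (fun q _ => he.analyticIn_axes _) p⟩
  obtain ⟨hA1, hA2⟩ := hcomp hA
  obtain ⟨hB1, hB2⟩ := hcomp hB
  have hBf := frequently_shift_ext hF hS hs he (hB.mono (cross_subset_axes n)) hB0
  -- With the mixed shifts eliminated by `e`, the identity `f = g ∘ shift` holds on an open dense
  -- set and can be differentiated in `u p`.
  have hfe : f =ᶠ[genFilter s] fun u => A (shift a b (e u)) / B (shift a b (e u)) := by
    filter_upwards [hf.eventually_ext subset_rfl he, he.eventually_genFilter hfg,
      hB1.eventually_ne_genFilter subset_rfl hBf,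
      genFilter_le_nhds (he.tendsto.eventually (hT.eventually h))] with u h1 h2 h3 h4
    rw [← h1, h2, h4 h3]
  have hxe' : ∀ᶠ u in solFilter D F s, ∀ q ∈ cross n,
      pd p (x q) u = pd p (fun v => e v (q.1 + a, q.2 + b)) u := by
    rw [eventually_all_finset]
    intro q hq
    refine solFilter_le_genFilter (eventually_pd_congr_genFilter ?_ p)
    refine (hx q hq).eventuallyEq hF (hS.solves s hs) (he.analyticIn_axes _).meroIn ?_
    filter_upwards [hxe q hq, he.eventually_eq (q.1 + a, q.2 + b)] with u h1 h2
    rw [h1, h2]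
  have hpd : ∀ᶠ u in solFilter D F s, ∀ q ∈ cross n, B (shift a b u) ≠ 0 →
      pd q g (shift a b u) = (pd q A (shift a b (e u)) * B (shift a b (e u)) -
        A (shift a b (e u)) * pd q B (shift a b (e u))) / B (shift a b (e u)) ^ 2 := by
    rw [eventually_all_finset]
    intro q _
    filter_upwards [solFilter_le_nhds (hT.eventually (MeroIn.eventually_pd hA hB h q)),
      he.eventually_shift_eq hA, he.eventually_shift_eq hB, he.eventually_shift_eq (hA.pd q),
      he.eventually_shift_eq (hB.pd q)] with u h1 h2 h3 h4 h5 h6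
    rw [h1 h6, h2, h3, h4, h5]
  filter_upwards [solFilter_le_genFilter (eventually_pd_congr_genFilter hfe p), hxe', hpd,
    solFilter_le_nhds hA1.eventually, solFilter_le_nhds hB1.eventually,
    hB1.eventually_ne hBf, he.eventually_shift_eq hB, solFilter_le_nhds hA2,
    solFilter_le_nhds hB2] with u h1 h2 h3 h4 h5 h6 h7 h8 h9
  rw [h1, pd_div h4 h5 h6, h8, h9]
  have h10 : ∀ q ∈ cross n, pd q g (shift a b u) * pd p (x q) u =
      (pd q A (shift a b (e u)) * B (shift a b (e u)) -
        A (shift a b (e u)) * pd q B (shift a b (e u))) / B (shift a b (e u)) ^ 2 *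
        pd p (fun v => e v (q.1 + a, q.2 + b)) u := fun q hq => by
    rw [h2 q hq, h3 q hq (by rw [← h7]; exact h6)]
  rw [Finset.sum_congr rfl h10, Finset.sum_mul, Finset.mul_sum, ← Finset.sum_sub_distrib,
    Finset.sum_div]
  refine Finset.sum_congr rfl fun q _ => ?_
  ring

/-- The partial derivative of `F` in its first variable, at the corner of the elementary square. -/
noncomputable def Fu (F : 𝕜 × 𝕜 × 𝕜 → 𝕜) (u : ℤ × ℤ → 𝕜) : 𝕜 :=
  deriv (fun t => F (t, u (1, 0), u (0, 1))) (u (0, 0))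

/-- The partial derivative of `F` in its second variable, at the corner of the elementary square. -/
noncomputable def Fu10 (F : 𝕜 × 𝕜 × 𝕜 → 𝕜) (u : ℤ × ℤ → 𝕜) : 𝕜 :=
  deriv (fun t => F (u (0, 0), t, u (0, 1))) (u (1, 0))

/-- The partial derivative of `F` in its third variable, at the corner of the elementary square. -/
noncomputable def Fu01 (F : 𝕜 × 𝕜 × 𝕜 → 𝕜) (u : ℤ × ℤ → 𝕜) : 𝕜 :=
  deriv (fun t => F (u (0, 0), u (1, 0), t)) (u (0, 1))

theorem fderiv_eq_partial {x y z : 𝕜} (h : AnalyticAt 𝕜 F (x, y, z)) (v : 𝕜 × 𝕜 × 𝕜) :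
    fderiv 𝕜 F (x, y, z) v = deriv (fun t => F (t, y, z)) x * v.1 +
      deriv (fun t => F (x, t, z)) y * v.2.1 + deriv (fun t => F (x, y, t)) z * v.2.2 := by
  have hd := h.differentiableAt.hasFDerivAt
  have h1 : HasDerivAt (fun t => F (t, y, z)) (fderiv 𝕜 F (x, y, z) (1, 0, 0)) x :=
    hd.comp_hasDerivAt x ((hasDerivAt_id' x).prodMk (hasDerivAt_const x (y, z)))
  have h2 : HasDerivAt (fun t => F (x, t, z)) (fderiv 𝕜 F (x, y, z) (0, 1, 0)) y :=
    hd.comp_hasDerivAt y ((hasDerivAt_const y x).prodMk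
      ((hasDerivAt_id' y).prodMk (hasDerivAt_const y z)))
  have h3 : HasDerivAt (fun t => F (x, y, t)) (fderiv 𝕜 F (x, y, z) (0, 0, 1)) z :=
    hd.comp_hasDerivAt z ((hasDerivAt_const z x).prodMk
      ((hasDerivAt_const z y).prodMk (hasDerivAt_id' z)))
  rw [h1.deriv, h2.deriv, h3.deriv]
  have : v = v.1 • ((1, 0, 0) : 𝕜 × 𝕜 × 𝕜) + v.2.1 • ((0, 1, 0) : 𝕜 × 𝕜 × 𝕜) +
      v.2.2 • ((0, 0, 1) : 𝕜 × 𝕜 × 𝕜) := by ext <;> simp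
  conv_lhs => rw [this]
  rw [map_add, map_add, map_smul, map_smul, map_smul]
  simp only [smul_eq_mul]
  ring

/-- The linearized equation. -/
theorem eventually_pd_equation (hF : IsEquation D F) (hS : IsBase D F S) (hs : s ∈ S)
    {x : ℤ × ℤ → (ℤ × ℤ → 𝕜) → 𝕜} (hx : ∀ q, MeroIn axes s (x q))
    (hxe : ∀ q, ∀ᶠ u in solFilter D F s, x q u = u q) (p : ℤ × ℤ) (k l : ℤ) :
    ∀ᶠ u in solFilter D F s, pd p (x (k + 1, l + 1)) u =
      Fu10 F (shift k l u) * pd p (x (k + 1, l)) u + Fu01 F (shift k l u) * pd p (x (k, l + 1)) u +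
      Fu F (shift k l u) * pd p (x (k, l)) u := by
  obtain ⟨e, he⟩ := exists_isExt hF (hS.solves s hs)
  have hxe' : ∀ q, ∀ᶠ u in solFilter D F s, pd p (x q) u = pd p (fun v => e v q) u := by
    intro q
    refine solFilter_le_genFilter (eventually_pd_congr_genFilter ?_ p)
    refine (hx q).eventuallyEq hF (hS.solves s hs) (he.analyticIn_axes _).meroIn ?_
    filter_upwards [hxe q, he.eventually_eq q] with u h1 h2
    rw [h1, h2]
  filter_upwards [hxe' (k + 1, l + 1), hxe' (k + 1, l), hxe' (k, l + 1), hxe' (k, l),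
    solFilter_le_nhds (he.solves k l).eventually_nhds,
    solFilter_le_nhds (he.analyticIn_axes (k, l)).eventually,
    solFilter_le_nhds (he.analyticIn_axes (k + 1, l)).eventually,
    solFilter_le_nhds (he.analyticIn_axes (k, l + 1)).eventually,
    he.eventually_eq (k, l), he.eventually_eq (k + 1, l), he.eventually_eq (k, l + 1)]
    with u h1 h2 h3 h4 h5 h6 h7 h8 h9 h10 h11
  rw [h1, h2, h3, h4]
  -- The extension satisfies the equation for all nearby axis values, so the equation itself can be
  -- differentiated.
  have h12 : (fun v => e v (k + 1, l + 1)) =ᶠ[𝓝 u] fun v => F (corner (e v) k l) :=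
    h5.mono fun v hv => hv.2
  have hFa : AnalyticAt 𝕜 F (corner (e u) k l) := hF.analytic _ h5.self_of_nhds.1
  have hd : HasDerivAt (fun t => F (corner (e (Function.update u p t)) k l)) _ (u p) :=
    HasFDerivAt.comp_hasDerivAt (l := F) (u p)
      (by simpa using hFa.differentiableAt.hasFDerivAt)
      ((h6.hasDerivAt_pd p).prodMk ((h7.hasDerivAt_pd p).prodMk (h8.hasDerivAt_pd p)))
  rw [pd_congr h12, pd, hd.deriv]
  rw [corner] at hFa ⊢
  rw [fderiv_eq_partial hFa]
  simp only [Fu, Fu10, Fu01, shift_apply, zero_add, h9, h10, h11, add_comm (1 : ℤ)]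
  ring

end QuadGraph

/-! ### Linear algebra: a finitely supported solution of the linearized equation. -/

namespace QuadGraph

section FiniteSupport

variable {K : Type*} [Field K] {A B C : ℕ → ℤ → K} {n : ℕ}

/-- Solutions of the truncated linearized equation supported on `0 ≤ q < N`; the entry `Y q k` with
`k < n` stands for the `k`-th shift of the `q`-th component. -/
def Truncated (A B C : ℕ → ℤ → K) (n N : ℕ) (Y : ℤ → ℕ → K) : Prop :=
  (∀ q : ℤ, q < 0 ∨ (N : ℤ) ≤ q → ∀ k < n, Y q k = 0) ∧
  ∀ q k, k + 1 < n → Y (q - 1) (k + 1) = A k q * Y q (k + 1) + B k q * Y (q - 1) k + C k q * Y q k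

/-- There are `n * n` unknowns, and only the equations with `0 ≤ q ≤ n` and `k < n - 1` are not
trivial; these are `(n + 1) * (n - 1) = n * n - 1`, one fewer. -/
theorem exists_truncated (A B C : ℕ → ℤ → K) (hn : 1 ≤ n) :
    ∃ Y, Truncated A B C n n Y ∧ ∃ q, ∃ k < n, Y q k ≠ 0 := by
  let ext : (Fin n × Fin n → K) → ℤ → ℕ → K := fun y q k =>
    if h : (0 ≤ q ∧ q < n) ∧ k < n then y (⟨q.toNat, by omega⟩, ⟨k, h.2⟩) else 0
  have hadd : ∀ y z q k, ext (y + z) q k = ext y q k + ext z q k := by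
    intro y z q k
    by_cases h : (0 ≤ q ∧ q < n) ∧ k < n <;> simp [ext, h]
  have hsmul : ∀ (c : K) y q k, ext (c • y) q k = c * ext y q k := by
    intro c y q k
    by_cases h : (0 ≤ q ∧ q < n) ∧ k < n <;> simp [ext, h]
  let L : (Fin n × Fin n → K) →ₗ[K] (Fin (n + 1) × Fin (n - 1) → K) :=
    { toFun := fun y i => ext y (((i.1 : ℕ) : ℤ) - 1) (i.2 + 1) -
        (A i.2 (i.1 : ℕ) * ext y (i.1 : ℕ) (i.2 + 1) + B i.2 (i.1 : ℕ) * ext y (((i.1 : ℕ) : ℤ) - 1)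
          i.2 + C i.2 (i.1 : ℕ) * ext y (i.1 : ℕ) i.2)
      map_add' := by intro y z; funext i; simp only [hadd, Pi.add_apply]; ring
      map_smul' := by
        intro c y; funext i; simp only [hsmul, Pi.smul_apply, smul_eq_mul, RingHom.id_apply]; ring }
  have hker : LinearMap.ker L ≠ ⊥ := by
    refine LinearMap.ker_ne_bot_of_finrank_lt ?_
    simp only [Module.finrank_fintype_fun_eq_card, Fintype.card_prod, Fintype.card_fin]
    obtain ⟨m, rfl⟩ : ∃ m, n = m + 1 := ⟨n - 1, by omega⟩
    simp only [Nat.add_sub_cancel]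
    nlinarith
  obtain ⟨y, hy, hy0⟩ := (Submodule.ne_bot_iff _).1 hker
  have hext : ∀ (q k : ℕ) (hq : q < n) (hk : k < n), ext y q k = y (⟨q, hq⟩, ⟨k, hk⟩) := by
    intro q k hq hk
    have : (0 ≤ (q : ℤ) ∧ (q : ℤ) < n) ∧ k < n := by omega
    simp [ext, this]
  refine ⟨ext y, ⟨?_, ?_⟩, ?_⟩
  · intro q hq k _
    have : ¬ ((0 ≤ q ∧ q < n) ∧ k < n) := by omega
    simp only [ext, this, dif_neg, not_false_eq_true]
  · intro q k hk
    by_cases hq : 0 ≤ q ∧ q ≤ n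
    · have h1 := congrFun (LinearMap.mem_ker.1 hy) (⟨q.toNat, by omega⟩, ⟨k, by omega⟩)
      have h2 : ((q.toNat : ℕ) : ℤ) = q := Int.toNat_of_nonneg hq.1
      simp only [L, LinearMap.coe_mk, AddHom.coe_mk, Pi.zero_apply, h2] at h1
      exact sub_eq_zero.1 h1
    · have h1 : ∀ k, ext y q k = 0 := fun k => by
        by_cases h : q = n
        · omega
        have : ¬ ((0 ≤ q ∧ q < n) ∧ k < n) := by omega
        simp only [ext, this, dif_neg, not_false_eq_true]
      have h2 : ∀ k, ext y (q - 1) k = 0 := fun k => by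
        have : ¬ ((0 ≤ q - 1 ∧ q - 1 < n) ∧ k < n) := by omega
        simp only [ext, this, dif_neg, not_false_eq_true]
      simp [h1, h2]
  · by_contra! h
    apply hy0
    funext i
    rw [← hext i.1 i.2 i.1.2 i.2.2]
    exact h _ _ i.2.2

/-- The linearized equation has a solution with finitely many components. -/
theorem exists_finite_solution (σ : K ≃+* K) (hA : ∀ k q, σ (A k q) = A (k + 1) q)
    (hB : ∀ k q, σ (B k q) = B (k + 1) q) (hC : ∀ k q, σ (C k q) = C (k + 1) q) (hn : 1 ≤ n)
    {ι : ℤ → ℕ → K} (hι : ∀ q, ι q n ≠ 0)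
    (hid : ∀ q (g₀ g₁ : ℕ → K),
      (∀ k < n, g₁ (k + 1) = A k q * g₀ (k + 1) + B k q * g₁ k + C k q * g₀ k) →
      ∑ k ∈ Finset.range (n + 1), ι (q - 1) k * g₁ k = ∑ k ∈ Finset.range (n + 1), ι q k * g₀ k)
    {μ : ℤ → K} (hμ0 : ∀ q, μ q ≠ 0) (hμ : ∀ q, σ (μ q) = B 0 (q + 1) * μ q) :
    ∃ (r : ℕ) (y : ℤ → K), (∀ q < 0, y q = 0) ∧ (∀ q : ℤ, r < q → y q = 0) ∧ y r ≠ 0 ∧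
      ∀ q, σ (y (q - 1)) = A 0 q * σ (y q) + B 0 q * y (q - 1) + C 0 q * y q := by
  classical
  have hP : ∃ N, ∃ Y, Truncated A B C n N Y ∧ ∃ q, ∃ k < n, Y q k ≠ 0 :=
    ⟨n, exists_truncated A B C hn⟩
  -- The shortest support is chosen in order to have uniqueness.
  obtain ⟨N, ⟨Y₀, hY₀, hne⟩, hmin⟩ : ∃ N, (∃ Y, Truncated A B C n N Y ∧ ∃ q, ∃ k < n, Y q k ≠ 0) ∧
      ∀ m < N, ¬ ∃ Y, Truncated A B C n m Y ∧ ∃ q, ∃ k < n, Y q k ≠ 0 :=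
    ⟨Nat.find hP, Nat.find_spec hP, fun m hm => Nat.find_min hP hm⟩
  obtain ⟨r, rfl⟩ : ∃ r, N = r + 1 := by
    rcases N with _ | r
    · obtain ⟨q, k, hk, h⟩ := hne
      exact absurd (hY₀.1 q (by omega) k hk) h
    · exact ⟨r, rfl⟩
  -- The equation at `q = r + 1` reads `Y r (k + 1) = B k (r + 1) * Y r k`. A zero top entry
  -- therefore kills the whole component `r` and gives a solution of shorter support, which is zero
  -- by minimality.
  have huniq : ∀ Y, Truncated A B C n (r + 1) Y → Y r 0 = 0 → ∀ q, ∀ k < n, Y q k = 0 := by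
    intro Y hY h0
    have h1 : ∀ k < n, Y r k = 0 := by
      intro k
      induction k with
      | zero => intro _; exact h0
      | succ k ih =>
        intro hk
        have h2 := hY.2 (r + 1) k hk
        rw [add_sub_cancel_right, ih (by omega), hY.1 (r + 1) (by push_cast; omega) _ hk,
          hY.1 (r + 1) (by push_cast; omega) k (by omega)] at h2
        simpa using h2
    have h2 : Truncated A B C n r Y := by
      refine ⟨fun q hq k hk => ?_, hY.2⟩
      by_cases hqr : q = r
      · rw [hqr]; exact h1 k hk
      · exact hY.1 q (by push_cast; omega) k hk
    intro q k hk
    by_contra h3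
    exact hmin r (by omega) ⟨Y, h2, q, k, hk, h3⟩
  have hr0 : Y₀ r 0 ≠ 0 := fun h => by
    obtain ⟨q, k, hk, h'⟩ := hne
    exact h' (huniq Y₀ hY₀ h q k hk)
  set Y : ℤ → ℕ → K := fun q k => μ r / Y₀ r 0 * Y₀ q k with hYdef
  have hY : Truncated A B C n (r + 1) Y := by
    refine ⟨fun q hq k hk => by simp [Y, hY₀.1 q hq k hk], fun q k hk => ?_⟩
    simp only [Y, hY₀.2 q k hk]; ring
  have hYr : Y r 0 = μ r := by simp only [Y]; field_simp
  -- The missing entry `k = n` is defined by requiring the relation `∑ ι q k * W q k = 0`, solvable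
  -- because `ι q n ≠ 0`. Entries with `k > n` are irrelevant.
  set W : ℤ → ℕ → K := fun q k => if k < n then Y q k else
    -(ι q n)⁻¹ * ∑ k ∈ Finset.range n, ι q k * Y q k with hW
  have hWY : ∀ q k, k < n → W q k = Y q k := fun q k hk => by simp [W, hk]
  have hWι : ∀ q, ∑ k ∈ Finset.range (n + 1), ι q k * W q k = 0 := by
    intro q
    rw [Finset.sum_range_succ, Finset.sum_congr rfl fun k hk => by
      rw [hWY q k (Finset.mem_range.1 hk)]]
    simp only [W, lt_irrefl, if_false]
    have := hι q
    field_simp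
    ring
  have hWout : ∀ q : ℤ, q < 0 ∨ ((r + 1 : ℕ) : ℤ) ≤ q → ∀ k, W q k = 0 := by
    intro q hq k
    by_cases hk : k < n
    · rw [hWY q k hk, hY.1 q hq k hk]
    · simp only [W, hk, if_false]
      rw [Finset.sum_eq_zero fun k hk => by
        rw [hY.1 q hq k (Finset.mem_range.1 hk), mul_zero], mul_zero]
  have hWc : ∀ q k, k < n →
      W (q - 1) (k + 1) = A k q * W q (k + 1) + B k q * W (q - 1) k + C k q * W q k := by
    intro q k hk
    rcases Nat.lt_or_ge (k + 1) n with hk1 | hk1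
    · rw [hWY _ _ hk1, hWY _ _ hk1, hWY _ _ hk, hWY _ _ hk]
      exact hY.2 q k hk1
    · obtain rfl : n = k + 1 := by omega
      -- The equation at `k = n - 1` is not part of the system. If its right-hand side is taken as
      -- the last entry of component `q - 1`, then `hid` transports the relation from `q` to `q -
      -- 1`; the relation determines that entry, so it is the one in `W`.
      set g₁ : ℕ → K := fun m => if m < k + 1 then W (q - 1) m else
        A k q * W q (k + 1) + B k q * W (q - 1) k + C k q * W q k with hg₁
      have h1 := hid q (W q) g₁ (by
        intro m hm
        rcases Nat.lt_or_ge (m + 1) (k + 1) with hm1 | hm1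
        · simp only [g₁, hm1, hm, if_true]
          rw [hWY _ _ hm1, hWY _ _ hm1, hWY _ _ hm, hWY _ _ hm]
          exact hY.2 q m hm1
        · obtain rfl : m = k := by omega
          simp [g₁])
      have h2 := hWι (q - 1)
      rw [hWι q, Finset.sum_range_succ, Finset.sum_congr rfl fun m hm => by
        rw [show g₁ m = W (q - 1) m by simp only [g₁, Finset.mem_range.1 hm, if_true]]] at h1
      rw [Finset.sum_range_succ] at h2
      have h3 : ι (q - 1) (k + 1) * g₁ (k + 1) = ι (q - 1) (k + 1) * W (q - 1) (k + 1) := by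
        linear_combination h1 - h2
      have h4 := mul_left_cancel₀ (hι (q - 1)) h3
      rw [← h4]
      simp [g₁]
  -- `Z` measures the failure of `W q (k + 1) = σ (W q k)`. The coefficients are carried along by
  -- `σ`, so it solves the same truncated system.
  set Z : ℤ → ℕ → K := fun q k => σ.symm (W q (k + 1)) - W q k with hZ
  have hZT : Truncated A B C n (r + 1) Z := by
    refine ⟨fun q hq k _ => by simp [Z, hWout q hq], fun q k hk => ?_⟩
    simp only [Z]
    rw [hWc q (k + 1) hk, hWc q k (by omega)]
    simp only [map_add, map_mul, ← hA, ← hB, ← hC, RingEquiv.symm_apply_apply]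
    ring
  -- The equation at the upper end of the support is `W r 1 = B 0 (r + 1) * W r 0`. As the top entry
  -- was normalized to `μ r`, this is `σ (μ r)`.
  have hZ0 : Z r 0 = 0 := by
    have h1 := hWc (r + 1) 0 hn
    rw [add_sub_cancel_right, hWout (r + 1) (by push_cast; omega), hWout (r + 1) (by push_cast; omega), hWY r 0 hn,
      hYr, mul_zero, mul_zero, zero_add, add_zero, ← hμ] at h1
    simp only [Z]
    rw [h1, hWY r 0 hn, hYr, zero_add, RingEquiv.symm_apply_apply, sub_self]
  have hWσ : ∀ q, W q 1 = σ (W q 0) := by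
    intro q
    have h1 := huniq Z hZT hZ0 q 0 hn
    simp only [Z, sub_eq_zero] at h1
    rw [← h1, RingEquiv.apply_symm_apply]
  refine ⟨r, fun q => W q 0, fun q hq => hWout q (Or.inl hq) 0,
    fun q hq => hWout q (Or.inr (by push_cast; omega)) 0, ?_, fun q => ?_⟩
  · simp only [hWY r 0 hn, hYr]; exact hμ0 r
  · have h1 := hWc q 0 hn
    rw [zero_add, hWσ, hWσ] at h1
    exact h1

end FiniteSupport

end QuadGraph

/-! ### The difference field with partial derivations and the construction of the operator. -/

namespace QuadGraph

/-- A field of functions of the dynamical variables: the shifts `T a b` by virtue of the equation,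
the partial derivatives `dd p`, the functions `x q = u_q`, and the coefficients `α`, `β`, `γ` of the
linearized equation, that is, `F_{u_{1,0}}`, `F_{u_{0,1}}`, `F_u`. -/
structure CrossField (K : Type*) [Field K] where
  T : ℤ → ℤ → K →+* K
  dd : ℤ × ℤ → K → K
  x : ℤ × ℤ → K
  α : K
  β : K
  γ : K
  T_zero : ∀ f, T 0 0 f = f
  T_add : ∀ a b c d f, T a b (T c d f) = T (a + c) (b + d) f
  dd_add : ∀ p f g, dd p (f + g) = dd p f + dd p g
  dd_mul : ∀ p f g, dd p (f * g) = dd p f * g + f * dd p g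
  dd_T : ∀ f, ∃ n : ℕ, (∀ q, q ∉ cross n → dd q f = 0) ∧ ∀ a b p,
    dd p (T a b f) = ∑ q ∈ cross n, T a b (dd q f) * dd p (x (q.1 + a, q.2 + b))
  dd_x : ∀ p q, q ∈ axes → dd p (x q) = if q = p then 1 else 0
  dd_equation : ∀ p k l, dd p (x (k + 1, l + 1)) = T k l α * dd p (x (k + 1, l)) +
    T k l β * dd p (x (k, l + 1)) + T k l γ * dd p (x (k, l))
  α_ne : α ≠ 0
  β_ne : β ≠ 0
  dd_α : ∀ q, q ≠ (0, 0) → q ≠ (1, 0) → q ≠ (0, 1) → dd q α = 0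
  dd_β : ∀ q, q ≠ (0, 0) → q ≠ (1, 0) → q ≠ (0, 1) → dd q β = 0
  dd_γ : ∀ q, q ≠ (0, 0) → q ≠ (1, 0) → q ≠ (0, 1) → dd q γ = 0

namespace CrossField

variable {K : Type*} [Field K] (C : CrossField K)

/-- The functions of the variables `u_{0,l}`. -/
def IsColumn (f : K) : Prop := ∀ k, k ≠ 0 → C.dd (k, 0) f = 0

/-- The functions of the variables `u_{0,l}` and `u_{1,0}`. -/
def IsNearColumn (f : K) : Prop := ∀ k, k ≠ 0 → k ≠ 1 → C.dd (k, 0) f = 0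

/-- The same field with the two directions of the lattice interchanged. -/
def swap : CrossField K where
  T a b := C.T b a
  dd p := C.dd p.swap
  x q := C.x q.swap
  α := C.β
  β := C.α
  γ := C.γ
  T_zero := C.T_zero
  T_add a b c d := C.T_add b a d c
  dd_add p := C.dd_add p.swap
  dd_mul p := C.dd_mul p.swap
  dd_T f := by
    obtain ⟨n, h1, h2⟩ := C.dd_T f
    have hc : ∀ q : ℤ × ℤ, q.swap ∈ cross n ↔ q ∈ cross n := fun q => by
      simp only [mem_cross, mem_window, Prod.fst_swap, Prod.snd_swap]; tauto
    refine ⟨n, fun q hq => h1 _ (by rwa [hc]), fun a b p => ?_⟩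
    rw [h2]
    exact Finset.sum_nbij' Prod.swap Prod.swap (fun q hq => (hc q).2 hq)
      (fun q hq => (hc q).2 hq) (by simp) (by simp) (by simp)
  dd_x p q hq := by
    have : q.swap ∈ axes := by
      rw [mem_axes] at hq ⊢; exact hq.symm
    rw [C.dd_x _ _ this]
    simp only [Prod.swap_inj]
  dd_equation p k l := by
    simp only [Prod.swap_prod_mk]
    rw [C.dd_equation]; ring
  α_ne := C.β_ne
  β_ne := C.α_ne
  dd_α q h1 h2 h3 := C.dd_β _ (fun h => h1 (Prod.swap_injective h)) (fun h => h3 (Prod.swap_injective h))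
    (fun h => h2 (Prod.swap_injective h))
  dd_β q h1 h2 h3 := C.dd_α _ (fun h => h1 (Prod.swap_injective h)) (fun h => h3 (Prod.swap_injective h))
    (fun h => h2 (Prod.swap_injective h))
  dd_γ q h1 h2 h3 := C.dd_γ _ (fun h => h1 (Prod.swap_injective h)) (fun h => h3 (Prod.swap_injective h))
    (fun h => h2 (Prod.swap_injective h))

theorem T_neg_left (a b : ℤ) (f : K) : C.T (-a) (-b) (C.T a b f) = f := by
  rw [C.T_add, neg_add_cancel, neg_add_cancel, C.T_zero]

theorem T_neg_right (a b : ℤ) (f : K) : C.T a b (C.T (-a) (-b) f) = f := by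
  rw [C.T_add, add_neg_cancel, add_neg_cancel, C.T_zero]

theorem T_eq_zero {a b : ℤ} {f : K} : C.T a b f = 0 ↔ f = 0 :=
  map_eq_zero_iff _ (RingHom.injective _)

theorem dd_x_column {k : ℤ} (hk : k ≠ 0) (l : ℤ) : C.dd (k, 0) (C.x (0, l)) = 0 := by
  rw [C.dd_x _ _ (Or.inl rfl), if_neg]
  simp [Ne.symm hk]

/-- The column `i = 1` is computed from the column `i = 0` and u_{1,0}, upwards by the linearized
equation and downwards by dividing it by `α`. -/
theorem dd_x_one {k : ℤ} (hk : k ≠ 0) (hk' : k ≠ 1) (l : ℤ) : C.dd (k, 0) (C.x (1, l)) = 0 := by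
  induction l using Int.induction_on with
  | zero => rw [C.dd_x _ _ (Or.inr rfl), if_neg]; simp [Ne.symm hk']
  | succ l ih =>
    have := C.dd_equation (k, 0) 0 l
    rw [zero_add] at this
    rw [this, ih, C.dd_x_column hk, C.dd_x_column hk]; ring
  | pred l ih =>
    have := C.dd_equation (k, 0) 0 (-l - 1)
    rw [zero_add, sub_add_cancel, ih, C.dd_x_column hk, C.dd_x_column hk] at this
    simpa [C.T_eq_zero, C.α_ne] using this

/-- A sum over the variables that a function depends on, with one non-zero term. -/
theorem sum_eq_single {f : K} {n : ℕ} (h : ∀ q, q ∉ cross n → C.dd q f = 0) {a b : ℤ}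
    {w : ℤ × ℤ → K} (q₀ : ℤ × ℤ)
    (h0 : ∀ q ∈ cross n, q ≠ q₀ → C.dd q f = 0 ∨ w q = 0) :
    ∑ q ∈ cross n, C.T a b (C.dd q f) * w q = C.T a b (C.dd q₀ f) * w q₀ := by
  refine Finset.sum_eq_single q₀ (fun q hq hne => ?_) fun hq => ?_
  · rcases h0 q hq hne with h1 | h1 <;> simp [h1]
  · rw [h q₀ hq]; simp

/-- The shift in the `i`-direction moves the dependence on the variables `u_{k,0}`. -/
theorem dd_T_one {k : ℤ} (hk : k ≠ 0) (hk' : k ≠ 1) (f : K) :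
    C.dd (k, 0) (C.T 1 0 f) = C.T 1 0 (C.dd (k - 1, 0) f) := by
  obtain ⟨n, h1, h2⟩ := C.dd_T f
  rw [h2, C.sum_eq_single h1 (k - 1, 0)]
  · simp only [sub_add_cancel, add_zero]
    rw [C.dd_x _ _ (Or.inr rfl), if_pos rfl, mul_one]
  · rintro ⟨a, b⟩ hq hne
    right
    simp only [add_zero]
    rcases (mem_cross.1 hq).2 with h3 | h3
    · dsimp only at h3
      subst h3
      rw [zero_add]
      exact C.dd_x_one hk hk' b
    · dsimp only at h3
      subst h3
      rw [C.dd_x _ _ (Or.inr rfl), if_neg]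
      simp only [Prod.mk.injEq, and_true, ne_eq] at hne ⊢
      omega

/-- Differentiation in u_{k,0}, `k ≠ 0, 1`, gives `T_i(∂_{k-1} y) = β ∂_k y`. A non-zero derivative
at some `k < 0` then propagates to all smaller indices and one at `k > 0` to all larger ones, but
`y` depends on finitely many variables. -/
theorem isColumn_of_T_one {y β γ : K} (hβ0 : β ≠ 0) (hβ : C.IsNearColumn β)
    (hγ : C.IsNearColumn γ) (h : C.T 1 0 y = β * y + γ) : C.IsColumn y := by
  have h1 : ∀ k, k ≠ 0 → k ≠ 1 → C.T 1 0 (C.dd (k - 1, 0) y) = β * C.dd (k, 0) y := by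
    intro k hk hk'
    rw [← C.dd_T_one hk hk', h, C.dd_add, C.dd_mul, hβ k hk hk', hγ k hk hk']
    ring
  obtain ⟨n, hn, -⟩ := C.dd_T y
  have hout : ∀ k : ℤ, (n : ℤ) < |k| → C.dd (k, 0) y = 0 := fun k hk => hn _ fun h => by
    have := (mem_window.1 (mem_cross.1 h).1).1
    simp only at this
    omega
  intro k hk
  rcases lt_or_gt_of_ne hk with hk | hk
  · have h2 : ∀ m : ℕ, C.dd (k, 0) y ≠ 0 → C.dd (k - m, 0) y ≠ 0 := by
      intro m h0
      induction m with
      | zero => simpa using h0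
      | succ m ih =>
        have h3 := h1 (k - m) (by omega) (by omega)
        intro h4
        rw [show k - (m : ℤ) - 1 = k - ((m + 1 : ℕ) : ℤ) by push_cast; ring, h4, map_zero] at h3
        exact mul_ne_zero hβ0 ih h3.symm
    by_contra h0
    refine h2 (n + 1) h0 (hout _ ?_)
    rw [abs_of_neg] <;> push_cast <;> omega
  · have h2 : ∀ m : ℕ, C.dd (k, 0) y ≠ 0 → C.dd (k + m, 0) y ≠ 0 := by
      intro m h0
      induction m with
      | zero => simpa using h0
      | succ m ih =>
        have h3 := h1 (k + (m + 1)) (by omega) (by omega)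
        intro h4
        rw [show k + ((m : ℤ) + 1) - 1 = k + m by ring] at h3
        push_cast at h4
        rw [h4, mul_zero, C.T_eq_zero] at h3
        exact ih h3
    by_contra h0
    refine h2 (n + 1) h0 (hout _ ?_)
    rw [abs_of_pos] <;> push_cast <;> omega

variable {C}

theorem IsColumn.isNearColumn {f : K} (h : C.IsColumn f) : C.IsNearColumn f := fun k hk _ => h k hk

theorem IsNearColumn.add {f g : K} (hf : C.IsNearColumn f) (hg : C.IsNearColumn g) :
    C.IsNearColumn (f + g) := fun k h1 h2 => by rw [C.dd_add, hf k h1 h2, hg k h1 h2, add_zero]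

theorem IsNearColumn.mul {f g : K} (hf : C.IsNearColumn f) (hg : C.IsNearColumn g) :
    C.IsNearColumn (f * g) := fun k h1 h2 => by rw [C.dd_mul, hf k h1 h2, hg k h1 h2]; ring

theorem IsColumn.T_one {f : K} (hf : C.IsColumn f) : C.IsNearColumn (C.T 1 0 f) := fun k h1 h2 => by
  rw [C.dd_T_one h1 h2, hf (k - 1) (by omega), map_zero]

theorem IsNearColumn.T_zero {f : K} (hf : C.IsNearColumn f) (b : ℤ) :
    C.IsNearColumn (C.T 0 b f) := by
  intro k hk hk'
  obtain ⟨n, h1, h2⟩ := C.dd_T f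
  rw [h2]
  refine Finset.sum_eq_zero ?_
  rintro ⟨c, d⟩ hq
  by_cases hc : c = 0
  · subst hc; rw [add_zero, C.dd_x_column hk, mul_zero]
  obtain rfl : d = 0 := by simpa [hc] using (mem_cross.1 hq).2
  by_cases hc' : c = 1
  · subst hc'; rw [add_zero, C.dd_x_one hk hk', mul_zero]
  · rw [hf c hc hc', map_zero, zero_mul]

theorem IsColumn.T_zero {f : K} (hf : C.IsColumn f) (b : ℤ) : C.IsColumn (C.T 0 b f) := by
  intro k hk
  obtain ⟨n, h1, h2⟩ := C.dd_T f
  rw [h2]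
  refine Finset.sum_eq_zero ?_
  rintro ⟨c, d⟩ hq
  by_cases hc : c = 0
  · subst hc; rw [add_zero, C.dd_x_column hk, mul_zero]
  obtain rfl : d = 0 := by simpa [hc] using (mem_cross.1 hq).2
  rw [hf c hc, map_zero, zero_mul]

theorem IsColumn.dd_T_zero {f : K} (hf : C.IsColumn f) (b l : ℤ) :
    C.dd (0, l) (C.T 0 b f) = C.T 0 b (C.dd (0, l - b) f) := by
  obtain ⟨n, h1, h2⟩ := C.dd_T f
  rw [h2, C.sum_eq_single h1 (0, l - b)]
  · simp only [sub_add_cancel, add_zero]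
    rw [C.dd_x _ _ (Or.inl rfl), if_pos rfl, mul_one]
  · rintro ⟨c, d⟩ hq hne
    by_cases hc : c = 0
    · right
      subst hc
      rw [add_zero, C.dd_x _ _ (Or.inl rfl), if_neg]
      simp only [Prod.mk.injEq, true_and, ne_eq] at hne ⊢
      omega
    · left
      obtain rfl : d = 0 := by simpa [hc] using (mem_cross.1 hq).2
      exact hf c hc

variable (C)

theorem isNearColumn_α : C.IsNearColumn C.α := fun k h1 h2 =>
  C.dd_α _ (by simp [h1]) (by simp [h2]) (by simp)

theorem isNearColumn_β : C.IsNearColumn C.β := fun k h1 h2 =>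
  C.dd_β _ (by simp [h1]) (by simp [h2]) (by simp)

theorem isNearColumn_γ : C.IsNearColumn C.γ := fun k h1 h2 =>
  C.dd_γ _ (by simp [h1]) (by simp [h2]) (by simp)

theorem dd_one (p : ℤ × ℤ) : C.dd p 1 = 0 := by
  have h := C.dd_mul p 1 1
  rw [mul_one, mul_one, one_mul] at h
  exact left_eq_add.1 h

theorem dd_zero (p : ℤ × ℤ) : C.dd p 0 = 0 := by
  have h := C.dd_mul p 0 0
  simpa using h

theorem isColumn_of_integral {J : K} (h : C.T 1 0 J = J) : C.IsColumn J :=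
  C.isColumn_of_T_one (β := 1) (γ := 0) one_ne_zero (fun k _ _ => C.dd_one _)
    (fun k _ _ => C.dd_zero _) (by rw [h]; ring)

/-- A non-constant integral can be shifted so that it depends on a prescribed range of variables
only. -/
theorem exists_integral {J : K} (h : C.T 1 0 J = J) {p : ℤ × ℤ} (hp : p ∈ axes)
    (h0 : C.dd p J ≠ 0) : ∃ J', C.T 1 0 J' = J' ∧ C.IsColumn J' ∧ (∀ l ≤ 0, C.dd (0, l) J' = 0) ∧
      ∃ m : ℕ, 1 ≤ m ∧ C.dd (0, m) J' ≠ 0 ∧ ∀ l, (m : ℤ) < l → C.dd (0, l) J' = 0 := by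
  classical
  have hc := C.isColumn_of_integral h
  obtain ⟨n, hn, -⟩ := C.dd_T J
  have hout : ∀ l : ℤ, (n : ℤ) < |l| → C.dd (0, l) J = 0 := fun l hl => hn _ fun h => by
    have := (mem_window.1 (mem_cross.1 h).1).2
    simp only at this
    omega
  have hl : ∃ l, C.dd (0, l) J ≠ 0 := by
    obtain ⟨a, b⟩ := p
    by_cases ha : a = 0
    · exact ⟨b, ha ▸ h0⟩
    · obtain rfl : b = 0 := by simpa [mem_axes, ha] using hp
      exact absurd (hc a ha) h0
  -- The variables of `J` lie in `|l| ≤ n`, so this shift makes all indices positive; the maximal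
  -- one is then a natural number of size at most `2 * n + 1`.
  set J' := C.T 0 (n + 1) J with hJ'
  have hd : ∀ l, C.dd (0, l) J' = C.T 0 (n + 1) (C.dd (0, l - (n + 1)) J) := fun l =>
    hc.dd_T_zero (n + 1) l
  have hlow : ∀ l ≤ 0, C.dd (0, l) J' = 0 := by
    intro l hl
    rw [hd, hout, map_zero]
    rw [abs_of_neg] <;> omega
  have hhigh : ∀ l, 2 * (n : ℤ) + 1 < l → C.dd (0, l) J' = 0 := by
    intro l hl
    rw [hd, hout, map_zero]
    rw [abs_of_pos] <;> omega
  obtain ⟨l, hl⟩ := hl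
  have hl' : C.dd (0, l + (n + 1)) J' ≠ 0 := by
    rw [hd, add_sub_cancel_right]; exact fun h => hl (C.T_eq_zero.1 h)
  have hex : ∃ m : ℕ, m ≤ 2 * n + 1 ∧ C.dd (0, m) J' ≠ 0 := by
    have h1 : ¬ l + (n + 1) ≤ 0 := fun h => hl' (hlow _ h)
    have h2 : ¬ 2 * (n : ℤ) + 1 < l + (n + 1) := fun h => hl' (hhigh _ h)
    refine ⟨(l + (n + 1)).toNat, by omega, ?_⟩
    rwa [Int.toNat_of_nonneg (by omega)]
  set m := Nat.findGreatest (fun m : ℕ => C.dd (0, (m : ℤ)) J' ≠ 0) (2 * n + 1) with hm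
  obtain ⟨m₀, hm₀, hm₀'⟩ := hex
  have hspec : C.dd (0, (m : ℤ)) J' ≠ 0 :=
    Nat.findGreatest_spec (P := fun m : ℕ => C.dd (0, (m : ℤ)) J' ≠ 0) hm₀ hm₀'
  refine ⟨J', ?_, hc.T_zero _, hlow, m, ?_, hspec, ?_⟩
  · rw [hJ', C.T_add, add_comm 1 (0 : ℤ), add_comm 0 ((n : ℤ) + 1), ← C.T_add, h]
  · by_contra hm1
    exact hspec (hlow _ (by omega))
  · intro l hl
    by_cases h2 : 2 * (n : ℤ) + 1 < l
    · exact hhigh l h2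
    · by_contra h3
      refine Nat.findGreatest_is_greatest (P := fun m : ℕ => C.dd (0, (m : ℤ)) J' ≠ 0)
        (n := 2 * n + 1) (k := l.toNat) (by omega) (by omega) ?_
      rwa [Int.toNat_of_nonneg (by omega)]

/-- Starting from u_{1,0}, the computation of u_{1,l} reaches u_{0,m} only at `l = m`, provided that
`m` is positive. There, `β` is the factor with which it enters. -/
theorem dd_x_one_of_lt {m : ℤ} (hm : 1 ≤ m) {l : ℤ} (hl : l < m) :
    C.dd (0, m) (C.x (1, l)) = 0 := by
  have h0 : ∀ l : ℤ, l ≠ m → C.dd (0, m) (C.x (0, l)) = 0 := by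
    intro l hl
    rw [C.dd_x _ _ (Or.inl rfl), if_neg]; simpa using hl
  induction l using Int.induction_on with
  | zero => rw [C.dd_x _ _ (Or.inr rfl), if_neg]; simp
  | succ l ih =>
    have := C.dd_equation (0, m) 0 l
    rw [zero_add] at this
    rw [this, ih (by omega), h0 _ (by omega), h0 _ (by omega)]; ring
  | pred l ih =>
    have := C.dd_equation (0, m) 0 (-l - 1)
    rw [zero_add, sub_add_cancel, ih (by omega), h0 _ (by omega), h0 _ (by omega)] at this
    simpa [C.T_eq_zero, C.α_ne] using this

theorem dd_x_one_self {m : ℤ} (hm : 1 ≤ m) :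
    C.dd (0, m) (C.x (1, m)) = C.T 0 (m - 1) C.β := by
  have := C.dd_equation (0, m) 0 (m - 1)
  rw [zero_add, sub_add_cancel, C.dd_x_one_of_lt hm (l := m - 1) (by omega), C.dd_x _ (0, m) (Or.inl rfl), if_pos rfl,
    C.dd_x _ (0, m - 1) (Or.inl rfl), if_neg (by simp)] at this
  rw [this]; ring

/-- The multiplier that a non-constant `j`-integral supplies. -/
theorem exists_multiplier {J : K} (h : C.T 1 0 J = J) {p : ℤ × ℤ} (hp : p ∈ axes)
    (h0 : C.dd p J ≠ 0) : ∃ μ : K, μ ≠ 0 ∧ C.T 1 0 μ = C.T 0 (-1) C.β * μ := by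
  obtain ⟨J', h1, hc, hlow, m, hm, hm0, hhigh⟩ := C.exists_integral h hp h0
  have hm' : 1 ≤ (m : ℤ) := by exact_mod_cast hm
  -- `T_i(J') = J'` is differentiated in the highest variable u_{0,m}, on which only u_{1,m} among
  -- the shifted variables depends.
  have h2 : C.T 1 0 (C.dd (0, m) J') * C.T 0 (m - 1) C.β = C.dd (0, m) J' := by
    obtain ⟨n, h3, h4⟩ := C.dd_T J'
    have h5 := h4 1 0 (0, m)
    rw [h1, C.sum_eq_single h3 (0, m)] at h5
    · simp only [zero_add, add_zero] at h5
      rw [C.dd_x_one_self hm'] at h5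
      exact h5.symm
    · rintro ⟨c, d⟩ hq hne
      by_cases hc' : c = 0
      · subst hc'
        simp only [zero_add, add_zero]
        rcases lt_trichotomy d m with hd | hd | hd
        · exact Or.inr (C.dd_x_one_of_lt hm' hd)
        · exact absurd (by rw [hd]) hne
        · exact Or.inl (hhigh d hd)
      · left
        obtain rfl : d = 0 := by simpa [hc'] using (mem_cross.1 hq).2
        exact hc c hc'
  -- Inverting the leading derivative turns division by `β` into multiplication, and the shift by
  -- `-m` moves `T_j^{m-1}(β)` to `T_j^{-1}(β)`.
  refine ⟨C.T 0 (-m) (C.dd (0, m) J')⁻¹, ?_, ?_⟩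
  · exact fun h => inv_ne_zero hm0 (C.T_eq_zero.1 h)
  · have hβ : C.T 0 (m - 1) C.β ≠ 0 := fun h => C.β_ne (C.T_eq_zero.1 h)
    have hT : C.T 1 0 (C.dd (0, m) J') ≠ 0 := fun h => hm0 (C.T_eq_zero.1 h)
    have h3 : C.T 1 0 (C.dd (0, m) J')⁻¹ = C.T 0 (m - 1) C.β * (C.dd (0, m) J')⁻¹ := by
      rw [map_inv₀]
      conv_rhs => rw [← h2]
      field_simp
    rw [C.T_add, add_comm 1 (0 : ℤ), add_comm 0 (-(m : ℤ)), ← C.T_add, h3, map_mul, C.T_add]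
    congr 3 <;> ring

/-- An `i`-integral gives a linear relation that the linearized equation preserves. -/
theorem exists_relation {I : K} (h : C.T 0 1 I = I) {p : ℤ × ℤ} (hp : p ∈ axes)
    (h0 : C.dd p I ≠ 0) : ∃ (n : ℕ) (ι : ℕ → K), 1 ≤ n ∧ ι n ≠ 0 ∧ ∀ g₀ g₁ : ℕ → K,
      (∀ k < n, g₁ (k + 1) = C.T k 0 C.α * g₀ (k + 1) + C.T k 0 C.β * g₁ k + C.T k 0 C.γ * g₀ k) →
      ∑ k ∈ Finset.range (n + 1), C.T 0 1 (ι k) * g₁ k =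
        ∑ k ∈ Finset.range (n + 1), ι k * g₀ k := by
  -- With the lattice directions interchanged, an i-integral becomes a j-integral. The relation is
  -- the differential of `T_j(I') = I'`, and its coefficients are the derivatives of `I'` in the row
  -- variables.
  obtain ⟨I', h1, hrow, hlow, n, hn, hn0, hhigh⟩ := C.swap.exists_integral (J := I) h (p := p.swap)
    (by rw [mem_axes] at hp ⊢; exact hp.symm) (by simpa [swap] using h0)
  change C.T 0 1 I' = I' at h1
  replace hrow : ∀ l, l ≠ 0 → C.dd (0, l) I' = 0 := hrow
  replace hlow : ∀ l ≤ 0, C.dd (l, 0) I' = 0 := hlow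
  replace hhigh : ∀ l, (n : ℤ) < l → C.dd (l, 0) I' = 0 := hhigh
  refine ⟨n, fun k => C.dd (k, 0) I', hn, hn0, fun g₀ g₁ hg => ?_⟩
  obtain ⟨N, h2, h3⟩ := C.dd_T I'
  have hsum : ∀ p, C.dd p I' = ∑ k ∈ Finset.range (n + 1),
      C.T 0 1 (C.dd ((k : ℤ), 0) I') * C.dd p (C.x ((k : ℤ), 1)) := by
    intro p
    conv_lhs => rw [← h1, h3]
    refine (Finset.sum_of_injOn
      (s := (Finset.range (n + 1)).filter fun k : ℕ => ((k : ℤ), (0 : ℤ)) ∈ cross N)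
      (f := fun k : ℕ => C.T 0 1 (C.dd ((k : ℤ), 0) I') * C.dd p (C.x ((k : ℤ), 1)))
      (fun k : ℕ => ((k : ℤ), (0 : ℤ))) ?_ ?_ ?_ ?_).symm.trans ?_
    · intro a _ b _ hab; simpa using hab
    · intro a ha; simpa using (Finset.mem_filter.1 ha).2
    · rintro ⟨c, d⟩ hq hnot
      have h4 : C.dd (c, d) I' = 0 := by
        by_contra h5
        have hd : d = 0 := by
          by_contra hd
          obtain rfl : c = 0 := by simpa [hd] using (mem_cross.1 hq).2
          exact h5 (hrow d hd)
        subst hd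
        have h6 : ¬ c ≤ 0 := fun h => h5 (hlow c h)
        have h7 : ¬ (n : ℤ) < c := fun h => h5 (hhigh c h)
        refine hnot ⟨c.toNat, ?_, ?_⟩
        · have : ((c.toNat : ℕ) : ℤ) = c := Int.toNat_of_nonneg (by omega)
          rw [Finset.mem_coe, Finset.mem_filter, this]
          exact ⟨Finset.mem_range.2 (by omega), hq⟩
        · simp only [Int.toNat_of_nonneg (show 0 ≤ c by omega)]
      rw [h4, map_zero, zero_mul]
    · intro k _
      simp only [add_zero, zero_add]
    · rw [Finset.sum_filter]
      refine Finset.sum_congr rfl fun k _ => ?_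
      split_ifs with h4
      · rfl
      · rw [h2 _ h4, map_zero, zero_mul]
  -- The variation of u_q when u_{k,0} varies by `g₀ k` and u_{0,1} by `g₁ 0`. It solves the
  -- linearized equation, so its values on the rows 0 and 1 are the given `g₀` and `g₁`.
  set G : ℤ × ℤ → K := fun q => ∑ k ∈ Finset.range (n + 1), g₀ k * C.dd ((k : ℤ), 0) (C.x q) +
    g₁ 0 * C.dd (0, 1) (C.x q) with hG
  have hG0 : ∀ k : ℕ, k ≤ n → G ((k : ℤ), 0) = g₀ k := by
    intro k hk
    simp only [G]
    rw [Finset.sum_eq_single k]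
    · rw [C.dd_x _ _ (Or.inr rfl), C.dd_x _ _ (Or.inr rfl), if_pos rfl, if_neg (by simp)]; ring
    · intro b _ hb
      rw [C.dd_x _ _ (Or.inr rfl), if_neg, mul_zero]
      simpa using Ne.symm hb
    · intro h; exact absurd (Finset.mem_range.2 (by omega)) h
  have hG1 : ∀ k : ℕ, k ≤ n → G ((k : ℤ), 1) = g₁ k := by
    intro k
    induction k with
    | zero =>
      intro _
      simp only [G, Nat.cast_zero]
      rw [Finset.sum_eq_zero, C.dd_x _ _ (Or.inl rfl), if_pos rfl]
      · ring
      · intro b _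
        rw [C.dd_x _ _ (Or.inl rfl), if_neg (by simp), mul_zero]
    | succ k ih =>
      intro hk
      rw [hg k (by omega), ← ih (by omega), ← hG0 k (by omega), ← hG0 (k + 1) hk]
      have h4 : ∀ p, C.dd p (C.x (((k + 1 : ℕ) : ℤ), 1)) = C.T k 0 C.α * C.dd p (C.x ((k : ℤ) + 1, 0)) +
          C.T k 0 C.β * C.dd p (C.x ((k : ℤ), 1)) + C.T k 0 C.γ * C.dd p (C.x ((k : ℤ), 0)) := by
        intro p
        have := C.dd_equation p k 0
        rw [zero_add] at this
        push_cast
        exact this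
      simp only [G, h4]
      push_cast
      simp only [mul_add, Finset.sum_add_distrib, Finset.mul_sum]
      have h5 : ∀ (c : K) (q : ℤ × ℤ), ∑ b ∈ Finset.range (n + 1), g₀ b * (c * C.dd ((b : ℤ), 0) (C.x q))
          = ∑ b ∈ Finset.range (n + 1), c * (g₀ b * C.dd ((b : ℤ), 0) (C.x q)) := fun c q =>
        Finset.sum_congr rfl fun b _ => by ring
      simp only [h5]
      ring
  have h01 : C.dd (0, 1) I' = 0 := hrow 1 one_ne_zero
  calc ∑ k ∈ Finset.range (n + 1), C.T 0 1 (C.dd ((k : ℤ), 0) I') * g₁ k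
      = ∑ k ∈ Finset.range (n + 1), C.T 0 1 (C.dd ((k : ℤ), 0) I') * G ((k : ℤ), 1) :=
        Finset.sum_congr rfl fun k hk => by rw [hG1 k (by simpa [Nat.lt_succ_iff] using hk)]
    _ = ∑ k ∈ Finset.range (n + 1), g₀ k * C.dd ((k : ℤ), 0) I' + g₁ 0 * C.dd (0, 1) I' := by
        simp only [G, mul_add, Finset.sum_add_distrib, Finset.mul_sum]
        rw [Finset.sum_comm, hsum (0, 1), Finset.mul_sum]
        congr 1
        · refine Finset.sum_congr rfl fun b _ => ?_
          rw [hsum ((b : ℤ), 0), Finset.mul_sum]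
          exact Finset.sum_congr rfl fun k _ => by ring
        · exact Finset.sum_congr rfl fun k _ => by ring
    _ = ∑ k ∈ Finset.range (n + 1), C.dd ((k : ℤ), 0) I' * g₀ k := by
        rw [h01, mul_zero, add_zero]
        exact Finset.sum_congr rfl fun k _ => mul_comm _ _

/-- If there are non-constant integrals in both directions, then the linearized equation has
solutions of the form `∑ λ_q T_j^q(ξ)`, `T_i(ξ) = ξ`, with `λ_q` functions of the `u_{0,l}`. -/
theorem exists_operator {I J : K} (hI : C.T 0 1 I = I) {p : ℤ × ℤ} (hp : p ∈ axes)
    (hI0 : C.dd p I ≠ 0) (hJ : C.T 1 0 J = J) {p' : ℤ × ℤ} (hp' : p' ∈ axes)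
    (hJ0 : C.dd p' J ≠ 0) : ∃ (r : ℕ) (lam : ℤ → K), (∀ q < 0, lam q = 0) ∧
      (∀ q : ℤ, r < q → lam q = 0) ∧ lam r ≠ 0 ∧ (∀ q, C.IsColumn (lam q)) ∧
      ∀ q, C.T 1 1 (lam (q - 1)) = C.α * C.T 1 0 (lam q) + C.β * C.T 0 1 (lam (q - 1)) +
        C.γ * lam q := by
  obtain ⟨μ, hμ0, hμ⟩ := C.exists_multiplier hJ hp' hJ0
  obtain ⟨n, ι, hn, hι, hid⟩ := C.exists_relation hI hp hI0
  -- The component `y q` stands for `T_j^{-q}(λ_q)`; in these terms the equation for the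
  -- coefficients involves no shift but `T_i`.
  let σ : K ≃+* K := RingEquiv.ofRingHom (C.T 1 0) (C.T (-1) 0)
    (by ext f; simpa using C.T_neg_right 1 0 f) (by ext f; simpa using C.T_neg_left 1 0 f)
  have hσ : ∀ f, σ f = C.T 1 0 f := fun _ => rfl
  have hcoef : ∀ (f : K) (k : ℕ) (q : ℤ), σ (C.T k (-q) f) = C.T ((k + 1 : ℕ) : ℤ) (-q) f := by
    intro f k q
    rw [hσ, C.T_add]
    congr 2 <;> push_cast <;> ring
  have hid' : ∀ (q : ℤ) (g₀ g₁ : ℕ → K), (∀ k < n, g₁ (k + 1) = C.T k (-q) C.α * g₀ (k + 1) +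
      C.T k (-q) C.β * g₁ k + C.T k (-q) C.γ * g₀ k) →
      ∑ k ∈ Finset.range (n + 1), C.T 0 (-(q - 1)) (ι k) * g₁ k =
        ∑ k ∈ Finset.range (n + 1), C.T 0 (-q) (ι k) * g₀ k := by
    intro q g₀ g₁ hg
    have h1 := congrArg (C.T 0 (-q)) (hid (fun k => C.T 0 q (g₀ k)) (fun k => C.T 0 q (g₁ k)) (by
      intro k hk
      have h2 := congrArg (C.T 0 q) (hg k hk)
      simpa only [map_add, map_mul, C.T_add, zero_add, add_neg_cancel] using h2))
    simp only [map_sum, map_mul, C.T_add, zero_add, neg_add_cancel, C.T_zero] at h1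
    rw [show -(q - 1) = -q + 1 by ring]
    exact h1
  have hμ' : ∀ q : ℤ, σ (C.T 0 (-q) μ) = C.T (0 : ℕ) (-(q + 1)) C.β * C.T 0 (-q) μ := by
    intro q
    have h1 := congrArg (C.T 0 (-q)) hμ
    simp only [map_mul, C.T_add, zero_add, add_zero] at h1
    simp only [hσ, C.T_add, zero_add, add_zero, Nat.cast_zero]
    rw [h1, show -(q + 1) = -q + -1 by ring]
  obtain ⟨r, y, hy1, hy2, hy3, hy4⟩ := exists_finite_solution (A := fun k q => C.T k (-q) C.α)
    (B := fun k q => C.T k (-q) C.β) (C := fun k q => C.T k (-q) C.γ) (n := n) σ (hcoef _)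
    (hcoef _) (hcoef _) hn (ι := fun q k => C.T 0 (-q) (ι k))
    (fun q h => hι (C.T_eq_zero.1 h)) hid' (μ := fun q => C.T 0 (-q) μ)
    (fun q h => hμ0 (C.T_eq_zero.1 h)) hμ'
  · refine ⟨r, fun q => C.T 0 q (y q), fun q hq => by dsimp only; rw [hy1 q hq, map_zero],
      fun q hq => by dsimp only; rw [hy2 q hq, map_zero], fun h => hy3 (C.T_eq_zero.1 h), fun q => ?_,
      fun q => ?_⟩
    · refine IsColumn.T_zero ?_ q
      -- Descending induction from `q > r`, where `y q = 0`. Given `y (q + 1)`, the equation has the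
      -- form `T_i(y_q) = β' y_q + γ'` with coefficients in u_{1,0} and the column, so
      -- `isColumn_of_T_one` applies.
      have h1 : ∀ (m : ℕ) (q : ℤ), (r : ℤ) < q + m → C.IsColumn (y q) := by
        intro m
        induction m with
        | zero =>
          intro q hq
          rw [hy2 q (by simpa using hq)]
          exact fun k _ => C.dd_zero _
        | succ m ih =>
          intro q hq
          have h2 := ih (q + 1) (by push_cast at hq; omega)
          have h3 := hy4 (q + 1)
          rw [add_sub_cancel_right, hσ, hσ] at h3
          refine C.isColumn_of_T_one (β := C.T 0 (-(q + 1)) C.β)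
            (γ := C.T 0 (-(q + 1)) C.α * C.T 1 0 (y (q + 1)) + C.T 0 (-(q + 1)) C.γ * y (q + 1))
            (fun h => C.β_ne (C.T_eq_zero.1 h)) (C.isNearColumn_β.T_zero _)
            (((C.isNearColumn_α.T_zero _).mul h2.T_one).add
              ((C.isNearColumn_γ.T_zero _).mul h2.isNearColumn)) ?_
          rw [h3]; simp only [Nat.cast_zero]; ring
      exact h1 (r - q + 1).toNat q (by omega)
    · have h1 := congrArg (C.T 0 q) (hy4 q)
      simp only [hσ, map_add, map_mul, C.T_add, Nat.cast_zero, add_zero, zero_add,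
        add_neg_cancel, C.T_zero] at h1
      simp only [C.T_add, add_zero, zero_add]
      rw [show 1 + (q - 1) = q by ring, h1]

theorem dd_x_one_succ (l : ℤ) :
    C.dd (1, 0) (C.x (1, l + 1)) = C.T 0 l C.α * C.dd (1, 0) (C.x (1, l)) := by
  have := C.dd_equation (1, 0) 0 l
  rw [zero_add, C.dd_x_column one_ne_zero, C.dd_x_column one_ne_zero] at this
  rw [this]; ring

theorem dd_x_one_ne_zero (l : ℤ) : C.dd (1, 0) (C.x (1, l)) ≠ 0 := by
  have hα : ∀ l, C.T 0 l C.α ≠ 0 := fun l h => C.α_ne (C.T_eq_zero.1 h)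
  induction l using Int.induction_on with
  | zero => rw [C.dd_x _ _ (Or.inr rfl), if_pos rfl]; exact one_ne_zero
  | succ l ih => rw [dd_x_one_succ]; exact mul_ne_zero (hα _) ih
  | pred l ih =>
    have := C.dd_x_one_succ (-l - 1)
    rw [sub_add_cancel] at this
    rw [this] at ih
    exact right_ne_zero_of_mul ih

/-- A function `h` of the `u_{0,l}` with `T_i(h)` again a function of the `u_{0,l}` does not change
along the curves on which all the `T_i`-shifted substitution variables are constant; `θ` is the
ratio that describes these curves. -/
theorem sum_dd_eq_zero {h θ : K} (hc : C.IsColumn h) (hc' : C.IsColumn (C.T 1 0 h))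
    (hθ : C.T 1 0 θ = C.α) {n : ℕ} (hn : ∀ q, q ∉ cross n → C.dd q h = 0) :
      ∑ m ∈ Finset.range (2 * n + 1),
        (∏ i ∈ Finset.range m, C.T 0 (-(n : ℤ) + i) θ) * C.dd (0, -(n : ℤ) + m) h = 0 := by
  obtain ⟨N, h2, h3⟩ := C.dd_T h
  -- The tangent vector of the curves: the variation of the column `i = 1` caused by u_{1,0}, pulled
  -- back by `T_i`. Its successive ratios are the shifts of `θ`.
  set κ : ℤ → K := fun l => C.T (-1) 0 (C.dd (1, 0) (C.x (1, l))) with hκ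
  have hκ0 : ∀ l, κ l ≠ 0 := fun l hl => C.dd_x_one_ne_zero l (C.T_eq_zero.1 hl)
  have hκs : ∀ l, κ (l + 1) = C.T 0 l θ * κ l := by
    intro l
    simp only [hκ]
    rw [dd_x_one_succ, map_mul, C.T_add, ← hθ, C.T_add]
    congr 3 <;> ring
  have hκp : ∀ m : ℕ, κ (-n + m) = (∏ i ∈ Finset.range m, C.T 0 (-(n : ℤ) + i) θ) * κ (-n) := by
    intro m
    induction m with
    | zero => simp
    | succ m ih =>
      rw [Finset.prod_range_succ, show (-(n : ℤ) + (m + 1 : ℕ)) = (-n + m) + 1 by push_cast; ring,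
        hκs, ih]
      ring
  -- The chain rule for `∂(T_i h)/∂u_{1,0}`, which vanishes because `T_i(h)` is a column function.
  have h4 : ∑ m ∈ Finset.range (2 * n + 1),
      C.T 1 0 (C.dd (0, -(n : ℤ) + m) h) * C.dd (1, 0) (C.x (1, -(n : ℤ) + m)) = 0 := by
    rw [← hc' 1 one_ne_zero, h3]
    refine Eq.trans ?_ (Finset.sum_of_injOn
      (s := (Finset.range (2 * n + 1)).filter fun m : ℕ => ((0 : ℤ), -(n : ℤ) + m) ∈ cross N)
      (f := fun m : ℕ => C.T 1 0 (C.dd (0, -(n : ℤ) + m) h) *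
        C.dd (1, 0) (C.x (1, -(n : ℤ) + m)))
      (fun m : ℕ => ((0 : ℤ), -(n : ℤ) + m)) ?_ ?_ ?_ ?_)
    · rw [Finset.sum_filter]
      refine Finset.sum_congr rfl fun k _ => ?_
      split_ifs with h4
      · rfl
      · rw [h2 _ h4, map_zero, zero_mul]
    · intro a _ b _ hab; simpa using hab
    · intro a ha; simpa using (Finset.mem_filter.1 ha).2
    · rintro ⟨c, d⟩ hq hnot
      have h4 : C.dd (c, d) h = 0 := by
        by_contra h5
        have hd : c = 0 := by
          by_contra hd
          obtain rfl : d = 0 := by simpa [hd] using (mem_cross.1 hq).2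
          exact h5 (hc c hd)
        subst hd
        have h6 : ((0 : ℤ), d) ∈ cross n := by
          by_contra h6
          exact h5 (hn _ h6)
        have h7 := abs_le.1 (mem_window.1 (mem_cross.1 h6).1).2
        simp only at h7
        have h8 : (((d + n).toNat : ℕ) : ℤ) = d + n := Int.toNat_of_nonneg (by omega)
        refine hnot ⟨(d + n).toNat, ?_, ?_⟩
        · rw [Finset.mem_coe, Finset.mem_filter, h8, neg_add_cancel_comm_assoc]
          exact ⟨Finset.mem_range.2 (by omega), hq⟩
        · simp only [h8, neg_add_cancel_comm_assoc]
      rw [h4, map_zero, zero_mul]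
    · intro k _
      simp only [add_zero, zero_add]
  have h5 := congrArg (C.T (-1) 0) h4
  rw [map_sum, map_zero] at h5
  refine (mul_eq_zero.1 ?_).resolve_right (hκ0 (-n))
  rw [Finset.sum_mul, ← h5]
  refine Finset.sum_congr rfl fun m _ => ?_
  have h6 := hκp m
  simp only [hκ] at h6
  rw [map_mul, h6, C.T_add, neg_add_cancel, zero_add, C.T_zero]
  ring

end CrossField

end QuadGraph

/-! ### Functions defined near the whole set `S`, and the consequences of its connectedness. -/

namespace QuadGraph

variable {𝕜 : Type*} [RCLike 𝕜]
variable {D : Set (𝕜 × 𝕜 × 𝕜)} {F : 𝕜 × 𝕜 × 𝕜 → 𝕜} {S : Set (ℤ × ℤ → 𝕜)}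
  {s : ℤ × ℤ → 𝕜} {K K' : Set (ℤ × ℤ)} {f g : (ℤ × ℤ → 𝕜) → 𝕜}

/-- Near `s`, the function `g` agrees on solutions with a quotient of analytic functions of finitely
many `u p`, `p ∈ K`. -/
def SolMeroIn (D : Set (𝕜 × 𝕜 × 𝕜)) (F : 𝕜 × 𝕜 × 𝕜 → 𝕜) (K : Set (ℤ × ℤ)) (s : ℤ × ℤ → 𝕜)
    (g : (ℤ × ℤ → 𝕜) → 𝕜) : Prop :=
  ∃ A B : (ℤ × ℤ → 𝕜) → 𝕜, AnalyticIn K s A ∧ AnalyticIn K s B ∧ (∃ᶠ u in 𝓝 s, B u ≠ 0) ∧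
    ∀ᶠ u in solFilter D F s, g u = A u / B u

theorem MeroIn.solMeroIn (hK : K ⊆ axes) (h : MeroIn K s g) : SolMeroIn D F K s g := by
  obtain ⟨A, B, hA, hB, hB0, h⟩ := h
  refine ⟨A, B, hA, hB, hB0, ?_⟩
  filter_upwards [solFilter_le_nhds h, (hB.mono hK).eventually_ne hB0] with u h1 h2 using h1 h2

/-- A function that does not change with one of the variables does not depend on it. -/
theorem SolMeroIn.without (hF : IsEquation D F) (hs : ∀ i j, SolvesAt D F s i j) {p : ℤ × ℤ}
    (hK : insert p K ⊆ axes) (h : SolMeroIn D F (insert p K) s g) (hg : MeroIn axes s g)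
    (hp : ∀ᶠ u in solFilter D F s, pd p g u = 0) : SolMeroIn D F K s g := by
  obtain ⟨A, B, hA, hB, hB0, h⟩ := h
  have hA' := hA.mono hK
  have hB' := hB.mono hK
  have hq : MeroIn axes s fun u => A u / B u :=
    ⟨A, B, hA', hB', hB0, Eventually.of_forall fun _ _ => rfl⟩
  have h1 := hg.eventuallyEq hF hs hq h
  have h2 : ∀ᶠ u in genFilter s, pd p g u = 0 :=
    (hg.pd p).eventuallyEq hF hs (AnalyticIn.const _ _ 0).meroIn hp
  have h3 : ∀ᶠ u in 𝓝 s, pd p A u * B u = A u * pd p B u := by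
    obtain ⟨b, hb, hb0, h4⟩ := eventually_genFilter.1 ((eventually_pd_congr_genFilter h1 p).and
      (h2.and ((hB.eventually_ne_genFilter hK hB0).and
        (genFilter_le_nhds (hA.eventually.and hB.eventually)))))
    refine ((hA'.pd p).mul hB').eventually_eq_of_mul_eq (hA'.mul (hB'.pd p)) hb hb0 ?_
    filter_upwards [h4] with u h5 h6
    obtain ⟨h7, h8, h9, h10, h11⟩ := h5 h6
    rw [h7, pd_div h10 h11 h9, div_eq_zero_iff, or_iff_left (pow_ne_zero 2 h9), sub_eq_zero] at h8
    exact h8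
  obtain ⟨A', B', h4, h5, h6, h7⟩ := exists_quotient_without hA hB hB0 h3
  have hK' : K ⊆ axes := (Set.subset_insert p K).trans hK
  refine ⟨A', B', h4, h5, h6, ?_⟩
  filter_upwards [h, solFilter_le_nhds h7, hB'.eventually_ne hB0,
    (h5.mono hK').eventually_ne h6] with u h8 h9 h10 h11
  rw [h8, div_eq_div_iff h10 h11, h9]

theorem SolMeroIn.without_finset (hF : IsEquation D F) (hs : ∀ i j, SolvesAt D F s i j)
    (L : Finset (ℤ × ℤ)) (hK : (L : Set (ℤ × ℤ)) ∪ K ⊆ axes)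
    (h : SolMeroIn D F (L ∪ K) s g) (hg : MeroIn axes s g)
    (hp : ∀ p ∈ L, ∀ᶠ u in solFilter D F s, pd p g u = 0) : SolMeroIn D F K s g := by
  classical
  induction L using Finset.induction_on with
  | empty => simpa using h
  | insert p L hpL ih =>
    rw [Finset.coe_insert, Set.insert_union] at h hK
    exact ih ((Set.subset_insert _ _).trans hK)
      (h.without hF hs hK hg (hp p (by simp))) fun q hq => hp q (by simp [hq])

/-- Generic points near `S` that satisfy the equation. -/
def solSup (D : Set (𝕜 × 𝕜 × 𝕜)) (F : 𝕜 × 𝕜 × 𝕜 → 𝕜) (S : Set (ℤ × ℤ → 𝕜)) :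
    Filter (ℤ × ℤ → 𝕜) := ⨆ s ∈ S, solFilter D F s

theorem eventually_solSup {P : (ℤ × ℤ → 𝕜) → Prop} :
    (∀ᶠ u in solSup D F S, P u) ↔ ∀ s ∈ S, ∀ᶠ u in solFilter D F s, P u := by
  simp [solSup, eventually_iSup]

theorem tendsto_shift_solSup (hF : IsEquation D F) (hS : IsBase D F S) (a b : ℤ) :
    Tendsto (shift a b) (solSup D F S) (solSup D F S) := by
  refine tendsto_iff_eventually.2 fun P hP => eventually_solSup.2 fun s hs => ?_
  exact (tendsto_shift_solFilter hF hS hs a b).eventually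
    (eventually_solSup.1 hP _ (hS.shift_mem hs a b))

/-- A quotient of analytic functions of the same finitely many dynamical variables near each
member of `S`. -/
def Honest (S : Set (ℤ × ℤ → 𝕜)) (g : (ℤ × ℤ → 𝕜) → 𝕜) : Prop :=
  ∃ n : ℕ, ∀ s ∈ S, MeroIn (cross n : Set (ℤ × ℤ)) s g

theorem Honest.meroIn (h : Honest S g) (hs : s ∈ S) : MeroIn axes s g := by
  obtain ⟨n, hn⟩ := h
  exact (hn s hs).mono (cross_subset_axes n)

theorem Honest.add (hf : Honest S f) (hg : Honest S g) : Honest S fun u => f u + g u := by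
  obtain ⟨n, hn⟩ := hf
  obtain ⟨m, hm⟩ := hg
  exact ⟨max n m, fun s hs =>
    ((hn s hs).mono (by exact_mod_cast cross_mono (le_max_left n m))).add
      ((hm s hs).mono (by exact_mod_cast cross_mono (le_max_right n m)))⟩

theorem Honest.mul (hf : Honest S f) (hg : Honest S g) : Honest S fun u => f u * g u := by
  obtain ⟨n, hn⟩ := hf
  obtain ⟨m, hm⟩ := hg
  exact ⟨max n m, fun s hs =>
    ((hn s hs).mono (by exact_mod_cast cross_mono (le_max_left n m))).mul
      ((hm s hs).mono (by exact_mod_cast cross_mono (le_max_right n m)))⟩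

theorem Honest.neg (hf : Honest S f) : Honest S fun u => - f u := by
  obtain ⟨n, hn⟩ := hf
  exact ⟨n, fun s hs => (hn s hs).neg⟩

theorem Honest.inv (hf : Honest S f) : Honest S fun u => (f u)⁻¹ := by
  obtain ⟨n, hn⟩ := hf
  exact ⟨n, fun s hs => (hn s hs).inv⟩

theorem Honest.pd (hf : Honest S f) (p : ℤ × ℤ) : Honest S (pd p f) := by
  obtain ⟨n, hn⟩ := hf
  exact ⟨n, fun s hs => (hn s hs).pd p⟩

theorem Honest.const (S : Set (ℤ × ℤ → 𝕜)) (c : 𝕜) : Honest S fun _ => c :=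
  ⟨0, fun _ _ => (AnalyticIn.const _ _ c).meroIn⟩

theorem Honest.eventuallyEq_genFilter (hF : IsEquation D F) (hS : IsBase D F S) (hf : Honest S f)
    (hg : Honest S g) (h : f =ᶠ[solSup D F S] g) (hs : s ∈ S) : f =ᶠ[genFilter s] g :=
  (hf.meroIn hs).eventuallyEq hF (hS.solves s hs) (hg.meroIn hs) (eventually_solSup.1 h s hs)

theorem Honest.pd_congr (hF : IsEquation D F) (hS : IsBase D F S) (hf : Honest S f)
    (hg : Honest S g) (h : f =ᶠ[solSup D F S] g) (p : ℤ × ℤ) :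
    QuadGraph.pd p f =ᶠ[solSup D F S] QuadGraph.pd p g :=
  eventually_solSup.2 fun _ hs => solFilter_le_genFilter
    (eventually_pd_congr_genFilter (hf.eventuallyEq_genFilter hF hS hg h hs) p)

theorem isOpen_eventually_solFilter (P : (ℤ × ℤ → 𝕜) → Prop) :
    IsOpen {s | ∀ᶠ u in solFilter D F s, P u} :=
  isOpen_iff_mem_nhds.2 fun _ hs => eventually_eventually_solFilter hs

theorem solSup_neBot (hF : IsEquation D F) (hS : IsBase D F S) : (solSup D F S).NeBot := by
  obtain ⟨s, hs⟩ := hS.connected.nonempty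
  have := solFilter_neBot hF (hS.solves s hs)
  exact this.mono (le_iSup₂_of_le s hs le_rfl)

/-- The members of `S` with zero germ and those with generically non-zero germ lie in two open sets
that cover `S` and cannot share a member of it, so connectedness leaves only one of them. -/
theorem Honest.eq_zero_or (hF : IsEquation D F) (hS : IsBase D F S) (h : Honest S g) :
    (∀ᶠ u in solSup D F S, g u = 0) ∨ ∀ᶠ u in solSup D F S, g u ≠ 0 := by
  have h1 : ∀ s ∈ S, (∀ᶠ u in solFilter D F s, g u = 0) ∨ ∀ᶠ u in solFilter D F s, g u ≠ 0 :=
    fun s hs => ((h.meroIn hs).eq_zero_or subset_rfl).imp (fun h => solFilter_le_genFilter h)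
      fun h => solFilter_le_genFilter h
  by_contra hc
  obtain ⟨⟨s, hs, h2⟩, t, ht, h3⟩ : (∃ s ∈ S, ¬ ∀ᶠ u in solFilter D F s, g u = 0) ∧
      ∃ s ∈ S, ¬ ∀ᶠ u in solFilter D F s, g u ≠ 0 := by
    rw [not_or, eventually_solSup, eventually_solSup] at hc
    constructor <;> by_contra! h
    · exact hc.1 h
    · exact hc.2 h
  obtain ⟨r, hr, h4, h5⟩ := hS.connected.isPreconnected _ _
    (isOpen_eventually_solFilter (D := D) (F := F) fun u => g u = 0)
    (isOpen_eventually_solFilter (D := D) (F := F) fun u => g u ≠ 0) h1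
    ⟨t, ht, (h1 t ht).resolve_right h3⟩ ⟨s, hs, (h1 s hs).resolve_left h2⟩
  have := solFilter_neBot hF (hS.solves r hr)
  replace h4 : ∀ᶠ u in solFilter D F r, g u = 0 := h4
  obtain ⟨u, h6, h7⟩ := (h4.and h5).exists
  exact h7 h6

/-- A function that changes with none of the dynamical variables is constant. -/
theorem Honest.exists_eq_const (hF : IsEquation D F) (hS : IsBase D F S) (h : Honest S g)
    (hp : ∀ p ∈ axes, ∀ᶠ u in solSup D F S, QuadGraph.pd p g u = 0) :
    ∃ C : 𝕜, ∀ s ∈ S, ∀ᶠ u in genFilter s, g u = C := by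
  obtain ⟨n, hn⟩ := id h
  have h1 : ∀ s ∈ S, ∃ C : 𝕜, ∀ᶠ u in solFilter D F s, g u = C := by
    intro s hs
    obtain ⟨A, B, ⟨L, hL, A', _, hA⟩, ⟨L', hL', B', _, hB⟩, -, h2⟩ :=
      SolMeroIn.without_finset hF (hS.solves s hs) (K := ∅) (cross n)
      (by simpa using cross_subset_axes n)
      (by simpa using (hn s hs).solMeroIn (D := D) (F := F) (cross_subset_axes n)) (h.meroIn hs)
      (fun p hp' => eventually_solSup.1 (hp p (cross_subset_axes n hp')) s hs)
    -- All variables have been removed, so the numerator and the denominator are functions of no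
    -- coordinates.
    have hr : ∀ (L : Finset (ℤ × ℤ)), (L : Set (ℤ × ℤ)) ⊆ ∅ → ∀ u, res L u = res L s :=
      fun L hL u => funext fun q => (hL q.2).elim
    refine ⟨A' (res L s) / B' (res L' s), ?_⟩
    filter_upwards [h2, solFilter_le_nhds hA, solFilter_le_nhds hB] with u h3 h4 h5
    rw [h3, h4, h5, hr L hL u, hr L' hL' u]
  obtain ⟨s₀, hs₀⟩ := hS.connected.nonempty
  obtain ⟨C, hC⟩ := h1 s₀ hs₀
  refine ⟨C, fun s hs => (h.meroIn hs).eventuallyEq hF (hS.solves s hs)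
    (AnalyticIn.const _ _ C).meroIn ?_⟩
  by_contra hne
  -- The local constants might differ; the open sets belonging to different constants cannot meet
  -- within the connected set `S`.
  have hcov : S ⊆ {s | ∀ᶠ u in solFilter D F s, g u = C} ∪
      ⋃ C' : {C' // C' ≠ C}, {s | ∀ᶠ u in solFilter D F s, g u = C'} := by
    intro t ht
    obtain ⟨C', h⟩ := h1 t ht
    by_cases hc : C' = C
    · exact Or.inl (hc ▸ h)
    · exact Or.inr (Set.mem_iUnion.2 ⟨⟨C', hc⟩, h⟩)
  have hne' : (S ∩ ⋃ C' : {C' // C' ≠ C}, {s | ∀ᶠ u in solFilter D F s, g u = C'}).Nonempty := by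
    obtain ⟨C', h⟩ := h1 s hs
    refine ⟨s, hs, Set.mem_iUnion.2 ⟨⟨C', fun hc => hne ?_⟩, h⟩⟩
    exact hc ▸ h
  obtain ⟨r, hr, h4, h5⟩ := hS.connected.isPreconnected _ _ (isOpen_eventually_solFilter _)
    (isOpen_iUnion fun C' => isOpen_eventually_solFilter _) hcov ⟨s₀, hs₀, hC⟩ hne'
  obtain ⟨⟨C', hC'⟩, h6⟩ := Set.mem_iUnion.1 h5
  have := solFilter_neBot hF (hS.solves r hr)
  replace h4 : ∀ᶠ u in solFilter D F r, g u = C := h4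
  obtain ⟨u, h6, h7⟩ := (h4.and h6).exists
  exact hC' (h7.symm.trans h6)

/-- The function `g ∘ shift` involves mixed shifts; eliminating them near each member of `S` gives
local quotients that agree with it on solutions, and these glue. The window grows by `|a| + |b|`,
uniformly on `S`. -/
theorem exists_honest_shift (hF : IsEquation D F) (hS : IsBase D F S) (hg : Honest S g) (a b : ℤ) :
    ∃ g', Honest S g' ∧ g' =ᶠ[solSup D F S] fun u => g (shift a b u) := by
  obtain ⟨n, hn⟩ := hg
  set m := n + a.natAbs + b.natAbs with hm
  have hK : ∀ p ∈ (cross n : Set (ℤ × ℤ)), (p.1 + a, p.2 + b) ∈ window m := by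
    intro p hp
    have h1 := mem_window.1 (mem_cross.1 (Finset.mem_coe.1 hp)).1
    rw [abs_le, abs_le] at h1
    rw [mem_window, abs_le, abs_le]
    have := Int.natCast_natAbs a; have := Int.natCast_natAbs b
    have := neg_abs_le a; have := le_abs_self a; have := neg_abs_le b; have := le_abs_self b
    have := abs_nonneg a; have := abs_nonneg b
    push_cast [hm]
    refine ⟨⟨?_, ?_⟩, ?_, ?_⟩ <;> linarith [h1.1.1, h1.1.2, h1.2.1, h1.2.2]
  have hloc : ∀ s ∈ S, SolMeroIn D F (cross m) s fun u => g (shift a b u) := by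
    intro s hs
    obtain ⟨A, B, hA, hB, hB0, h⟩ := hn _ (hS.shift_mem hs a b)
    obtain ⟨e, he⟩ := exists_isExt hF (hS.solves s hs)
    have hBe := analyticIn_shift_ext he hK hB
    have hB0' := frequently_shift_ext hF hS hs he (hB.mono (cross_subset_axes n)) hB0
    refine ⟨_, _, analyticIn_shift_ext he hK hA, hBe, hB0', ?_⟩
    filter_upwards [he.eventually_shift_eq hA, he.eventually_shift_eq hB,
      (hBe.mono (cross_subset_axes m)).eventually_ne hB0',
      solFilter_le_nhds ((tendsto_shift_nhds a b s).eventually h)] with u h1 h2 h3 h4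
    rw [h1, h2]
    rw [h2] at h3
    exact h4 h3
  obtain ⟨g', h1, h2⟩ := exists_meroIn hF hS (cross_subset_axes m) hloc
  exact ⟨g', ⟨m, h1⟩, eventually_solSup.2 h2⟩

theorem exists_honest_coord (hF : IsEquation D F) (hS : IsBase D F S) (q : ℤ × ℤ) :
    ∃ g', Honest S g' ∧ g' =ᶠ[solSup D F S] fun u => u q := by
  obtain ⟨n, hn⟩ := (eventually_mem_window q).exists
  have hloc : ∀ s ∈ S, SolMeroIn D F (cross n) s fun u => u q := by
    intro s hs
    obtain ⟨e, he⟩ := exists_isExt hF (hS.solves s hs)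
    refine ⟨_, _, he.analyticIn n q hn, AnalyticIn.const _ _ 1,
      (Eventually.of_forall fun _ => one_ne_zero).frequently, ?_⟩
    filter_upwards [he.eventually_eq q] with u h1
    rw [h1, div_one]
  obtain ⟨g', h1, h2⟩ := exists_meroIn hF hS (cross_subset_axes n) hloc
  exact ⟨g', ⟨n, h1⟩, eventually_solSup.2 h2⟩

theorem analyticIn_fderiv_F (hF : IsEquation D F) (hS : IsBase D F S) (hs : s ∈ S)
    (v : 𝕜 × 𝕜 × 𝕜) : AnalyticIn {(0, 0), (1, 0), (0, 1)} s
      fun u => fderiv 𝕜 F (u (0, 0), u (1, 0), u (0, 1)) v := by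
  have h1 : AnalyticAt 𝕜 (fun y => fderiv 𝕜 F y v) (s (0, 0), s (1, 0), s (0, 1)) :=
    ((ContinuousLinearMap.apply 𝕜 𝕜 v).analyticAt _).fun_comp
      (g := fun l : (𝕜 × 𝕜 × 𝕜) →L[𝕜] 𝕜 => l v)
      (hF.analytic _ (hS.solves s hs 0 0).1).fderiv
  exact AnalyticIn.comp (H := fun y => fderiv 𝕜 F y v) (f := fun u => (u (0, 0), u (1, 0), u (0, 1)))
    h1 ((AnalyticIn.coord (by simp)).prodMk
      ((AnalyticIn.coord (by simp)).prodMk (AnalyticIn.coord (by simp))))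

theorem eventually_fderiv_F (hF : IsEquation D F) (hS : IsBase D F S) (hs : s ∈ S)
    (v : 𝕜 × 𝕜 × 𝕜) : ∀ᶠ u in 𝓝 s, fderiv 𝕜 F (u (0, 0), u (1, 0), u (0, 1)) v =
      Fu F u * v.1 + Fu10 F u * v.2.1 + Fu01 F u * v.2.2 := by
  filter_upwards [eventually_corner_mem hF (hS.solves s hs 0 0)] with u hu
  exact fderiv_eq_partial (hF.analytic _ hu) v

theorem analyticIn_Fu (hF : IsEquation D F) (hS : IsBase D F S) (hs : s ∈ S) :
    AnalyticIn {(0, 0), (1, 0), (0, 1)} s (Fu F) :=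
  (analyticIn_fderiv_F hF hS hs (1, 0, 0)).congr <| by
    filter_upwards [eventually_fderiv_F hF hS hs (1, 0, 0)] with u hu
    rw [hu]; ring

theorem analyticIn_Fu10 (hF : IsEquation D F) (hS : IsBase D F S) (hs : s ∈ S) :
    AnalyticIn {(0, 0), (1, 0), (0, 1)} s (Fu10 F) :=
  (analyticIn_fderiv_F hF hS hs (0, 1, 0)).congr <| by
    filter_upwards [eventually_fderiv_F hF hS hs (0, 1, 0)] with u hu
    rw [hu]; ring

theorem analyticIn_Fu01 (hF : IsEquation D F) (hS : IsBase D F S) (hs : s ∈ S) :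
    AnalyticIn {(0, 0), (1, 0), (0, 1)} s (Fu01 F) :=
  (analyticIn_fderiv_F hF hS hs (0, 0, 1)).congr <| by
    filter_upwards [eventually_fderiv_F hF hS hs (0, 0, 1)] with u hu
    rw [hu]; ring

theorem corner_subset_cross : ({(0, 0), (1, 0), (0, 1)} : Set (ℤ × ℤ)) ⊆ cross 1 := by
  rintro p (rfl | rfl | rfl) <;> simp [mem_cross, mem_window]

theorem honest_of_corner (h : ∀ s ∈ S, AnalyticIn {(0, 0), (1, 0), (0, 1)} s g) : Honest S g :=
  ⟨1, fun s hs => ((h s hs).mono corner_subset_cross).meroIn⟩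

end QuadGraph

/-! ### The field of germs on solutions, as an instance of `CrossField`. -/

namespace QuadGraph

variable {𝕜 : Type*} [RCLike 𝕜]
variable {D : Set (𝕜 × 𝕜 × 𝕜)} {F : 𝕜 × 𝕜 × 𝕜 → 𝕜} {S : Set (ℤ × ℤ → 𝕜)}
  {s : ℤ × ℤ → 𝕜} {K K' : Set (ℤ × ℤ)} {f g : (ℤ × ℤ → 𝕜) → 𝕜}

/-- The ring of germs on solutions of functions of the dynamical variables. -/
def germRing (D : Set (𝕜 × 𝕜 × 𝕜)) (F : 𝕜 × 𝕜 × 𝕜 → 𝕜) (S : Set (ℤ × ℤ → 𝕜)) :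
    Subring (Germ (solSup D F S) 𝕜) where
  carrier := {x | ∃ g, Honest S g ∧ (g : Germ (solSup D F S) 𝕜) = x}
  zero_mem' := ⟨_, Honest.const S 0, rfl⟩
  one_mem' := ⟨_, Honest.const S 1, rfl⟩
  add_mem' := by
    rintro _ _ ⟨f, hf, rfl⟩ ⟨g, hg, rfl⟩
    exact ⟨_, hf.add hg, rfl⟩
  mul_mem' := by
    rintro _ _ ⟨f, hf, rfl⟩ ⟨g, hg, rfl⟩
    exact ⟨_, hf.mul hg, rfl⟩
  neg_mem' := by
    rintro _ ⟨f, hf, rfl⟩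
    exact ⟨_, hf.neg, rfl⟩

/-- The element that a function represents. -/
def Honest.germ (D : Set (𝕜 × 𝕜 × 𝕜)) (F : 𝕜 × 𝕜 × 𝕜 → 𝕜) (h : Honest S g) : germRing D F S :=
  ⟨(g : Germ (solSup D F S) 𝕜), g, h, rfl⟩

/-- A function that represents a given element. -/
noncomputable def rep (x : germRing D F S) : (ℤ × ℤ → 𝕜) → 𝕜 := x.2.choose

theorem rep_honest (x : germRing D F S) : Honest S (rep x) := x.2.choose_spec.1

theorem coe_rep (x : germRing D F S) : ((rep x : (ℤ × ℤ → 𝕜) → 𝕜) : Germ (solSup D F S) 𝕜) = x :=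
  x.2.choose_spec.2

theorem germ_rep (x : germRing D F S) : (rep_honest x).germ D F = x := Subtype.ext (coe_rep x)

theorem Honest.germ_eq_germ (hf : Honest S f) (hg : Honest S g) :
    hf.germ D F = hg.germ D F ↔ f =ᶠ[solSup D F S] g := by
  rw [← Subtype.coe_inj]; exact Germ.coe_eq

theorem Honest.rep_germ (hf : Honest S f) : rep (hf.germ D F) =ᶠ[solSup D F S] f :=
  (Honest.germ_eq_germ (rep_honest _) hf).1 (germ_rep _)

/-- By connectedness a function that is not zero is generically non-zero near all of `S`, so its
pointwise inverse is an inverse of the germ. -/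
theorem germRing_isField (hF : IsEquation D F) (hS : IsBase D F S) : IsField (germRing D F S) where
  exists_pair_ne := by
    refine ⟨(Honest.const S 0).germ D F, (Honest.const S 1).germ D F, fun h => ?_⟩
    have := solSup_neBot hF hS
    obtain ⟨u, hu⟩ := ((Honest.germ_eq_germ _ _).1 h).exists
    exact zero_ne_one hu
  mul_comm := mul_comm
  mul_inv_cancel := by
    intro x hx
    refine ⟨(rep_honest x).inv.germ D F, ?_⟩
    have h0 : ¬ ∀ᶠ u in solSup D F S, rep x u = 0 := fun h => hx <| by
      rw [← germ_rep x]
      exact (Honest.germ_eq_germ (rep_honest x) (Honest.const S 0)).2 h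
    rw [show x * (rep_honest x).inv.germ D F =
      (rep_honest x).germ D F * (rep_honest x).inv.germ D F by rw [germ_rep]]
    refine (Honest.germ_eq_germ (D := D) (F := F) ((rep_honest x).mul (rep_honest x).inv) (Honest.const S 1)).2 ?_
    filter_upwards [((rep_honest x).eq_zero_or hF hS).resolve_left h0] with u hu
    exact mul_inv_cancel₀ hu

/-- The shift of germs. -/
def shiftGerm (hF : IsEquation D F) (hS : IsBase D F S) (a b : ℤ) :
    Germ (solSup D F S) 𝕜 →+* Germ (solSup D F S) 𝕜 where
  toFun x := x.compTendsto (shift a b) (tendsto_shift_solSup hF hS a b)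
  map_zero' := rfl
  map_one' := rfl
  map_add' x y := by
    induction x, y using Germ.inductionOn₂
    rfl
  map_mul' x y := by
    induction x, y using Germ.inductionOn₂
    rfl

/-- The shift by virtue of the equation. -/
def shiftHom (hF : IsEquation D F) (hS : IsBase D F S) (a b : ℤ) :
    germRing D F S →+* germRing D F S :=
  ((shiftGerm hF hS a b).comp (germRing D F S).subtype).codRestrict (germRing D F S) <| by
    rintro ⟨_, g, hg, rfl⟩
    obtain ⟨g', h1, h2⟩ := exists_honest_shift hF hS hg a b
    exact ⟨g', h1, Germ.coe_eq.2 h2⟩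

theorem shiftHom_germ_eq (hF : IsEquation D F) (hS : IsBase D F S) {a b : ℤ} (hf : Honest S f)
    (hg : Honest S g) : shiftHom hF hS a b (hf.germ D F) = hg.germ D F ↔
      (fun u => f (shift a b u)) =ᶠ[solSup D F S] g := by
  rw [← Subtype.coe_inj]; exact Germ.coe_eq

theorem rep_shiftHom (hF : IsEquation D F) (hS : IsBase D F S) (a b : ℤ) (x : germRing D F S) :
    rep (shiftHom hF hS a b x) =ᶠ[solSup D F S] fun u => rep x (shift a b u) := by
  refine ((shiftHom_germ_eq hF hS (rep_honest x) (rep_honest _)).1 ?_).symm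
  rw [germ_rep, germ_rep]

/-- The partial derivative. -/
noncomputable def pdGerm (p : ℤ × ℤ) (x : germRing D F S) : germRing D F S :=
  ((rep_honest x).pd p).germ D F

theorem Honest.pdGerm_germ (hF : IsEquation D F) (hS : IsBase D F S) (hf : Honest S f)
    (p : ℤ × ℤ) : pdGerm p (hf.germ D F) = (hf.pd p).germ D F :=
  (Honest.germ_eq_germ _ _).2 ((rep_honest _).pd_congr hF hS hf hf.rep_germ p)

/-- A dynamical variable, or the function of these that the equation makes of a mixed shift. -/
noncomputable def coordGerm (hF : IsEquation D F) (hS : IsBase D F S) (q : ℤ × ℤ) :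
    germRing D F S := (exists_honest_coord hF hS q).choose_spec.1.germ D F

theorem rep_coordGerm (hF : IsEquation D F) (hS : IsBase D F S) (q : ℤ × ℤ) :
    rep (coordGerm hF hS q) =ᶠ[solSup D F S] fun u => u q :=
  (Honest.rep_germ _).trans (exists_honest_coord hF hS q).choose_spec.2

theorem eventually_pd_eq_zero_of_notMem {K : Set (ℤ × ℤ)} (hK : K ⊆ axes)
    (h : ∀ s ∈ S, MeroIn K s g) {p : ℤ × ℤ} (hp : p ∉ K) :
    ∀ᶠ u in solSup D F S, pd p g u = 0 := by
  refine eventually_solSup.2 fun s hs => solFilter_le_genFilter ?_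
  filter_upwards [(h s hs).eventually_analyticIn hK] with u hu
  exact hu.pd_eq_zero hp

theorem eventually_pd_add (hf : Honest S f) (hg : Honest S g) (p : ℤ × ℤ) :
    ∀ᶠ u in solSup D F S, pd p (fun v => f v + g v) u = pd p f u + pd p g u := by
  refine eventually_solSup.2 fun s hs => solFilter_le_genFilter ?_
  filter_upwards [(hf.meroIn hs).eventually_analyticIn subset_rfl,
    (hg.meroIn hs).eventually_analyticIn subset_rfl] with u h1 h2
  exact pd_add h1 h2 p

theorem eventually_pd_mul (hf : Honest S f) (hg : Honest S g) (p : ℤ × ℤ) :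
    ∀ᶠ u in solSup D F S, pd p (fun v => f v * g v) u = pd p f u * g u + f u * pd p g u := by
  refine eventually_solSup.2 fun s hs => solFilter_le_genFilter ?_
  filter_upwards [(hf.meroIn hs).eventually_analyticIn subset_rfl,
    (hg.meroIn hs).eventually_analyticIn subset_rfl] with u h1 h2
  exact pd_mul h1 h2 p

theorem honest_Fu10 (hF : IsEquation D F) (hS : IsBase D F S) : Honest S (Fu10 F) :=
  honest_of_corner fun _ hs => analyticIn_Fu10 hF hS hs

theorem honest_Fu01 (hF : IsEquation D F) (hS : IsBase D F S) : Honest S (Fu01 F) :=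
  honest_of_corner fun _ hs => analyticIn_Fu01 hF hS hs

theorem honest_Fu (hF : IsEquation D F) (hS : IsBase D F S) : Honest S (Fu F) :=
  honest_of_corner fun _ hs => analyticIn_Fu hF hS hs

theorem pdGerm_germ_eq_zero (hF : IsEquation D F) (hS : IsBase D F S) (hg : Honest S g)
    (h : ∀ s ∈ S, AnalyticIn {(0, 0), (1, 0), (0, 1)} s g) {q : ℤ × ℤ} (h0 : q ≠ (0, 0))
    (h1 : q ≠ (1, 0)) (h2 : q ≠ (0, 1)) : pdGerm q (hg.germ D F) = 0 := by
  rw [hg.pdGerm_germ hF hS]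
  refine (Honest.germ_eq_germ _ (Honest.const S 0)).2 ?_
  exact eventually_pd_eq_zero_of_notMem (corner_subset_cross.trans (cross_subset_axes 1))
    (fun s hs => (h s hs).meroIn) (by simp [h0, h1, h2])

theorem germ_ne_zero (hF : IsEquation D F) (hS : IsBase D F S) (hg : Honest S g)
    (h : ∀ s ∈ S, ContinuousAt g s ∧ g s ≠ 0) : hg.germ D F ≠ 0 := by
  intro h0
  have h1 := (Honest.germ_eq_germ hg (Honest.const S 0)).1 h0
  obtain ⟨s, hs⟩ := hS.connected.nonempty
  have := solFilter_neBot hF (hS.solves s hs)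
  obtain ⟨u, h2, h3⟩ := ((eventually_solSup.1 h1 s hs).and
    (solFilter_le_nhds ((h s hs).1.eventually_ne (h s hs).2))).exists
  exact h3 h2

theorem pdGerm_coordGerm (hF : IsEquation D F) (hS : IsBase D F S) (p : ℤ × ℤ) {q : ℤ × ℤ}
    (hq : q ∈ axes) : pdGerm p (coordGerm hF hS q) = if q = p then 1 else 0 := by
  have h1 : Honest S fun u : ℤ × ℤ → 𝕜 => u q := by
    obtain ⟨n, hn⟩ := (eventually_mem_window q).exists
    exact ⟨n, fun s _ => (AnalyticIn.coord (by exact_mod_cast mem_cross.2 ⟨hn, hq⟩)).meroIn⟩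
  have h2 : coordGerm hF hS q = h1.germ D F := by
    rw [← germ_rep (coordGerm hF hS q)]
    exact (Honest.germ_eq_germ _ _).2 (rep_coordGerm hF hS q)
  rw [h2, h1.pdGerm_germ hF hS]
  split_ifs with h
  · refine (Honest.germ_eq_germ _ (Honest.const S 1)).2 (Eventually.of_forall fun u => ?_)
    rw [pd_coord, if_pos h]
  · refine (Honest.germ_eq_germ _ (Honest.const S 0)).2 (Eventually.of_forall fun u => ?_)
    rw [pd_coord, if_neg h]

theorem germRing_ext {x y : germRing D F S} (h : rep x =ᶠ[solSup D F S] rep y) : x = y := by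
  rw [← germ_rep x, ← germ_rep y]
  exact (Honest.germ_eq_germ _ _).2 h

theorem rep_add (x y : germRing D F S) :
    rep (x + y) =ᶠ[solSup D F S] fun u => rep x u + rep y u := by
  have : x + y = ((rep_honest x).add (rep_honest y)).germ D F := by
    conv_lhs => rw [← germ_rep x, ← germ_rep y]
    rfl
  rw [this]
  exact Honest.rep_germ _

theorem rep_mul (x y : germRing D F S) :
    rep (x * y) =ᶠ[solSup D F S] fun u => rep x u * rep y u := by
  have : x * y = ((rep_honest x).mul (rep_honest y)).germ D F := by
    conv_lhs => rw [← germ_rep x, ← germ_rep y]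
    rfl
  rw [this]
  exact Honest.rep_germ _

theorem rep_sum {ι : Type*} (I : Finset ι) (x : ι → germRing D F S) :
    rep (∑ i ∈ I, x i) =ᶠ[solSup D F S] fun u => ∑ i ∈ I, rep (x i) u := by
  classical
  induction I using Finset.induction_on with
  | empty => exact Honest.rep_germ (Honest.const S 0)
  | insert i I hi ih =>
    rw [Finset.sum_insert hi]
    filter_upwards [rep_add (x i) (∑ i ∈ I, x i), ih] with u h1 h2
    rw [h1, h2, Finset.sum_insert hi]

theorem rep_pdGerm (p : ℤ × ℤ) (x : germRing D F S) :
    rep (pdGerm p x) =ᶠ[solSup D F S] pd p (rep x) := Honest.rep_germ _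

theorem rep_eq_zero (x : germRing D F S) : x = 0 ↔ rep x =ᶠ[solSup D F S] fun _ => 0 := by
  rw [← Honest.germ_eq_germ (rep_honest x) (Honest.const S 0), germ_rep]
  rfl

/-- The field of functions of the dynamical variables. -/
noncomputable abbrev germField (hF : IsEquation D F) (hS : IsBase D F S) : Field (germRing D F S) :=
  (germRing_isField hF hS).toField

theorem pdGerm_equation (hF : IsEquation D F) (hS : IsBase D F S) (p : ℤ × ℤ) (k l : ℤ) :
    pdGerm p (coordGerm hF hS (k + 1, l + 1)) =
      shiftHom hF hS k l ((honest_Fu10 hF hS).germ D F) * pdGerm p (coordGerm hF hS (k + 1, l)) +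
      shiftHom hF hS k l ((honest_Fu01 hF hS).germ D F) * pdGerm p (coordGerm hF hS (k, l + 1)) +
      shiftHom hF hS k l ((honest_Fu hF hS).germ D F) * pdGerm p (coordGerm hF hS (k, l)) := by
  refine germRing_ext ?_
  have hT := tendsto_shift_solSup hF hS k l
  have hx : ∀ q, ∀ᶠ u in solSup D F S, rep (coordGerm hF hS q) u = u q := rep_coordGerm hF hS
  have h : ∀ᶠ u in solSup D F S, pd p (rep (coordGerm hF hS (k + 1, l + 1))) u =
      Fu10 F (shift k l u) * pd p (rep (coordGerm hF hS (k + 1, l))) u +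
      Fu01 F (shift k l u) * pd p (rep (coordGerm hF hS (k, l + 1))) u +
      Fu F (shift k l u) * pd p (rep (coordGerm hF hS (k, l))) u :=
    eventually_solSup.2 fun s hs => eventually_pd_equation hF hS hs
      (x := fun q => rep (coordGerm hF hS q)) (fun q => (rep_honest _).meroIn hs)
      (fun q => eventually_solSup.1 (hx q) s hs) p k l
  filter_upwards [rep_add (shiftHom hF hS k l ((honest_Fu10 hF hS).germ D F) *
      pdGerm p (coordGerm hF hS (k + 1, l)) + shiftHom hF hS k l ((honest_Fu01 hF hS).germ D F) *
      pdGerm p (coordGerm hF hS (k, l + 1))) (shiftHom hF hS k l ((honest_Fu hF hS).germ D F) *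
      pdGerm p (coordGerm hF hS (k, l))),
    rep_add (shiftHom hF hS k l ((honest_Fu10 hF hS).germ D F) *
      pdGerm p (coordGerm hF hS (k + 1, l))) (shiftHom hF hS k l ((honest_Fu01 hF hS).germ D F) *
      pdGerm p (coordGerm hF hS (k, l + 1))),
    rep_mul (shiftHom hF hS k l ((honest_Fu10 hF hS).germ D F))
      (pdGerm p (coordGerm hF hS (k + 1, l))),
    rep_mul (shiftHom hF hS k l ((honest_Fu01 hF hS).germ D F))
      (pdGerm p (coordGerm hF hS (k, l + 1))),
    rep_mul (shiftHom hF hS k l ((honest_Fu hF hS).germ D F))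
      (pdGerm p (coordGerm hF hS (k, l))),
    rep_pdGerm p (coordGerm hF hS (k + 1, l + 1)), rep_pdGerm p (coordGerm hF hS (k + 1, l)),
    rep_pdGerm p (coordGerm hF hS (k, l + 1)), rep_pdGerm p (coordGerm hF hS (k, l)), h,
    rep_shiftHom hF hS k l ((honest_Fu10 hF hS).germ D F),
    rep_shiftHom hF hS k l ((honest_Fu01 hF hS).germ D F),
    rep_shiftHom hF hS k l ((honest_Fu hF hS).germ D F),
    hT.eventually (honest_Fu10 hF hS).rep_germ, hT.eventually (honest_Fu01 hF hS).rep_germ,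
    hT.eventually (honest_Fu hF hS).rep_germ]
    with u h1 h2 h3 h4 h5 h6 h7 h8 h9 h10 h11 h12 h13 h14 h15 h16
  rw [h1, h2, h3, h4, h5, h6, h7, h8, h9, h10, h11, h12, h13, h14, h15, h16]

theorem exists_pdGerm_shiftHom (hF : IsEquation D F) (hS : IsBase D F S) (x : germRing D F S) :
    ∃ n : ℕ, (∀ q, q ∉ cross n → pdGerm q x = 0) ∧ ∀ a b p, pdGerm p (shiftHom hF hS a b x) =
      ∑ q ∈ cross n, shiftHom hF hS a b (pdGerm q x) *
        pdGerm p (coordGerm hF hS (q.1 + a, q.2 + b)) := by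
  obtain ⟨n, hn⟩ := rep_honest x
  refine ⟨n, fun q hq => ?_, fun a b p => germRing_ext ?_⟩
  · rw [rep_eq_zero]
    exact (rep_pdGerm q x).trans
      (eventually_pd_eq_zero_of_notMem (cross_subset_axes n) hn (by exact_mod_cast hq))
  · have h : ∀ᶠ u in solSup D F S, pd p (rep (shiftHom hF hS a b x)) u =
        ∑ q ∈ cross n, pd q (rep x) (shift a b u) *
          pd p (rep (coordGerm hF hS (q.1 + a, q.2 + b))) u :=
      eventually_solSup.2 fun s hs => eventually_pd_shift hF hS hs (hn _ (hS.shift_mem hs a b))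
        ((rep_honest _).meroIn hs) (eventually_solSup.1 (rep_shiftHom hF hS a b x) s hs)
        (x := fun q => rep (coordGerm hF hS (q.1 + a, q.2 + b)))
        (fun q _ => (rep_honest _).meroIn hs)
        (fun q _ => eventually_solSup.1 (rep_coordGerm hF hS _) s hs) p
    have h1 : ∀ᶠ u in solSup D F S, ∀ q ∈ cross n, rep (shiftHom hF hS a b (pdGerm q x) *
        pdGerm p (coordGerm hF hS (q.1 + a, q.2 + b))) u = pd q (rep x) (shift a b u) *
          pd p (rep (coordGerm hF hS (q.1 + a, q.2 + b))) u := by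
      rw [eventually_all_finset]
      intro q _
      filter_upwards [rep_mul (shiftHom hF hS a b (pdGerm q x))
          (pdGerm p (coordGerm hF hS (q.1 + a, q.2 + b))), rep_shiftHom hF hS a b (pdGerm q x),
        rep_pdGerm p (coordGerm hF hS (q.1 + a, q.2 + b)),
        (tendsto_shift_solSup hF hS a b).eventually (rep_pdGerm q x)] with u h1 h2 h3 h4
      rw [h1, h2, h3, h4]
    filter_upwards [h, h1, rep_pdGerm p (shiftHom hF hS a b x), rep_sum (cross n) fun q =>
      shiftHom hF hS a b (pdGerm q x) * pdGerm p (coordGerm hF hS (q.1 + a, q.2 + b))]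
      with u h2 h3 h4 h5
    rw [h4, h2, h5]
    exact (Finset.sum_congr rfl h3).symm

/-- The shifts and the partial derivatives on the field of functions of the dynamical variables. -/
noncomputable def crossField (hF : IsEquation D F) (hS : IsBase D F S) :
    @CrossField (germRing D F S) (germField hF hS) :=
  letI := germField hF hS
  { T := shiftHom hF hS
    dd := pdGerm
    x := coordGerm hF hS
    α := (honest_Fu10 hF hS).germ D F
    β := (honest_Fu01 hF hS).germ D F
    γ := (honest_Fu hF hS).germ D F
    T_zero := fun x => germRing_ext <| (rep_shiftHom hF hS 0 0 x).trans <|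
      Eventually.of_forall fun u => by simp only [shift_zero]
    T_add := fun a b c d x => germRing_ext <| by
      filter_upwards [rep_shiftHom hF hS a b (shiftHom hF hS c d x),
        (tendsto_shift_solSup hF hS a b).eventually (rep_shiftHom hF hS c d x),
        rep_shiftHom hF hS (a + c) (b + d) x] with u h1 h2 h3
      rw [h1, h2, h3, shift_shift, add_comm c, add_comm d]
    dd_add := fun p x y => germRing_ext <| by
      filter_upwards [rep_pdGerm p (x + y), rep_add (pdGerm p x) (pdGerm p y), rep_pdGerm p x,
        rep_pdGerm p y, eventually_pd_add (rep_honest x) (rep_honest y) p,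
        (rep_honest (x + y)).pd_congr hF hS ((rep_honest x).add (rep_honest y)) (rep_add x y) p]
        with u h1 h2 h3 h4 h5 h6
      exact (h1.trans h6).trans (h5.trans (by rw [← h3, ← h4]; exact h2.symm))
    dd_mul := fun p x y => germRing_ext <| by
      filter_upwards [rep_pdGerm p (x * y), rep_add (pdGerm p x * y) (x * pdGerm p y),
        rep_mul (pdGerm p x) y, rep_mul x (pdGerm p y), rep_pdGerm p x,
        rep_pdGerm p y, eventually_pd_mul (rep_honest x) (rep_honest y) p,
        (rep_honest (x * y)).pd_congr hF hS ((rep_honest x).mul (rep_honest y)) (rep_mul x y) p]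
        with u h1 h2 h3 h4 h5 h6 h7 h8
      exact (h1.trans h8).trans (h7.trans (by rw [← h5, ← h6, ← h3, ← h4]; exact h2.symm))
    dd_T := exists_pdGerm_shiftHom hF hS
    dd_x := fun p _ hq => pdGerm_coordGerm hF hS p hq
    dd_equation := pdGerm_equation hF hS
    α_ne := germ_ne_zero hF hS _ fun _ hs => ⟨(analyticIn_Fu10 hF hS hs).continuousAt,
      hF.deriv_u10 _ _ _ (hS.solves _ hs 0 0).1⟩
    β_ne := germ_ne_zero hF hS _ fun _ hs => ⟨(analyticIn_Fu01 hF hS hs).continuousAt,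
      hF.deriv_u01 _ _ _ (hS.solves _ hs 0 0).1⟩
    dd_α := fun _ => pdGerm_germ_eq_zero hF hS _ fun _ hs => analyticIn_Fu10 hF hS hs
    dd_β := fun _ => pdGerm_germ_eq_zero hF hS _ fun _ hs => analyticIn_Fu01 hF hS hs
    dd_γ := fun _ => pdGerm_germ_eq_zero hF hS _ fun _ hs => analyticIn_Fu hF hS hs }

end QuadGraph

/-! ### The column variables and the local coordinates given by a substitution. -/

namespace QuadGraph

variable {𝕜 : Type*} [RCLike 𝕜]
variable {s : ℤ × ℤ → 𝕜} {K K' : Set (ℤ × ℤ)} {φ : 𝕜 × 𝕜 → 𝕜}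

/-- The vertices `(0, a), …, (0, b)`. -/
noncomputable def seg (a b : ℤ) : Finset (ℤ × ℤ) := {0} ×ˢ Finset.Icc a b

theorem mem_seg {a b : ℤ} {p : ℤ × ℤ} : p ∈ seg a b ↔ p.1 = 0 ∧ a ≤ p.2 ∧ p.2 ≤ b := by
  rw [seg, Finset.mem_product, Finset.mem_singleton, Finset.mem_Icc]

theorem seg_subset_axes (a b : ℤ) : (seg a b : Set (ℤ × ℤ)) ⊆ axes := fun _ hp =>
  Or.inl (mem_seg.1 hp).1

theorem seg_mono {a b a' b' : ℤ} (ha : a' ≤ a) (hb : b ≤ b') :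
    (seg a b : Set (ℤ × ℤ)) ⊆ seg a' b' := fun p hp => by
  rw [Finset.mem_coe, mem_seg] at hp ⊢
  exact ⟨hp.1, ha.trans hp.2.1, hp.2.2.trans hb⟩

theorem sum_seg {M : Type*} [AddCommMonoid M] (c : ℤ) (N : ℕ) (f : ℤ × ℤ → M) :
    ∑ q ∈ seg c (c + N), f q = ∑ m ∈ Finset.range (N + 1), f (0, c + m) := by
  refine (Finset.sum_nbij' (fun m : ℕ => ((0 : ℤ), c + m)) (fun q => (q.2 - c).toNat)
    ?_ ?_ ?_ ?_ ?_).symm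
  · intro m hm
    rw [Finset.mem_range] at hm
    exact mem_seg.2 ⟨rfl, by simp only; omega, by simp only; omega⟩
  · intro q hq
    have := mem_seg.1 hq
    rw [Finset.mem_range]; omega
  · intro m _
    simp
  · intro q hq
    obtain ⟨h1, h2, h3⟩ := mem_seg.1 hq
    refine Prod.ext h1.symm ?_
    simp only
    rw [Int.toNat_of_nonneg (by omega)]; ring
  · intro m _; rfl

theorem fderiv_eq_d₁_d₂ {w z : 𝕜} (h : AnalyticAt 𝕜 φ (w, z)) (v : 𝕜 × 𝕜) :
    fderiv 𝕜 φ (w, z) v = d₁ φ w z * v.1 + d₂ φ w z * v.2 := by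
  have hd := h.differentiableAt.hasFDerivAt
  have h1 : HasDerivAt (fun t => φ (t, z)) (fderiv 𝕜 φ (w, z) (1, 0)) w :=
    hd.comp_hasDerivAt w ((hasDerivAt_id' w).prodMk (hasDerivAt_const w z))
  have h2 : HasDerivAt (fun t => φ (w, t)) (fderiv 𝕜 φ (w, z) (0, 1)) z :=
    hd.comp_hasDerivAt z ((hasDerivAt_const z w).prodMk (hasDerivAt_id' z))
  rw [d₁, d₂, h1.deriv, h2.deriv]
  have : v = v.1 • ((1, 0) : 𝕜 × 𝕜) + v.2 • ((0, 1) : 𝕜 × 𝕜) := by ext <;> simp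
  conv_lhs => rw [this]
  rw [map_add, map_smul, map_smul]
  simp only [smul_eq_mul]
  ring

theorem analyticAt_d₁ {x : 𝕜 × 𝕜} (h : AnalyticAt 𝕜 φ x) :
    AnalyticAt 𝕜 (fun y => d₁ φ y.1 y.2) x := by
  have h1 : AnalyticAt 𝕜 (fun y => fderiv 𝕜 φ y (1, 0)) x :=
    ((ContinuousLinearMap.apply 𝕜 𝕜 ((1, 0) : 𝕜 × 𝕜)).analyticAt _).fun_comp
      (g := fun l : (𝕜 × 𝕜) →L[𝕜] 𝕜 => l (1, 0)) h.fderiv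
  refine h1.congr ?_
  filter_upwards [h.eventually_analyticAt] with y hy
  rw [fderiv_eq_d₁_d₂ (w := y.1) (z := y.2) hy]; ring

theorem analyticAt_d₂ {x : 𝕜 × 𝕜} (h : AnalyticAt 𝕜 φ x) :
    AnalyticAt 𝕜 (fun y => d₂ φ y.1 y.2) x := by
  have h1 : AnalyticAt 𝕜 (fun y => fderiv 𝕜 φ y (0, 1)) x :=
    ((ContinuousLinearMap.apply 𝕜 𝕜 ((0, 1) : 𝕜 × 𝕜)).analyticAt _).fun_comp
      (g := fun l : (𝕜 × 𝕜) →L[𝕜] 𝕜 => l (0, 1)) h.fderiv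
  refine h1.congr ?_
  filter_upwards [h.eventually_analyticAt] with y hy
  rw [fderiv_eq_d₁_d₂ (w := y.1) (z := y.2) hy]; ring

/-- The substitution: `u_{0,l}` is replaced by `φ(u_{0,l}, u_{0,l+1})`. -/
def substMap (φ : 𝕜 × 𝕜 → 𝕜) (u : ℤ × ℤ → 𝕜) : ℤ × ℤ → 𝕜 := fun p => φ (u (0, p.2), u (0, p.2 + 1))

/-- The substitution on the column is regular at `s`. -/
structure RegularAt (φ : 𝕜 × 𝕜 → 𝕜) (s : ℤ × ℤ → 𝕜) : Prop where
  analyticAt : ∀ k, AnalyticAt 𝕜 φ (s (0, k), s (0, k + 1))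
  d₁_ne : ∀ k, d₁ φ (s (0, k)) (s (0, k + 1)) ≠ 0
  d₂_ne : ∀ k, d₂ φ (s (0, k)) (s (0, k + 1)) ≠ 0

theorem RegularAt.analyticIn_substMap (h : RegularAt φ s) {p : ℤ × ℤ} (h0 : (0, p.2) ∈ K)
    (h1 : (0, p.2 + 1) ∈ K) : AnalyticIn K s fun u => substMap φ u p :=
  AnalyticIn.comp (H := φ) (f := fun u => (u (0, p.2), u (0, p.2 + 1))) (h.analyticAt p.2)
    ((AnalyticIn.coord h0).prodMk (AnalyticIn.coord h1))

theorem RegularAt.continuousAt_substMap (h : RegularAt φ s) : ContinuousAt (substMap φ) s :=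
  continuousAt_pi.2 fun _ =>
    (h.analyticIn_substMap (K := Set.univ) (Set.mem_univ _) (Set.mem_univ _)).continuousAt

/-- The ratio that describes the curves on which the substitution variables are constant. -/
noncomputable def slope (φ : 𝕜 × 𝕜 → 𝕜) (u : ℤ × ℤ → 𝕜) (k : ℤ) : 𝕜 :=
  -(d₁ φ (u (0, k)) (u (0, k + 1)) / d₂ φ (u (0, k)) (u (0, k + 1)))

/-- Local coordinates, given by `φ(u_{0,k}, u_{0,k+1})`, `c ≤ k < c + N`, and `u_{0,c}`. -/
theorem RegularAt.exists_coordinates (h : RegularAt φ s) (c : ℤ) (N : ℕ) :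
    ∃ Ψ Ξ : (ℤ × ℤ → 𝕜) → (ℤ × ℤ → 𝕜),
      (∀ k, c ≤ k → k < c + N → ∀ u, Ψ u (0, k) = substMap φ u (0, k)) ∧
      ContinuousAt Ψ s ∧ ContinuousAt Ξ (Ψ s) ∧ Ξ (Ψ s) = s ∧
      (∀ p ∈ seg c (c + N), AnalyticIn (seg c (c + N) : Set (ℤ × ℤ)) (Ψ s) fun v => Ξ v p) ∧
      (∀ p ∈ seg c (c + N), ∀ᶠ u in 𝓝 s, Ξ (Ψ u) p = u p) ∧
      (∀ k, c ≤ k → k < c + N → ∀ᶠ v in 𝓝 (Ψ s), substMap φ (Ξ v) (0, k) = v (0, k)) ∧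
      ∀ m : ℕ, m ≤ N → ∀ᶠ v in 𝓝 (Ψ s), pd (0, c + N) (fun v => Ξ v (0, c + m)) v =
        ∏ i ∈ Finset.range m, slope φ (Ξ v) (c + i) := by
  classical
  choose Z hZa hZ0 hZ1 hZ2 using fun m : ℕ => exists_implicit (h.analyticAt (c + m))
    (h.d₂_ne (c + m))
  -- The `N + 1` column variables give only `N` substitution variables; the free slot `c + N` keeps
  -- u_{0,c}.
  let Ψ : (ℤ × ℤ → 𝕜) → (ℤ × ℤ → 𝕜) := fun u p =>
    if p.2 < c + N then substMap φ u p else if p.2 = c + N then u (0, c) else s p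
  -- The column is rebuilt from u_{0,c} by solving `φ(u_{0,k}, u_{0,k+1}) = v_{0,k}` for u_{0,k+1}
  -- in succession.
  let x : ℕ → (ℤ × ℤ → 𝕜) → 𝕜 := fun m => Nat.rec (fun v => v (0, c + N))
    (fun m y v => Z m (y v, v (0, c + m))) m
  have hx0 : ∀ v, x 0 v = v (0, c + N) := fun _ => rfl
  have hx1 : ∀ m v, x (m + 1) v = Z m (x m v, v (0, c + m)) := fun _ _ => rfl
  let Ξ : (ℤ × ℤ → 𝕜) → (ℤ × ℤ → 𝕜) := fun v p =>
    if p ∈ seg c (c + N) then x (p.2 - c).toNat v else s p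
  have hΨ : ∀ k < c + N, ∀ u, Ψ u (0, k) = substMap φ u (0, k) := fun k h2 u => by
    simp only [Ψ, if_pos h2]
  have hΨN : ∀ u, Ψ u (0, c + N) = u (0, c) := fun u => by simp [Ψ]
  have hmem : ∀ m : ℕ, m ≤ N → ((0 : ℤ), c + (m : ℤ)) ∈ seg c (c + N) := fun m hm =>
    mem_seg.2 ⟨rfl, by simp only; omega, by simp only; omega⟩
  have hΞ : ∀ m : ℕ, m ≤ N → ∀ v, Ξ v (0, c + m) = x m v := fun m hm v => by
    simp only [Ξ, if_pos (hmem m hm)]; simp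
  have hΨc : ContinuousAt Ψ s := by
    refine continuousAt_pi.2 fun p => ?_
    by_cases h1 : p.2 < c + N
    · simpa [Ψ, h1] using continuousAt_pi.1 h.continuousAt_substMap p
    by_cases h2 : p.2 = c + N
    · simpa [Ψ, h1, h2] using (continuous_apply ((0 : ℤ), c)).continuousAt
    · simpa [Ψ, h1, h2] using continuousAt_const
  have hxs : ∀ m : ℕ, m ≤ N → x m (Ψ s) = s (0, c + m) := by
    intro m hm
    induction m with
    | zero => rw [hx0, hΨN]; simp
    | succ m ih =>
      rw [hx1, ih (by omega), hΨ _ (by omega)]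
      push_cast
      rw [← add_assoc]
      exact hZ0 m
  have hxa : ∀ m : ℕ, m ≤ N → AnalyticIn (seg c (c + N) : Set (ℤ × ℤ)) (Ψ s) (x m) := by
    intro m hm
    induction m with
    | zero => exact AnalyticIn.coord (Finset.mem_coe.2 (hmem N le_rfl))
    | succ m ih =>
      refine AnalyticIn.comp (H := Z m) (f := fun v => (x m v, v (0, c + m))) ?_
        ((ih (by omega)).prodMk (AnalyticIn.coord (Finset.mem_coe.2 (hmem m (by omega)))))
      rw [hxs m (by omega), hΨ _ (by omega)]
      exact hZa m
  have hΞs : Ξ (Ψ s) = s := by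
    funext p
    by_cases hp : p ∈ seg c (c + N)
    · obtain ⟨h1, h2, h3⟩ := mem_seg.1 hp
      obtain ⟨a, b⟩ := p
      simp only at h1 h2 h3
      subst h1
      obtain ⟨m, rfl⟩ := Int.le.dest h2
      rw [hΞ m (by omega), hxs m (by omega)]
    · simp only [Ξ, if_neg hp]
  have hx2 : ∀ m : ℕ, m ≤ N → ∀ᶠ u in 𝓝 s, x m (Ψ u) = u (0, c + m) := by
    intro m hm
    induction m with
    | zero => exact Eventually.of_forall fun u => by rw [hx0, hΨN]; simp
    | succ m ih =>
      have hc : ContinuousAt (fun u : ℤ × ℤ → 𝕜 => (u (0, c + m), u (0, c + m + 1))) s :=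
        ((continuous_apply _).prodMk (continuous_apply _)).continuousAt
      filter_upwards [ih (by omega), hc.eventually (hZ1 m)] with u h1 h2
      rw [hx1, h1, hΨ _ (by omega)]
      push_cast
      rw [← add_assoc]
      exact h2
  have hx3 : ∀ m : ℕ, m < N → ∀ᶠ v in 𝓝 (Ψ s), φ (x m v, x (m + 1) v) = v (0, c + m) := by
    intro m hm
    have hc : ContinuousAt (fun v : ℤ × ℤ → 𝕜 => (x m v, v (0, c + m))) (Ψ s) :=
      (hxa m (by omega)).continuousAt.prodMk (continuous_apply _).continuousAt
    have h1 := hZ2 m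
    rw [show (s (0, c + m), φ (s (0, c + m), s (0, c + m + 1))) = (x m (Ψ s), Ψ s (0, c + m)) by
      rw [hxs m (by omega), hΨ _ (by omega)]; rfl] at h1
    filter_upwards [hc.eventually h1] with v h2
    rw [hx1]; exact h2
  have hΞc : ContinuousAt Ξ (Ψ s) := by
    refine continuousAt_pi.2 fun p => ?_
    by_cases hp : p ∈ seg c (c + N)
    · obtain ⟨h1, h2, h3⟩ := mem_seg.1 hp
      simpa [Ξ, hp] using (hxa (p.2 - c).toNat (by omega)).continuousAt
    · simpa [Ξ, hp] using continuousAt_const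
  have hreg : ∀ m : ℕ, m < N → ∀ᶠ v in 𝓝 (Ψ s), AnalyticAt 𝕜 φ (x m v, x (m + 1) v) ∧
      d₂ φ (x m v) (x (m + 1) v) ≠ 0 := by
    intro m hm
    have hc : ContinuousAt (fun v : ℤ × ℤ → 𝕜 => (x m v, x (m + 1) v)) (Ψ s) :=
      (hxa m (by omega)).continuousAt.prodMk (hxa (m + 1) (by omega)).continuousAt
    have h0 : (x m (Ψ s), x (m + 1) (Ψ s)) = (s (0, c + m), s (0, c + m + 1)) := by
      rw [hxs m (by omega), hxs (m + 1) (by omega)]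
      push_cast
      rw [← add_assoc]
    have h1 := h.analyticAt (c + m)
    have h2 := (analyticAt_d₂ h1).continuousAt.eventually_ne (h.d₂_ne (c + m))
    rw [← h0] at h1 h2
    exact (hc.eventually h1.eventually_analyticAt).and (hc.eventually h2)
  refine ⟨Ψ, Ξ, fun k _ h2 u => hΨ k h2 u, hΨc, hΞc, hΞs, ?_, ?_, ?_, ?_⟩
  · intro p hp
    obtain ⟨h1, h2, h3⟩ := mem_seg.1 hp
    simpa [Ξ, hp] using hxa (p.2 - c).toNat (by omega)
  · rintro ⟨a, b⟩ hp
    obtain ⟨h1, h2, h3⟩ := mem_seg.1 hp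
    simp only at h1 h2 h3
    subst h1
    obtain ⟨m, rfl⟩ := Int.le.dest h2
    filter_upwards [hx2 m (by omega)] with u hu
    rw [hΞ m (by omega), hu]
  · intro k h1 h2
    obtain ⟨m, rfl⟩ := Int.le.dest h1
    filter_upwards [hx3 m (by omega)] with v hv
    have h3 := hΞ (m + 1) (by omega) v
    push_cast at h3
    rw [← add_assoc] at h3
    simp only [substMap]
    rw [hΞ m (by omega), h3, hv]
  · intro m hm
    simp only [hΞ m hm]
    induction m with
    | zero => exact Eventually.of_forall fun v => by simp [x, pd_coord]
    | succ m ih =>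
      filter_upwards [ih (by omega), hreg m (by omega), (hx3 m (by omega)).eventually_nhds,
        (hxa m (by omega)).eventually, (hxa (m + 1) hm).eventually] with v h1 h2 h3 h4 h5
      have hd : HasDerivAt (fun t => φ (x m (Function.update v (0, c + N) t),
          x (m + 1) (Function.update v (0, c + N) t))) _ (v (0, c + N)) :=
        HasFDerivAt.comp_hasDerivAt (l := φ) (v (0, c + N))
          (by simpa using h2.1.differentiableAt.hasFDerivAt)
          ((h4.hasDerivAt_pd (0, c + N)).prodMk (h5.hasDerivAt_pd (0, c + N)))
      -- This function is the coordinate `v (0, c + m)`, independent of the free slot. Hence each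
      -- step multiplies the derivative by `-φ_w / φ_z`, the slope.
      have h6 : pd (0, c + N) (fun v => φ (x m v, x (m + 1) v)) v = 0 := by
        rw [pd_congr h3, pd_coord, if_neg]
        simp only [Prod.mk.injEq, true_and]; omega
      rw [pd, hd.deriv, fderiv_eq_d₁_d₂ h2.1] at h6
      simp only at h6
      have h7 := hΞ (m + 1) (by omega) v
      push_cast at h7
      rw [← add_assoc] at h7
      rw [Finset.prod_range_succ, ← h1, slope, hΞ m (by omega), h7]
      have := h2.2
      field_simp
      linear_combination h6

end QuadGraph

/-! ### Functions of the substitution variables. -/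

namespace QuadGraph

variable {𝕜 : Type*} [RCLike 𝕜]
variable {D : Set (𝕜 × 𝕜 × 𝕜)} {F : 𝕜 × 𝕜 × 𝕜 → 𝕜} {S : Set (ℤ × ℤ → 𝕜)}
  {s t t' : ℤ × ℤ → 𝕜} {K K' : Set (ℤ × ℤ)} {φ : 𝕜 × 𝕜 → 𝕜} {f g : (ℤ × ℤ → 𝕜) → 𝕜}

/-- A function of the coordinates in `K` can be considered near any point with the same
coordinates. -/
theorem AnalyticIn.exists_transfer (hf : AnalyticIn K t f) (hK : ∀ p ∈ K, t p = t' p) :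
    ∃ f', AnalyticIn K t' f' ∧ ((∃ᶠ v in 𝓝 t, f v ≠ 0) → ∃ᶠ v in 𝓝 t', f' v ≠ 0) ∧
      ∀ {α : Type _} {l : Filter α} {Ψ Φ : α → (ℤ × ℤ → 𝕜)}, Tendsto Ψ l (𝓝 t) →
        (∀ p ∈ K, ∀ᶠ u in l, Ψ u p = Φ u p) → ∀ᶠ u in l, f (Ψ u) = f' (Φ u) := by
  obtain ⟨L, hL, A, hA, he⟩ := hf
  have ht : res L t = res L t' := funext fun q => hK q (hL q.2)
  refine ⟨fun v => A (res L v), ⟨L, hL, A, ht ▸ hA, Eventually.of_forall fun _ => rfl⟩, ?_, ?_⟩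
  · intro h
    have h1 : ∃ᶠ y in 𝓝 (res L t), A y ≠ 0 := by
      rw [← map_res_nhds, frequently_map]
      exact (h.and_eventually he).mono fun u hu => hu.2 ▸ hu.1
    rwa [ht, ← map_res_nhds, frequently_map] at h1
  · intro α l Ψ Φ hΨ h
    have h1 : ∀ᶠ u in l, ∀ q : L, Ψ u q = Φ u q := eventually_all.2 fun q => h q (hL q.2)
    filter_upwards [hΨ.eventually he, h1] with u h2 h3
    rw [h2]
    congr 1
    exact funext h3

/-- A quotient that does not change along the curves on which the substitution variables are
constant is a quotient of functions of these variables. -/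
theorem RegularAt.exists_quotient (h : RegularAt φ s) {c : ℤ} {N : ℕ}
    (hf : AnalyticIn (seg c (c + N) : Set (ℤ × ℤ)) s f)
    (hg : AnalyticIn (seg c (c + N) : Set (ℤ × ℤ)) s g) (hg0 : ∃ᶠ u in 𝓝 s, g u ≠ 0)
    (hid : ∀ᶠ u in 𝓝 s, ∑ m ∈ Finset.range (N + 1), (∏ i ∈ Finset.range m, slope φ u (c + i)) *
      (pd (0, c + m) f u * g u - f u * pd (0, c + m) g u) = 0) :
    ∃ A B, AnalyticIn (seg c (c + N - 1) : Set (ℤ × ℤ)) (substMap φ s) A ∧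
      AnalyticIn (seg c (c + N - 1) : Set (ℤ × ℤ)) (substMap φ s) B ∧
      (∃ᶠ v in 𝓝 (substMap φ s), B v ≠ 0) ∧
      ∀ᶠ u in 𝓝 s, f u * B (substMap φ u) = A (substMap φ u) * g u := by
  obtain ⟨Ψ, Ξ, h1, hΨ, hΞ, hs, h2, h3, -, h5⟩ := h.exists_coordinates c N
  have hins : (seg c (c + N) : Set (ℤ × ℤ)) ⊆ insert (0, c + N) (seg c (c + N - 1)) := by
    rintro ⟨a, b⟩ hp
    obtain ⟨rfl, h6, h7⟩ := mem_seg.1 (Finset.mem_coe.1 hp)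
    simp only at h6 h7
    by_cases hb : b = c + N
    · exact Or.inl (by rw [hb])
    · exact Or.inr (Finset.mem_coe.2 (mem_seg.2 ⟨rfl, h6, by simp only; omega⟩))
  have hΞt : Tendsto Ξ (𝓝 (Ψ s)) (𝓝 s) := by have := hΞ.tendsto; rwa [hs] at this
  have hcomp : ∀ {f : (ℤ × ℤ → 𝕜) → 𝕜}, AnalyticIn (seg c (c + N) : Set (ℤ × ℤ)) s f →
      AnalyticIn (seg c (c + N) : Set (ℤ × ℤ)) (Ψ s) (fun v => f (Ξ v)) ∧
      (∀ᶠ u in 𝓝 s, f (Ξ (Ψ u)) = f u) ∧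
      ∀ᶠ v in 𝓝 (Ψ s), pd (0, c + N) (fun v => f (Ξ v)) v = ∑ m ∈ Finset.range (N + 1),
        (∏ i ∈ Finset.range m, slope φ (Ξ v) (c + i)) * pd (0, c + m) f (Ξ v) := by
    intro f hf
    have hf' : AnalyticIn (seg c (c + N) : Set (ℤ × ℤ)) (Ξ (Ψ s)) f := by rwa [hs]
    refine ⟨hf'.comp_map hΞ fun p hp => h2 p hp,
      hf.eventually_map_eq (hΞt.comp hΨ) fun p hp => h3 p hp, ?_⟩
    have h6 : ∀ᶠ v in 𝓝 (Ψ s), ∀ m ∈ Finset.range (N + 1),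
        pd (0, c + N) (fun v => Ξ v (0, c + m)) v =
          ∏ i ∈ Finset.range m, slope φ (Ξ v) (c + i) := by
      rw [eventually_all_finset]
      exact fun m hm => h5 m (by rw [Finset.mem_range] at hm; omega)
    filter_upwards [hf'.eventually_pd_comp hΞ h2 (0, c + N), h6] with v h7 h8
    rw [h7, sum_seg c N fun q => pd q f (Ξ v) * pd (0, c + N) (fun v => Ξ v q) v]
    exact Finset.sum_congr rfl fun m hm => by rw [h8 m hm, mul_comm]
  obtain ⟨hf1, hf2, hf3⟩ := hcomp hf
  obtain ⟨hg1, hg2, hg3⟩ := hcomp hg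
  have hg0' : ∃ᶠ v in 𝓝 (Ψ s), g (Ξ v) ≠ 0 := hΨ.tendsto.frequently
    ((hg0.and_eventually hg2).mono fun u hu => by rw [hu.2]; exact hu.1)
  -- In the new coordinates `hid` says that the quotient does not change with the free one, which
  -- can be dropped; only the substitution variables remain.
  obtain ⟨A, B, hA, hB, hB0, hAB⟩ := exists_quotient_without (hf1.mono hins) (hg1.mono hins) hg0' <| by
    filter_upwards [hf3, hg3, hΞt.eventually hid] with v h6 h7 h8
    rw [h6, h7, ← sub_eq_zero, ← h8, Finset.sum_mul, Finset.mul_sum, ← Finset.sum_sub_distrib]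
    exact Finset.sum_congr rfl fun m _ => by ring
  have hY : ∀ p ∈ (seg c (c + N - 1) : Set (ℤ × ℤ)), ∀ u, Ψ u p = substMap φ u p := by
    rintro ⟨a, b⟩ hp u
    obtain ⟨rfl, h6, h7⟩ := mem_seg.1 (Finset.mem_coe.1 hp)
    exact h1 b h6 (by simp only at h7; omega) u
  obtain ⟨A', hA', -, hA''⟩ := hA.exists_transfer fun p hp => hY p hp s
  obtain ⟨B', hB', hB0', hB''⟩ := hB.exists_transfer fun p hp => hY p hp s
  refine ⟨A', B', hA', hB', hB0' hB0, ?_⟩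
  filter_upwards [hΨ.eventually hAB, hA'' hΨ fun p hp => Eventually.of_forall fun u => hY p hp u,
    hB'' hΨ fun p hp => Eventually.of_forall fun u => hY p hp u, hf2, hg2] with u h6 h7 h8 h9 h10
  rw [← h7, ← h8, ← h9, ← h10]
  exact h6

/-- The substitution variables are independent. -/
theorem RegularAt.frequently_ne (h : RegularAt φ s) {a b : ℤ}
    (hf : AnalyticIn (seg a b : Set (ℤ × ℤ)) (substMap φ s) f)
    (h0 : ∃ᶠ v in 𝓝 (substMap φ s), f v ≠ 0) : ∃ᶠ u in 𝓝 s, f (substMap φ u) ≠ 0 := by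
  -- `Ξ` produces a column with prescribed substitution variables, so a function of these that
  -- vanishes for all columns near `s` vanishes identically.
  obtain ⟨Ψ, Ξ, h1, hΨ, hΞ, hs, -, -, h4, -⟩ := h.exists_coordinates a (b + 1 - a).toNat
  have hΞt : Tendsto Ξ (𝓝 (Ψ s)) (𝓝 s) := by have := hΞ.tendsto; rwa [hs] at this
  have hmem : ∀ p ∈ (seg a b : Set (ℤ × ℤ)), p = (0, p.2) ∧ a ≤ p.2 ∧
      p.2 < a + (b + 1 - a).toNat := by
    intro p hp
    obtain ⟨h5, h6, h7⟩ := mem_seg.1 (Finset.mem_coe.1 hp)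
    exact ⟨Prod.ext h5 rfl, h6, by omega⟩
  obtain ⟨f', -, hf0, hf'⟩ := hf.exists_transfer (t' := Ψ s) fun p hp => by
    obtain ⟨h5, h6, h7⟩ := hmem p hp
    rw [h5, h1 _ h6 h7]
  intro h5
  refine hf0 h0 ?_
  filter_upwards [hf' (h.continuousAt_substMap.tendsto.comp hΞt) (Φ := id) fun p hp => by
    obtain ⟨h5, h6, h7⟩ := hmem p hp
    rw [h5]
    exact h4 _ h6 h7, hΞt.eventually h5] with v h6 h7
  rw [show f' v = f (substMap φ (Ξ v)) from h6.symm]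
  exact h7

/-- Near `s`, `g` is a quotient of analytic functions of finitely many `Y u p`, `p ∈ K`. -/
def MeroVia (Y : (ℤ × ℤ → 𝕜) → (ℤ × ℤ → 𝕜)) (K : Set (ℤ × ℤ)) (s : ℤ × ℤ → 𝕜)
    (g : (ℤ × ℤ → 𝕜) → 𝕜) : Prop :=
  ∃ A B : (ℤ × ℤ → 𝕜) → 𝕜, AnalyticIn K (Y s) A ∧ AnalyticIn K (Y s) B ∧
    (∃ᶠ v in 𝓝 (Y s), B v ≠ 0) ∧ ∀ᶠ u in 𝓝 s, B (Y u) ≠ 0 → g u = A (Y u) / B (Y u)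

variable {Y : (ℤ × ℤ → 𝕜) → (ℤ × ℤ → 𝕜)}

theorem MeroVia.mono (h : MeroVia Y K s f) (hK : K ⊆ K') : MeroVia Y K' s f := by
  obtain ⟨A, B, hA, hB, h⟩ := h
  exact ⟨A, B, hA.mono hK, hB.mono hK, h⟩

theorem MeroVia.const (c : 𝕜) : MeroVia Y K s fun _ => c :=
  ⟨fun _ => c, fun _ => 1, AnalyticIn.const _ _ _, AnalyticIn.const _ _ _,
    (Eventually.of_forall fun _ => one_ne_zero).frequently, by simp⟩

theorem MeroVia.add (hf : MeroVia Y K s f) (hg : MeroVia Y K s g) :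
    MeroVia Y K s fun u => f u + g u := by
  obtain ⟨A, B, hA, hB, hB0, h⟩ := hf
  obtain ⟨A', B', hA', hB', hB0', h'⟩ := hg
  refine ⟨fun u => A u * B' u + B u * A' u, fun u => B u * B' u, (hA.mul hB').add (hB.mul hA'),
    hB.mul hB', hB.frequently_mul_ne hB' hB0 hB0', ?_⟩
  filter_upwards [h, h'] with u h1 h2 h3
  have h4 := left_ne_zero_of_mul h3
  have h5 := right_ne_zero_of_mul h3
  rw [h1 h4, h2 h5, div_add_div _ _ h4 h5]

theorem MeroVia.mul (hf : MeroVia Y K s f) (hg : MeroVia Y K s g) :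
    MeroVia Y K s fun u => f u * g u := by
  obtain ⟨A, B, hA, hB, hB0, h⟩ := hf
  obtain ⟨A', B', hA', hB', hB0', h'⟩ := hg
  refine ⟨fun u => A u * A' u, fun u => B u * B' u, hA.mul hA',
    hB.mul hB', hB.frequently_mul_ne hB' hB0 hB0', ?_⟩
  filter_upwards [h, h'] with u h1 h2 h3
  rw [h1 (left_ne_zero_of_mul h3), h2 (right_ne_zero_of_mul h3), div_mul_div_comm]

theorem MeroVia.finsetSum {ι : Type*} (I : Finset ι) {f : ι → (ℤ × ℤ → 𝕜) → 𝕜}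
    (h : ∀ i ∈ I, MeroVia Y K s (f i)) : MeroVia Y K s fun u => ∑ i ∈ I, f i u := by
  classical
  induction I using Finset.induction_on with
  | empty => simpa using MeroVia.const (0 : 𝕜)
  | insert i I hi ih =>
    simp only [Finset.sum_insert hi]
    exact (h i (by simp)).add (ih fun j hj => h j (by simp [hj]))

theorem MeroVia.shift {a b : ℤ} (h : MeroVia Y K (shift a b s) g)
    (hY : ∀ u, Y (shift a b u) = QuadGraph.shift a b (Y u))
    (hK : ∀ p ∈ K, (p.1 + a, p.2 + b) ∈ K') : MeroVia Y K' s fun u => g (shift a b u) := by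
  obtain ⟨A, B, hA, hB, hB0, h⟩ := h
  rw [hY] at hA hB hB0
  refine ⟨_, _, hA.shift hK, hB.shift hK, frequently_shift hB0, ?_⟩
  filter_upwards [(tendsto_shift_nhds a b s).eventually h] with u h1
  rwa [hY] at h1

theorem MeroVia.meroIn {K₁ : Set (ℤ × ℤ)} (h : MeroVia Y K s g) (hY : ContinuousAt Y s)
    (hY' : ∀ p ∈ K, AnalyticIn K₁ s fun u => Y u p)
    (hopen : ∀ B : (ℤ × ℤ → 𝕜) → 𝕜, AnalyticIn K (Y s) B → (∃ᶠ v in 𝓝 (Y s), B v ≠ 0) → ∃ᶠ u in 𝓝 s, B (Y u) ≠ 0) :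
    MeroIn K₁ s g := by
  obtain ⟨A, B, hA, hB, hB0, h⟩ := h
  exact ⟨fun u => A (Y u), fun u => B (Y u), hA.comp_map hY hY', hB.comp_map hY hY',
    hopen B hB hB0, h⟩

theorem RegularAt.meroIn (hφ : RegularAt φ s) {a b : ℤ}
    (h : MeroVia (substMap φ) (seg a b) s g) :
    MeroIn (seg a (b + 1) : Set (ℤ × ℤ)) s g := by
  refine MeroVia.meroIn h hφ.continuousAt_substMap (fun p hp => ?_)
    fun B hB hB0 => hφ.frequently_ne hB hB0
  obtain ⟨-, h1, h2⟩ := mem_seg.1 (Finset.mem_coe.1 hp)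
  exact hφ.analyticIn_substMap (mem_seg.2 ⟨rfl, h1, by simp only; omega⟩)
    (mem_seg.2 ⟨rfl, by simp only; omega, by simp only; omega⟩)

/-- Openness of a projection to coordinates indexed without repetition, used to translate between
finite index types and sets of vertices. -/
theorem map_coord_nhds {ι : Type*} (e : ι → ℤ × ℤ) (he : Function.Injective e)
    (t : ℤ × ℤ → 𝕜) : map (fun v i => v (e i)) (𝓝 t) = 𝓝 fun i => t (e i) := by
  have hc : Continuous fun (v : ℤ × ℤ → 𝕜) i => v (e i) :=
    continuous_pi fun i => continuous_apply (e i)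
  refine le_antisymm hc.continuousAt ?_
  have hσ : Continuous fun y : ι → 𝕜 => Function.extend e y t := by
    refine continuous_pi fun p => ?_
    by_cases h : ∃ i, e i = p
    · obtain ⟨i, rfl⟩ := h
      simpa only [he.extend_apply] using continuous_apply i
    · simpa only [Function.extend_apply' _ _ _ h] using continuous_const
  have h1 : Function.extend e (fun i => t (e i)) t = t := by
    funext p
    by_cases h : ∃ i, e i = p
    · obtain ⟨i, rfl⟩ := h
      rw [he.extend_apply]
    · rw [Function.extend_apply' _ _ _ h]
  have h2 := hσ.tendsto fun i => t (e i)
  rw [h1] at h2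
  have h3 := map_mono (m := fun (v : ℤ × ℤ → 𝕜) i => v (e i)) h2
  rw [map_map] at h3
  convert h3
  rw [show ((fun (v : ℤ × ℤ → 𝕜) i => v (e i)) ∘ fun y => Function.extend e y t) = id from
    funext fun y => funext fun i => he.extend_apply _ _ _, map_id]

theorem isFunctionOf_iff_meroVia {a b : ℤ} (hY : ∀ s ∈ S, ContinuousAt Y s) :
    IsFunctionOf S (fun (k : Finset.Icc a b) u => Y u (0, k)) g ↔
      ∀ s ∈ S, MeroVia Y (seg a b) s g := by
  have hinj : Function.Injective fun k : Finset.Icc a b => ((0 : ℤ), (k : ℤ)) := fun k l h =>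
    Subtype.ext (Prod.ext_iff.1 h).2
  have hmap := fun s => map_coord_nhds (fun k : Finset.Icc a b => ((0 : ℤ), (k : ℤ))) hinj (Y s)
  refine forall₂_congr fun s hs => ⟨?_, ?_⟩
  · rintro ⟨A, B, hA, hB, hB0, h⟩
    have hpi : AnalyticIn (seg a b : Set (ℤ × ℤ)) (Y s)
        fun v (k : Finset.Icc a b) => v (0, (k : ℤ)) := AnalyticIn.pi fun k =>
      AnalyticIn.coord (Finset.mem_coe.2 (mem_seg.2 ⟨rfl, Finset.mem_Icc.1 k.2⟩))
    refine ⟨_, _, AnalyticIn.comp (H := A) hA hpi, AnalyticIn.comp (H := B) hB hpi, ?_, h⟩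
    rwa [← hmap, frequently_map] at hB0
  · rintro ⟨A, B, ⟨L, hL, A', hA', hA⟩, ⟨L', hL', B', hB', hB⟩, hB0, h⟩
    have hmem : ∀ {L : Finset (ℤ × ℤ)}, (L : Set (ℤ × ℤ)) ⊆ seg a b → ∀ q : L,
        (q : ℤ × ℤ).2 ∈ Finset.Icc a b := fun hL q =>
      Finset.mem_Icc.2 (mem_seg.1 (hL q.2)).2
    let σ : ∀ {L : Finset (ℤ × ℤ)}, (L : Set (ℤ × ℤ)) ⊆ seg a b →
        (Finset.Icc a b → 𝕜) →L[𝕜] (L → 𝕜) := fun hL =>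
      ContinuousLinearMap.pi fun q => ContinuousLinearMap.proj ⟨_, hmem hL q⟩
    have hσ : ∀ {L : Finset (ℤ × ℤ)} (hL : (L : Set (ℤ × ℤ)) ⊆ seg a b) (v : ℤ × ℤ → 𝕜),
        σ hL (fun k => v (0, k)) = res L v := fun hL v => funext fun q => by
      have : (q : ℤ × ℤ) = (0, (q : ℤ × ℤ).2) := Prod.ext (mem_seg.1 (hL q.2)).1 rfl
      simp only [σ, ContinuousLinearMap.coe_pi', ContinuousLinearMap.proj_apply, res]
      rw [this]
    refine ⟨fun y => A' (σ hL y), fun y => B' (σ hL' y), ?_, ?_, ?_, ?_⟩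
    · exact AnalyticAt.fun_comp (g := A') (by rwa [hσ hL]) ((σ hL).analyticAt _)
    · exact AnalyticAt.fun_comp (g := B') (by rwa [hσ hL']) ((σ hL').analyticAt _)
    · rw [← hmap, frequently_map]
      exact (hB0.and_eventually hB).mono fun v hv => by dsimp only; rw [hσ hL', ← hv.2]; exact hv.1
    · filter_upwards [h, (hY s hs).eventually hA, (hY s hs).eventually hB] with u h1 h2 h3
      rw [hσ hL, hσ hL', ← h2, ← h3]
      exact h1

theorem isFunctionOfColumn_iff {a b : ℤ} :
    IsFunctionOfColumn S a b g ↔ ∀ s ∈ S, MeroIn (seg a b : Set (ℤ × ℤ)) s g :=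
  isFunctionOf_iff_meroVia (Y := id) fun _ _ => continuousAt_id

theorem isFunctionOfSubst_iff (hφ : ∀ s ∈ S, RegularAt φ s) {a b : ℤ} :
    IsFunctionOfSubst S φ a b g ↔ ∀ s ∈ S, MeroVia (substMap φ) (seg a b) s g :=
  isFunctionOf_iff_meroVia fun s hs => (hφ s hs).continuousAt_substMap

theorem IsFunctionOfDynamical.honest (h : IsFunctionOfDynamical S g) : Honest S g := by
  obtain ⟨K, hK, h⟩ := h
  have h1 : ∀ᶠ n : ℕ in atTop, ∀ p ∈ K, p ∈ window n := by
    rw [eventually_all_finset]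
    exact fun p _ => eventually_mem_window p
  obtain ⟨n, hn⟩ := h1.exists
  refine ⟨n, fun s hs => ?_⟩
  obtain ⟨A, B, hA, hB, hB0, h⟩ := h s hs
  have hsub : (K : Set (ℤ × ℤ)) ⊆ cross n := fun p hp =>
    Finset.mem_coe.2 (mem_cross.2 ⟨hn p hp, hK p hp⟩)
  refine ⟨fun u => A (res K u), fun u => B (res K u),
    ⟨K, hsub, A, hA, Eventually.of_forall fun _ => rfl⟩,
    ⟨K, hsub, B, hB, Eventually.of_forall fun _ => rfl⟩, ?_, h⟩
  change ∃ᶠ y in 𝓝 (res K s), B y ≠ 0 at hB0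
  rwa [← map_res_nhds, frequently_map] at hB0

end QuadGraph

/-! ### Column functions whose `T_i`-shift is again a column function. -/

namespace QuadGraph

variable {𝕜 : Type*} [RCLike 𝕜]
variable {D : Set (𝕜 × 𝕜 × 𝕜)} {F : 𝕜 × 𝕜 × 𝕜 → 𝕜} {S : Set (ℤ × ℤ → 𝕜)}
  {E : Set (𝕜 × 𝕜)} {φ ψ : 𝕜 × 𝕜 → 𝕜}
  {s : ℤ × ℤ → 𝕜} {f g h k : (ℤ × ℤ → 𝕜) → 𝕜}

/-- The derivatives of the relation `φ(u_{1,0}, F(u, u_{1,0}, u_{0,1})) = ψ(u, u_{0,1})`. -/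
theorem HasForm.deriv_relation (hF : IsEquation D F) (hform : HasForm D F E φ ψ) {x y z : 𝕜}
    (hD : (x, y, z) ∈ D) :
    d₁ φ y (F (x, y, z)) + d₂ φ y (F (x, y, z)) * deriv (fun t => F (x, t, z)) y = 0 ∧
    d₁ ψ x z = d₂ φ y (F (x, y, z)) * deriv (fun t => F (t, y, z)) x ∧
    d₂ ψ x z = d₂ φ y (F (x, y, z)) * deriv (fun t => F (x, y, t)) z := by
  have hd := (hF.analytic _ hD).differentiableAt.hasFDerivAt
  have hφa := hform.analytic_φ _ (hform.mem_left _ _ _ hD)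
  have hφd := hφa.differentiableAt.hasFDerivAt
  have h1 : HasDerivAt (fun t => F (t, y, z)) (deriv (fun t => F (t, y, z)) x) x :=
    (hd.comp_hasDerivAt x ((hasDerivAt_id' x).prodMk
      (hasDerivAt_const x (y, z)))).differentiableAt.hasDerivAt
  have h2 : HasDerivAt (fun t => F (x, t, z)) (deriv (fun t => F (x, t, z)) y) y :=
    (hd.comp_hasDerivAt y ((hasDerivAt_const y x).prodMk
      ((hasDerivAt_id' y).prodMk (hasDerivAt_const y z)))).differentiableAt.hasDerivAt
  have h3 : HasDerivAt (fun t => F (x, y, t)) (deriv (fun t => F (x, y, t)) z) z :=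
    (hd.comp_hasDerivAt z ((hasDerivAt_const z x).prodMk
      ((hasDerivAt_const z y).prodMk (hasDerivAt_id' z)))).differentiableAt.hasDerivAt
  have hmem : ∀ {e : 𝕜 → 𝕜 × 𝕜 × 𝕜} {t : 𝕜}, Continuous e → e t ∈ D → ∀ᶠ t' in 𝓝 t, e t' ∈ D :=
    fun he ht => he.continuousAt.eventually (hF.isOpen.mem_nhds ht)
  refine ⟨?_, ?_, ?_⟩
  · have h4 := hφd.comp_hasDerivAt y ((hasDerivAt_id' y).prodMk h2)
    rw [fderiv_eq_d₁_d₂ hφa] at h4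
    have h5 : (fun t => φ (t, F (x, t, z))) =ᶠ[𝓝 y] fun _ => ψ (x, z) := by
      filter_upwards [hmem (e := fun t => (x, t, z)) (by fun_prop) hD] with t ht
      exact hform.relation _ _ _ ht
    have h6 := h4.deriv.symm.trans (h5.deriv_eq.trans (deriv_const _ _))
    simpa using h6
  · have h4 := hφd.comp_hasDerivAt x ((hasDerivAt_const x y).prodMk h1)
    rw [fderiv_eq_d₁_d₂ hφa] at h4
    have h5 : (fun t => φ (y, F (t, y, z))) =ᶠ[𝓝 x] fun t => ψ (t, z) := by
      filter_upwards [hmem (e := fun t => (t, y, z)) (by fun_prop) hD] with t ht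
      exact hform.relation _ _ _ ht
    have h6 := h4.deriv.symm.trans h5.deriv_eq
    simpa [d₁] using h6.symm
  · have h4 := hφd.comp_hasDerivAt z ((hasDerivAt_const z y).prodMk h3)
    rw [fderiv_eq_d₁_d₂ hφa] at h4
    have h5 : (fun t => φ (y, F (x, y, t))) =ᶠ[𝓝 z] fun t => ψ (x, t) := by
      filter_upwards [hmem (e := fun t => (x, y, t)) (by fun_prop) hD] with t ht
      exact hform.relation _ _ _ ht
    have h6 := h4.deriv.symm.trans h5.deriv_eq
    simpa [d₂] using h6.symm

/-- Both partial derivatives of `ψ` have this factor, so its vanishing would contradict the Jacobian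
condition at `(x, z)`. -/
theorem HasForm.d₂_ne (hF : IsEquation D F) (hform : HasForm D F E φ ψ) {x y z : 𝕜}
    (hD : (x, y, z) ∈ D) : d₂ φ y (F (x, y, z)) ≠ 0 := by
  intro h0
  obtain ⟨-, h1, h2⟩ := hform.deriv_relation hF hD
  refine hform.jacobian x z (hform.mem_right _ _ _ hD) ?_
  rw [h1, h2, h0]; ring

theorem HasForm.regularAt_right (hF : IsEquation D F) (hform : HasForm D F E φ ψ)
    (hs : ∀ i j, SolvesAt D F s i j) : RegularAt ψ s := by
  have h1 : ∀ k, (s (0, k), s (1, k), s (0, k + 1)) ∈ D := fun k => by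
    simpa [corner] using (hs 0 k).1
  refine ⟨fun k => hform.analytic_ψ _ (hform.mem_right _ _ _ (h1 k)), fun k => ?_, fun k => ?_⟩
  · rw [(hform.deriv_relation hF (h1 k)).2.1]
    exact mul_ne_zero (hform.d₂_ne hF (h1 k)) (hF.deriv_u _ _ _ (h1 k))
  · rw [(hform.deriv_relation hF (h1 k)).2.2]
    exact mul_ne_zero (hform.d₂_ne hF (h1 k)) (hF.deriv_u01 _ _ _ (h1 k))

/-- The relation controls `φ` only on the right-hand sides of squares, so the column `i = 0` is
viewed as the right-hand side of the squares at `i = -1`. -/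
theorem HasForm.regularAt_left (hF : IsEquation D F) (hform : HasForm D F E φ ψ)
    (hs : ∀ i j, SolvesAt D F s i j) : RegularAt φ s := by
  have h1 : ∀ k, (s (-1, k), s (0, k), s (-1, k + 1)) ∈ D := fun k => by
    simpa [corner] using (hs (-1) k).1
  have h2 : ∀ k, s (0, k + 1) = F (s (-1, k), s (0, k), s (-1, k + 1)) := fun k => by
    simpa [corner] using (hs (-1) k).2
  refine ⟨fun k => ?_, fun k => ?_, fun k => ?_⟩ <;> rw [h2 k]
  · exact hform.analytic_φ _ (hform.mem_left _ _ _ (h1 k))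
  · rw [eq_neg_of_add_eq_zero_left (hform.deriv_relation hF (h1 k)).1]
    exact neg_ne_zero.2 (mul_ne_zero (hform.d₂_ne hF (h1 k)) (hF.deriv_u10 _ _ _ (h1 k)))
  · exact hform.d₂_ne hF (h1 k)

theorem rep_prod {ι : Type*} (I : Finset ι) (x : ι → germRing D F S) :
    rep (∏ i ∈ I, x i) =ᶠ[solSup D F S] fun u => ∏ i ∈ I, rep (x i) u := by
  classical
  induction I using Finset.induction_on with
  | empty => exact Honest.rep_germ (Honest.const S 1)
  | insert i I hi ih =>
    rw [Finset.prod_insert hi]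
    filter_upwards [rep_mul (x i) (∏ i ∈ I, x i), ih] with u h1 h2
    rw [h1, h2, Finset.prod_insert hi]

theorem seg_subset_cross (n : ℕ) : (seg (-n) n : Set (ℤ × ℤ)) ⊆ cross n := by
  intro p hp
  obtain ⟨h1, h2, h3⟩ := mem_seg.1 (Finset.mem_coe.1 hp)
  refine Finset.mem_coe.2 (mem_cross.2 ⟨mem_window.2 ⟨?_, abs_le.2 ⟨h2, h3⟩⟩, Or.inl h1⟩)
  simp [h1]

theorem honest_of_seg {n : ℕ} (hh : ∀ s ∈ S, MeroIn (seg (-n) n : Set (ℤ × ℤ)) s h) :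
    Honest S h := ⟨n, fun s hs => (hh s hs).mono (seg_subset_cross n)⟩

theorem pdGerm_germ_of_seg (hF : IsEquation D F) (hS : IsBase D F S) {n : ℕ}
    (hh : ∀ s ∈ S, MeroIn (seg (-n) n : Set (ℤ × ℤ)) s h) {p : ℤ × ℤ}
    (hp : p ∉ (seg (-n) n : Set (ℤ × ℤ))) :
    pdGerm p ((honest_of_seg hh).germ D F) = 0 := by
  rw [Honest.pdGerm_germ hF hS]
  exact (Honest.germ_eq_germ _ (Honest.const S 0)).2
    (eventually_pd_eq_zero_of_notMem (seg_subset_axes _ _) hh hp)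

/-- A function `h` of the `u_{0,l}` with `T_i(h)` again a function of the `u_{0,l}` does not change
along certain curves. -/
theorem eventually_sum_pd_eq_zero (hF : IsEquation D F) (hS : IsBase D F S) {n : ℕ}
    (hh : ∀ s ∈ S, MeroIn (seg (-n) n : Set (ℤ × ℤ)) s h)
    (hk : ∀ s ∈ S, MeroIn (seg (-n) n : Set (ℤ × ℤ)) s k)
    (hhk : (fun u => h (shift 1 0 u)) =ᶠ[solSup D F S] k) (hg : Honest S g)
    (hgα : (fun u => g (shift 1 0 u)) =ᶠ[solSup D F S] Fu10 F) :
    ∀ᶠ u in solSup D F S, ∑ m ∈ Finset.range (2 * n + 1),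
      (∏ i ∈ Finset.range m, g (shift 0 (-(n : ℤ) + i) u)) * pd (0, -(n : ℤ) + m) h u = 0 := by
  let := germField hF hS
  have hh' := honest_of_seg hh
  have hk' := honest_of_seg hk
  have hT : shiftHom hF hS 1 0 (hh'.germ D F) = hk'.germ D F :=
    (shiftHom_germ_eq hF hS hh' hk').2 hhk
  have hcol : ∀ {f : (ℤ × ℤ → 𝕜) → 𝕜}
      (hf : ∀ s ∈ S, MeroIn (seg (-n) n : Set (ℤ × ℤ)) s f),
      (crossField hF hS).IsColumn ((honest_of_seg hf).germ D F) := fun hf a ha =>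
    pdGerm_germ_of_seg hF hS hf fun hp => ha (mem_seg.1 (Finset.mem_coe.1 hp)).1
  have h1 : ∑ m ∈ Finset.range (2 * n + 1), (∏ i ∈ Finset.range m,
      shiftHom hF hS 0 (-(n : ℤ) + i) (hg.germ D F)) * pdGerm (0, -(n : ℤ) + m) (hh'.germ D F)
      = 0 :=
    (crossField hF hS).sum_dd_eq_zero (hcol hh) (by
      change (crossField hF hS).IsColumn (shiftHom hF hS 1 0 (hh'.germ D F))
      rw [hT]; exact hcol hk)
      ((shiftHom_germ_eq hF hS hg (honest_Fu10 hF hS)).2 hgα)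
      fun q hq => pdGerm_germ_of_seg hF hS hh fun hp => hq (by exact_mod_cast seg_subset_cross n hp)
  have h2 := (rep_eq_zero _).1 h1
  have h3 : ∀ᶠ u in solSup D F S, ∀ m ∈ Finset.range (2 * n + 1), rep ((∏ i ∈ Finset.range m,
      shiftHom hF hS 0 (-(n : ℤ) + i) (hg.germ D F)) * pdGerm (0, -(n : ℤ) + m) (hh'.germ D F)) u
      = (∏ i ∈ Finset.range m, g (shift 0 (-(n : ℤ) + i) u)) * pd (0, -(n : ℤ) + m) h u := by
    rw [eventually_all_finset]
    intro m _
    have h4 : ∀ᶠ u in solSup D F S, ∀ i ∈ Finset.range m,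
        rep (shiftHom hF hS 0 (-(n : ℤ) + i) (hg.germ D F)) u =
          g (shift 0 (-(n : ℤ) + i) u) := by
      rw [eventually_all_finset]
      intro i _
      filter_upwards [rep_shiftHom hF hS 0 (-(n : ℤ) + i) (hg.germ D F),
        (tendsto_shift_solSup hF hS 0 (-(n : ℤ) + i)).eventually hg.rep_germ] with u h5 h6
      rw [h5, h6]
    rw [hh'.pdGerm_germ hF hS]
    filter_upwards [rep_mul (∏ i ∈ Finset.range m,
      shiftHom hF hS 0 (-(n : ℤ) + i) (hg.germ D F)) ((hh'.pd (0, -(n : ℤ) + m)).germ D F),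
      rep_prod (Finset.range m) fun i : ℕ => shiftHom hF hS 0 (-(n : ℤ) + i) (hg.germ D F), h4,
      (hh'.pd (0, -(n : ℤ) + m)).rep_germ (D := D) (F := F)] with u h5 h6 h7 h8
    rw [h5, h6, h8, Finset.prod_congr rfl h7]
  filter_upwards [h2, h3, rep_sum (Finset.range (2 * n + 1)) fun m : ℕ => (∏ i ∈ Finset.range m,
      shiftHom hF hS 0 (-(n : ℤ) + i) (hg.germ D F)) * pdGerm (0, -(n : ℤ) + m) (hh'.germ D F)]
    with u h4 h5 h6
  rw [← Finset.sum_congr rfl h5, ← h6, h4]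

theorem slope_shift (φ : 𝕜 × 𝕜 → 𝕜) (u : ℤ × ℤ → 𝕜) (l : ℤ) :
    slope φ (shift 0 l u) 0 = slope φ u l := by
  simp [slope, shift, add_comm]

theorem RegularAt.analyticIn_d₁ (hφ : RegularAt φ s) {K : Set (ℤ × ℤ)} {l : ℤ} (h0 : (0, l) ∈ K)
    (h1 : (0, l + 1) ∈ K) : AnalyticIn K s fun u => d₁ φ (u (0, l)) (u (0, l + 1)) :=
  AnalyticIn.comp (H := fun y => d₁ φ y.1 y.2) (f := fun u => (u (0, l), u (0, l + 1)))
    (analyticAt_d₁ (hφ.analyticAt l)) ((AnalyticIn.coord h0).prodMk (AnalyticIn.coord h1))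

theorem RegularAt.analyticIn_d₂ (hφ : RegularAt φ s) {K : Set (ℤ × ℤ)} {l : ℤ} (h0 : (0, l) ∈ K)
    (h1 : (0, l + 1) ∈ K) : AnalyticIn K s fun u => d₂ φ (u (0, l)) (u (0, l + 1)) :=
  AnalyticIn.comp (H := fun y => d₂ φ y.1 y.2) (f := fun u => (u (0, l), u (0, l + 1)))
    (analyticAt_d₂ (hφ.analyticAt l)) ((AnalyticIn.coord h0).prodMk (AnalyticIn.coord h1))

theorem RegularAt.analyticIn_slope (hφ : RegularAt φ s) {K : Set (ℤ × ℤ)} {l : ℤ}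
    (h0 : (0, l) ∈ K) (h1 : (0, l + 1) ∈ K) : AnalyticIn K s fun u => slope φ u l :=
  ((hφ.analyticIn_d₁ h0 h1).div (hφ.analyticIn_d₂ h0 h1) (hφ.d₂_ne l)).neg

/-- Near `s`, the function `g` agrees on solutions with a quotient of analytic functions of the
`Y u p`, `p ∈ K`. -/
def SolMeroVia (D : Set (𝕜 × 𝕜 × 𝕜)) (F : 𝕜 × 𝕜 × 𝕜 → 𝕜) (Y : (ℤ × ℤ → 𝕜) → (ℤ × ℤ → 𝕜))
    (K : Set (ℤ × ℤ)) (s : ℤ × ℤ → 𝕜) (g : (ℤ × ℤ → 𝕜) → 𝕜) : Prop :=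
  ∃ A B : (ℤ × ℤ → 𝕜) → 𝕜, AnalyticIn K (Y s) A ∧ AnalyticIn K (Y s) B ∧
    (∃ᶠ v in 𝓝 (Y s), B v ≠ 0) ∧ ∀ᶠ u in solFilter D F s, g u = A (Y u) / B (Y u)

/-- Moving u_{1,0} alone keeps `φ(u_{1,0}, u_{1,1}) = ψ(u, u_{0,1})` fixed, hence `-φ_w / φ_z` there
is the derivative of `F`. So `θ = slope` is the ratio required by `CrossField.sum_dd_eq_zero`. -/
theorem slope_shift_one (hF : IsEquation D F) (hform : HasForm D F E φ ψ) :
    (fun u => slope φ (shift 1 0 u) 0) =ᶠ[solSup D F S] Fu10 F := by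
  refine eventually_solSup.2 fun s _ => ?_
  filter_upwards [eventually_solvesOn 0] with u hu
  obtain ⟨h1, h2⟩ := hu 0 0 (by simp) (by simp)
  simp only [corner, zero_add] at h1 h2
  have h3 := (hform.deriv_relation hF h1).1
  have h4 := hform.d₂_ne hF h1
  rw [← h2] at h3 h4
  simp only [slope, shift_apply, zero_add, add_zero, Fu10]
  field_simp
  linear_combination -h3

/-- The functions of the `u_{0,l}` whose `T_i`-shifts are functions of the `u_{0,l}` are functions
of the substitution variables. -/
theorem solMeroVia_left (hF : IsEquation D F) (hS : IsBase D F S) (hform : HasForm D F E φ ψ)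
    {n : ℕ} (hh : ∀ s ∈ S, MeroIn (seg (-n) n : Set (ℤ × ℤ)) s h)
    (hk : ∀ s ∈ S, MeroIn (seg (-n) n : Set (ℤ × ℤ)) s k)
    (hhk : (fun u => h (shift 1 0 u)) =ᶠ[solSup D F S] k) (hs : s ∈ S) :
    SolMeroVia D F (substMap φ) (seg (-n) n) s h := by
  have hφ : ∀ s ∈ S, RegularAt φ s := fun s hs => hform.regularAt_left hF (hS.solves s hs)
  have hθ : Honest S fun u => slope φ u 0 := ⟨1, fun s hs =>
    ((hφ s hs).analyticIn_slope (by simp [mem_cross, mem_window])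
      (by simp [mem_cross, mem_window])).meroIn⟩
  have h1 := eventually_solSup.1 (eventually_sum_pd_eq_zero hF hS hh hk hhk hθ
    (slope_shift_one hF hform)) s hs
  simp only [slope_shift] at h1
  obtain ⟨f, g, hf, hg, hg0, hfg⟩ := hh s hs
  have hax := seg_subset_axes (-n) n
  have hseg : (-(n : ℤ) + ((2 * n : ℕ) : ℤ)) = n := by push_cast; ring
  have hslope : ∀ l, AnalyticIn axes s fun u => slope φ u l := fun l =>
    (hφ s hs).analyticIn_slope (Or.inl rfl) (Or.inl rfl)
  -- Clearing the denominator of `h` makes the identity analytic in the column variables, so it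
  -- holds near `s` and not only on generic solutions.
  have h2 : ∀ᶠ u in 𝓝 s, ∑ m ∈ Finset.range (2 * n + 1),
      (∏ i ∈ Finset.range m, slope φ u (-(n : ℤ) + i)) *
        (pd (0, -(n : ℤ) + m) f u * g u - f u * pd (0, -(n : ℤ) + m) g u) = 0 := by
    refine AnalyticIn.eventuallyEq_of_solFilter hF (hS.solves s hs) (D := D)
      (AnalyticIn.finsetSum _ fun (m : ℕ) _ =>
        (AnalyticIn.finsetProd _ fun (i : ℕ) _ => hslope (-(n : ℤ) + i)).mul
          ((((hf.mono hax).pd _).mul (hg.mono hax)).sub ((hf.mono hax).mul ((hg.mono hax).pd _))))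
      (AnalyticIn.const axes s 0) ?_
    have h3 : ∀ᶠ u in 𝓝 s, ∀ m ∈ Finset.range (2 * n + 1), g u ≠ 0 →
        pd (0, -(n : ℤ) + m) h u =
        (pd (0, -(n : ℤ) + m) f u * g u - f u * pd (0, -(n : ℤ) + m) g u) / g u ^ 2 := by
      rw [eventually_all_finset]
      exact fun m _ => MeroIn.eventually_pd hf hg hfg _
    filter_upwards [h1, solFilter_le_nhds h3, (hg.mono hax).eventually_ne hg0] with u h4 h5 h6
    rw [Finset.sum_congr rfl fun m hm => by rw [h5 m hm h6]] at h4
    simp only [← mul_div_assoc] at h4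
    rw [← Finset.sum_div, div_eq_zero_iff, or_iff_left (pow_ne_zero 2 h6)] at h4
    exact h4
  obtain ⟨A, B, hA, hB, hB0, hAB⟩ := (hφ s hs).exists_quotient (c := -n) (N := 2 * n)
    (by rwa [hseg]) (by rwa [hseg]) hg0 h2
  rw [hseg] at hA hB
  refine ⟨A, B, hA.mono (seg_mono le_rfl (by omega)), hB.mono (seg_mono le_rfl (by omega)), hB0, ?_⟩
  have hBY : AnalyticIn axes s fun u => B (substMap φ u) :=
    hB.comp_map (hφ s hs).continuousAt_substMap fun p _ =>
      (hφ s hs).analyticIn_substMap (Or.inl rfl) (Or.inl rfl)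
  filter_upwards [solFilter_le_nhds hfg, (hg.mono hax).eventually_ne hg0, solFilter_le_nhds hAB,
    hBY.eventually_ne ((hφ s hs).frequently_ne hB hB0)] with u h3 h4 h5 h6
  rw [h3 h4, div_eq_div_iff h4 h6, h5]

/-- `T_i` carries the variables `φ(u_{0,k}, u_{0,k+1})` to `ψ(u_{0,k}, u_{0,k+1})`, so the quotient
that gives `h` at the shifted solution, evaluated on the latter, gives `k`. -/
theorem solMeroVia_right (hF : IsEquation D F) (hS : IsBase D F S) (hform : HasForm D F E φ ψ)
    {K : Set (ℤ × ℤ)} (hh : ∀ s ∈ S, SolMeroVia D F (substMap φ) K s h)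
    (hhk : (fun u => h (shift 1 0 u)) =ᶠ[solSup D F S] k) (hs : s ∈ S) :
    SolMeroVia D F (substMap ψ) K s k := by
  have hrel : ∀ (u : ℤ × ℤ → 𝕜) (p : ℤ × ℤ), SolvesAt D F u 0 p.2 →
      substMap φ (shift 1 0 u) p = substMap ψ u p := by
    rintro u p ⟨h1, h2⟩
    simp only [corner, zero_add] at h1 h2
    have := hform.relation _ _ _ h1
    rw [← h2] at this
    simpa [substMap, shift] using this
  have hYs : substMap φ (shift 1 0 s) = substMap ψ s := funext fun p => hrel s p (hS.solves s hs 0 p.2)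
  obtain ⟨A, B, hA, hB, hB0, h1⟩ := hh _ (hS.shift_mem hs 1 0)
  have ht1 : Tendsto (fun u => substMap φ (shift 1 0 u)) (solFilter D F s) (𝓝 (substMap ψ s)) := by
    rw [← hYs]
    exact ((hform.regularAt_left hF (hS.solves _ (hS.shift_mem hs 1 0))).continuousAt_substMap.tendsto.comp
      (tendsto_shift_nhds 1 0 s)).mono_left solFilter_le_nhds
  have ht2 : Tendsto (substMap ψ) (solFilter D F s) (𝓝 (substMap ψ s)) :=
    (hform.regularAt_right hF (hS.solves s hs)).continuousAt_substMap.tendsto.mono_left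
      solFilter_le_nhds
  have heq : ∀ p : ℤ × ℤ, ∀ᶠ u in solFilter D F s,
      substMap φ (shift 1 0 u) p = substMap ψ u p := fun p => by
    filter_upwards [eventually_solvesOn p.2.natAbs] with u hu
    exact hrel u p (hu 0 p.2 (by simp) (Int.abs_eq_natAbs _).le)
  rw [hYs] at hA hB hB0
  refine ⟨A, B, hA, hB, hB0, ?_⟩
  filter_upwards [(tendsto_shift_solFilter hF hS hs 1 0).eventually h1,
    eventually_solSup.1 hhk s hs, hA.eventually_eq_of_eqOn ht1 ht2 fun p _ => heq p,
    hB.eventually_eq_of_eqOn ht1 ht2 fun p _ => heq p] with u h2 h3 h4 h5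
  rw [← h3, h2, h4, h5]

theorem exists_meroVia (hF : IsEquation D F) (hS : IsBase D F S) (hφ : ∀ s ∈ S, RegularAt φ s)
    {a b : ℤ} (hh : ∀ s ∈ S, SolMeroVia D F (substMap φ) (seg a b) s h) :
    ∃ h', (∀ s ∈ S, MeroVia (substMap φ) (seg a b) s h') ∧
      ∀ s ∈ S, h' =ᶠ[solFilter D F s] h := by
  choose! A B hA hB hB0 hAB using hh
  have hY : ∀ s ∈ S, ∀ {f : (ℤ × ℤ → 𝕜) → 𝕜}, AnalyticIn (seg a b : Set (ℤ × ℤ)) (substMap φ s) f →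
      AnalyticIn axes s fun u => f (substMap φ u) := fun s hs f hf =>
    hf.comp_map (hφ s hs).continuousAt_substMap fun p _ =>
      (hφ s hs).analyticIn_substMap (Or.inl rfl) (Or.inl rfl)
  obtain ⟨h', h1, h2⟩ := exists_eventually_eq_div hF hS (A := fun s u => A s (substMap φ u))
    (B := fun s u => B s (substMap φ u)) (fun s hs => hY s hs (hA s hs))
    (fun s hs => hY s hs (hB s hs)) (fun s hs => (hφ s hs).frequently_ne (hB s hs) (hB0 s hs)) hAB
  exact ⟨h', fun s hs => ⟨A s, B s, hA s hs, hB s hs, hB0 s hs, h1 s hs⟩, h2⟩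

end QuadGraph

/-! ### From the operator to the substitutions of Miura type. -/

namespace QuadGraph

variable {𝕜 : Type*} [RCLike 𝕜]
variable {D : Set (𝕜 × 𝕜 × 𝕜)} {F : 𝕜 × 𝕜 × 𝕜 → 𝕜} {S : Set (ℤ × ℤ → 𝕜)}
  {E : Set (𝕜 × 𝕜)} {φ ψ : 𝕜 × 𝕜 → 𝕜}
  {s : ℤ × ℤ → 𝕜} {f g h k : (ℤ × ℤ → 𝕜) → 𝕜}

/-- The finitely many variables u_{l,0}, `l ≠ 0`, are removed one at a time near each member of `S`,
and the resulting quotients are glued. -/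
theorem exists_column (hF : IsEquation D F) (hS : IsBase D F S) (x : germRing D F S)
    (hx : ∀ l : ℤ, l ≠ 0 → pdGerm (l, 0) x = 0) : ∃ (n : ℕ) (g : (ℤ × ℤ → 𝕜) → 𝕜),
      (∀ s ∈ S, MeroIn (seg (-n) n : Set (ℤ × ℤ)) s g) ∧ g =ᶠ[solSup D F S] rep x := by
  classical
  obtain ⟨n, hn⟩ := rep_honest x
  have h1 : (((cross n).filter fun p => p.1 ≠ 0 : Finset (ℤ × ℤ)) : Set (ℤ × ℤ)) ∪ seg (-n) n ⊆
      axes := by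
    refine Set.union_subset (fun p hp => ?_) (seg_subset_axes _ _)
    exact (mem_cross.1 (Finset.mem_filter.1 (Finset.mem_coe.1 hp)).1).2
  have h2 : (cross n : Set (ℤ × ℤ)) ⊆
      (((cross n).filter fun p => p.1 ≠ 0 : Finset (ℤ × ℤ)) : Set (ℤ × ℤ)) ∪ seg (-n) n := by
    intro p hp
    by_cases h0 : p.1 = 0
    · exact Or.inr (Finset.mem_coe.2 (mem_seg.2 ⟨h0,
        abs_le.1 (mem_window.1 (mem_cross.1 (Finset.mem_coe.1 hp)).1).2⟩))
    · exact Or.inl (Finset.mem_coe.2 (Finset.mem_filter.2 ⟨Finset.mem_coe.1 hp, h0⟩))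
  obtain ⟨g, hg1, hg2⟩ := exists_meroIn hF hS (seg_subset_axes (-n) n) fun s hs =>
    SolMeroIn.without_finset hF (hS.solves s hs) _ h1
      (((hn s hs).mono h2).solMeroIn h1) ((rep_honest x).meroIn hs) fun p hp => by
        obtain ⟨h3, h4⟩ := Finset.mem_filter.1 hp
        obtain ⟨a, b⟩ := p
        obtain rfl : b = 0 := (mem_cross.1 h3).2.resolve_left h4
        filter_upwards [eventually_solSup.1 (rep_pdGerm (a, 0) x) s hs,
          eventually_solSup.1 ((rep_eq_zero _).1 (hx a h4)) s hs] with u h5 h6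
        rw [← h5, h6]
  exact ⟨n, g, hg1, eventually_solSup.2 hg2⟩

theorem exists_pdGerm_ne_zero (hF : IsEquation D F) (hS : IsBase D F S) (hg : Honest S g)
    (h : Essential S g) : ∃ p ∈ axes, pdGerm p (hg.germ D F) ≠ 0 := by
  by_contra! h0
  obtain ⟨C, hC⟩ := hg.exists_eq_const hF hS fun p hp => by
    have h1 := h0 p hp
    rw [hg.pdGerm_germ hF hS] at h1
    exact (Honest.germ_eq_germ (hg.pd p) (Honest.const S 0)).1 h1
  exact h C fun s hs => genericallyNear_iff_genFilter.2 (hC s hs)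

theorem ShiftInvariant.shiftHom_germ (hF : IsEquation D F) (hS : IsBase D F S) {a b : ℤ}
    (hg : Honest S g) (h : ShiftInvariant D F S a b g) :
    shiftHom hF hS a b (hg.germ D F) = hg.germ D F := by
  refine (shiftHom_germ_eq hF hS hg hg).2 (eventually_solSup.2 fun s hs => ?_)
  obtain ⟨N, hN⟩ := h s hs
  exact hN.eventually

/-- For a Darboux integrable equation, the linearized equation has a solution given by an operator
`∑ λ_q T_j^q` whose coefficients are functions of the `u_{0,l}`. -/
theorem DarbouxIntegrable.exists_operator (hF : IsEquation D F) (hS : IsBase D F S)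
    (hD : DarbouxIntegrable D F S) : ∃ (r n : ℕ) (lam : ℤ → (ℤ × ℤ → 𝕜) → 𝕜),
      (∀ q, ∀ s ∈ S, MeroIn (seg (-n) n : Set (ℤ × ℤ)) s (lam q)) ∧ lam (-1) = (fun _ => 0) ∧
      lam (r + 1) = (fun _ => 0) ∧ (∀ s ∈ S, ¬ GenericallyNear s fun u => lam r u = 0) ∧
      ∀ q, ∀ᶠ u in solSup D F S, lam (q - 1) (shift 1 1 u) = Fu10 F u * lam q (shift 1 0 u) +
        Fu01 F u * lam (q - 1) (shift 0 1 u) + Fu F u * lam q u := by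
  classical
  let := germField hF hS
  obtain ⟨⟨I, hI, hI1, hI2⟩, J, hJ, hJ1, hJ2⟩ := hD
  obtain ⟨p, hp, hp0⟩ := exists_pdGerm_ne_zero hF hS hI.honest hI1
  obtain ⟨p', hp', hp0'⟩ := exists_pdGerm_ne_zero hF hS hJ.honest hJ1
  obtain ⟨r, x, hx1, hx2, hx3, hx4, hx5⟩ := (crossField hF hS).exists_operator
    (hI2.shiftHom_germ hF hS hI.honest) hp hp0 (hJ2.shiftHom_germ hF hS hJ.honest) hp' hp0'
  replace hx5 : ∀ q, shiftHom hF hS 1 1 (x (q - 1)) =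
      (honest_Fu10 hF hS).germ D F * shiftHom hF hS 1 0 (x q) +
      (honest_Fu01 hF hS).germ D F * shiftHom hF hS 0 1 (x (q - 1)) +
      (honest_Fu hF hS).germ D F * x q := hx5
  choose n g hg1 hg2 using fun q => exists_column hF hS (x q) (hx4 q)
  -- Outside of `0, …, r` the germ is zero; the function is made literally zero there, so that the
  -- boundary terms vanish everywhere and one `n` serves for all `q`.
  let lam : ℤ → (ℤ × ℤ → 𝕜) → 𝕜 := fun q => if 0 ≤ q ∧ q ≤ r then g q else fun _ => 0
  have hlam : ∀ q, lam q =ᶠ[solSup D F S] rep (x q) := by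
    intro q
    by_cases hq : 0 ≤ q ∧ q ≤ r
    · simp only [lam, if_pos hq]; exact hg2 q
    · simp only [lam, if_neg hq]
      have h0 : x q = 0 := by
        rcases not_and_or.1 hq with h | h
        · exact hx1 q (not_le.1 h)
        · exact hx2 q (not_le.1 h)
      exact ((rep_eq_zero _).1 h0).symm
  refine ⟨r, (Finset.Icc (0 : ℤ) r).sup n, lam, fun q s hs => ?_, by simp [lam], by simp [lam],
    fun s hs h => ?_, fun q => ?_⟩
  · by_cases hq : 0 ≤ q ∧ q ≤ r
    · simp only [lam, if_pos hq]
      have h1 : n q ≤ (Finset.Icc (0 : ℤ) r).sup n :=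
        Finset.le_sup (f := n) (Finset.mem_Icc.2 hq)
      exact (hg1 q s hs).mono (seg_mono (by omega) (by omega))
    · simp only [lam, if_neg hq]
      exact (AnalyticIn.const _ _ 0).meroIn
  · have h1 := ((rep_honest (x r)).eq_zero_or hF hS).resolve_left fun h => hx3 ((rep_eq_zero _).2 h)
    have := solFilter_neBot hF (hS.solves s hs)
    obtain ⟨u, h2, h3, h4⟩ := ((eventually_solSup.1 h1 s hs).and
      ((eventually_solSup.1 (hlam r) s hs).and
        (solFilter_le_genFilter (genericallyNear_iff_genFilter.1 h)))).exists
    exact h2 (h3 ▸ h4)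
  · have h1 := congrArg rep (hx5 q)
    have hT := fun a b => tendsto_shift_solSup hF hS a b
    filter_upwards [rep_shiftHom hF hS 1 1 (x (q - 1)), rep_shiftHom hF hS 1 0 (x q),
      rep_shiftHom hF hS 0 1 (x (q - 1)), (hT 1 1).eventually (hlam (q - 1)),
      (hT 1 0).eventually (hlam q), (hT 0 1).eventually (hlam (q - 1)), hlam q,
      rep_add ((honest_Fu10 hF hS).germ D F * shiftHom hF hS 1 0 (x q) +
        (honest_Fu01 hF hS).germ D F * shiftHom hF hS 0 1 (x (q - 1)))
        ((honest_Fu hF hS).germ D F * x q),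
      rep_add ((honest_Fu10 hF hS).germ D F * shiftHom hF hS 1 0 (x q))
        ((honest_Fu01 hF hS).germ D F * shiftHom hF hS 0 1 (x (q - 1))),
      rep_mul ((honest_Fu10 hF hS).germ D F) (shiftHom hF hS 1 0 (x q)),
      rep_mul ((honest_Fu01 hF hS).germ D F) (shiftHom hF hS 0 1 (x (q - 1))),
      rep_mul ((honest_Fu hF hS).germ D F) (x q), (honest_Fu10 hF hS).rep_germ (D := D) (F := F),
      (honest_Fu01 hF hS).rep_germ (D := D) (F := F), (honest_Fu hF hS).rep_germ (D := D) (F := F)]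
      with u a1 a2 a3 a4 a5 a6 a7 a8 a9 a10 a11 a12 a13 a14 a15
    rw [a4, a5, a6, a7, ← a1, ← a2, ← a3, h1, a8, a9, a10, a11, a12, a13, a14, a15]

theorem substMap_shift (φ : 𝕜 × 𝕜 → 𝕜) (b : ℤ) (u : ℤ × ℤ → 𝕜) :
    substMap φ (shift 0 b u) = shift 0 b (substMap φ u) := by
  funext p
  simp [substMap, shift, add_right_comm]

/-- In `φ_u R + φ_{u_{0,1}} T_j R` the coefficient of `T_j^q` is `φ_u λ_q + φ_{u_{0,1}}
T_j(λ_{q-1})`, with `λ_{-1} = λ_{r+1} = 0`. By hypothesis it is a function of the substitution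
variables, so it can serve as the coefficient of `R̂`. -/
theorem isMiuraType_of_operator (hF : IsEquation D F) (hS : IsBase D F S)
    (hφ : ∀ s ∈ S, RegularAt φ s) {r n : ℕ} {lam lamhat : ℤ → (ℤ × ℤ → 𝕜) → 𝕜}
    (hlam : ∀ q, ∀ s ∈ S, MeroIn (seg (-n) n : Set (ℤ × ℤ)) s (lam q))
    (h0 : lam (-1) = fun _ => 0) (hr : lam (r + 1) = fun _ => 0)
    (hr0 : ∀ s ∈ S, ¬ GenericallyNear s fun u => lam r u = 0)
    (hlamhat : ∀ q, ∀ s ∈ S, MeroVia (substMap φ) (seg (-n) n) s (lamhat q))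
    (hrel : ∀ q, ∀ s ∈ S, ∀ᶠ u in solFilter D F s, lamhat q u =
      d₁ φ (u (0, 0)) (u (0, 1)) * lam q u +
        d₂ φ (u (0, 0)) (u (0, 1)) * lam (q - 1) (shift 0 1 u)) :
    IsMiuraType S φ := by
  refine ⟨r, -n, n, -n, n, fun q => lam q, fun q => lamhat q,
    fun q _ => isFunctionOfColumn_iff.2 (hlam q), hr0,
    fun q _ => (isFunctionOfSubst_iff hφ).2 (hlamhat q), fun p t ξ hξ => ⟨fun s hs => ?_, ?_, ?_⟩⟩
  · simpa using And.intro ((hφ s hs).d₁_ne 0) ((hφ s hs).d₂_ne 0)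
  · rw [isFunctionOfSubst_iff hφ] at hξ
    -- A range that contains the variables of all coefficients and of all shifts of `ξ` by `p + q`,
    -- `q ≤ r + 1`, with one more place because each substitution variable involves two column
    -- variables.
    obtain ⟨L, hL⟩ : ∃ L : ℕ, L = n + p.natAbs + r + t + 2 := ⟨_, rfl⟩
    have hp1 := neg_abs_le p
    have hp2 := le_abs_self p
    have hp3 := Int.natCast_natAbs p
    have hmem : ∀ {q b : ℕ} {x : ℤ × ℤ}, q ≤ r + 1 → b ≤ t + 1 →
        x ∈ (seg 0 b : Set (ℤ × ℤ)) → (x.1 + 0, x.2 + (p + q)) ∈ (seg (-L) L : Set (ℤ × ℤ)) := by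
      intro q b x hq hb hx
      obtain ⟨h1, h2, h3⟩ := mem_seg.1 (Finset.mem_coe.1 hx)
      exact Finset.mem_coe.2 (mem_seg.2 ⟨by simp only; omega, by simp only; omega,
        by simp only; omega⟩)
    refine ⟨-L, L, by omega, ?_, ?_⟩
    · rw [isFunctionOfColumn_iff]
      intro s hs
      refine MeroIn.finsetSum _ fun q hq => ?_
      rw [Finset.mem_range] at hq
      refine ((hlam q s hs).mono (seg_mono (by omega) (by omega))).mul ?_
      have h1 := (hφ _ (hS.shift_mem hs 0 (p + q))).meroIn (hξ _ (hS.shift_mem hs 0 (p + q)))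
      have h2 := h1.shift fun x hx => hmem (q := q) (b := t + 1) (by omega) le_rfl
        (by push_cast; exact hx)
      simpa only [shift_shift, zero_add] using h2
    · rw [isFunctionOfSubst_iff hφ]
      intro s hs
      refine MeroVia.finsetSum _ fun q hq => ?_
      rw [Finset.mem_range] at hq
      refine ((hlamhat q s hs).mono (seg_mono (by omega) (by omega))).mul ?_
      have h2 := (hξ _ (hS.shift_mem hs 0 (p + q))).shift (fun u => substMap_shift φ (p + q) u)
        fun x hx => hmem (q := q) (b := t) (by omega) (by omega) hx
      simpa only [shift_shift, zero_add] using h2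
  · intro s hs
    rw [genericallyNear_iff_genFilter]
    -- Both sides are functions of dynamical variables, so the identity on solutions holds
    -- generically.
    have h1 : ∀ᶠ u in genFilter s, ∀ q ∈ Finset.range (r + 2), lamhat (q : ℕ) u =
        d₁ φ (u (0, 0)) (u (0, 1)) * lam q u +
          d₂ φ (u (0, 0)) (u (0, 1)) * lam (q - 1) (shift 0 1 u) := by
      rw [eventually_all_finset]
      intro q _
      have hd1 : MeroIn axes s fun u => d₁ φ (u (0, 0)) (u (0, 1)) :=
        ((hφ s hs).analyticIn_d₁ (l := 0) (Or.inl rfl) (Or.inl rfl)).meroIn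
      have hd2 : MeroIn axes s fun u => d₂ φ (u (0, 0)) (u (0, 1)) :=
        ((hφ s hs).analyticIn_d₂ (l := 0) (Or.inl rfl) (Or.inl rfl)).meroIn
      refine MeroIn.eventuallyEq hF (hS.solves s hs)
        (((hφ s hs).meroIn (hlamhat q s hs)).mono (seg_subset_axes _ _))
        ((hd1.mul ((hlam q s hs).mono (seg_subset_axes _ _))).add (hd2.mul
          ((hlam _ _ (hS.shift_mem hs 0 1)).shift fun x hx => Or.inl ?_))) (hrel q s hs)
      simpa using (mem_seg.1 (Finset.mem_coe.1 hx)).1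
    filter_upwards [h1] with u hu
    simp only [applyOp]
    have h2 : ∀ q : ℕ, shift 0 (q : ℤ) (shift 0 1 u) = shift 0 ((q + 1 : ℕ) : ℤ) u := fun q => by
      rw [shift_shift]; push_cast; simp
    simp only [h2]
    have h3 : lam ((r + 1 : ℕ) : ℤ) u = 0 := by push_cast; rw [hr]
    have h4 : lam (((0 : ℕ) : ℤ) - 1) (shift 0 1 u) = 0 := by norm_num [h0]
    symm
    rw [Finset.sum_congr (rfl : Finset.range (r + 1 + 1) = Finset.range (r + 2))
      fun q hq => by rw [hu q hq, add_mul], Finset.sum_add_distrib, Finset.sum_range_succ,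
      Finset.sum_range_succ' (fun q : ℕ => d₂ φ (u (0, 0)) (u (0, 1)) *
        lam ((q : ℤ) - 1) (shift 0 1 u) * ξ (shift 0 p (shift 0 (q : ℤ) u))),
      h3, h4, Finset.mul_sum, Finset.mul_sum]
    push_cast
    simp only [add_sub_cancel_right, mul_zero, zero_mul, add_zero, mul_assoc]

theorem honest_coefficients (hφ : ∀ s ∈ S, RegularAt φ s) {lam : ℤ → (ℤ × ℤ → 𝕜) → 𝕜} {n : ℕ}
    (hS : IsBase D F S)
    (hlam : ∀ q, ∀ s ∈ S, MeroIn (seg (-n) n : Set (ℤ × ℤ)) s (lam q)) (q q' : ℤ) (hs : s ∈ S) :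
    MeroIn (seg (-(n + 1 : ℕ)) (n + 1 : ℕ) : Set (ℤ × ℤ)) s fun u =>
      d₁ φ (u (0, 0)) (u (0, 1)) * lam q u +
        d₂ φ (u (0, 0)) (u (0, 1)) * lam q' (shift 0 1 u) := by
  have hm : ∀ l : ℤ, 0 ≤ l → l ≤ 1 →
      (0, l) ∈ (seg (-(n + 1 : ℕ)) (n + 1 : ℕ) : Set (ℤ × ℤ)) := fun l h1 h2 =>
    Finset.mem_coe.2 (mem_seg.2 ⟨rfl, by simp only; push_cast; omega,
      by simp only; push_cast; omega⟩)
  have h0 := hm 0 le_rfl zero_le_one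
  have h1 := hm (0 + 1) (by omega) (by omega)
  refine (((hφ s hs).analyticIn_d₁ h0 h1).meroIn.mul ((hlam q s hs).mono
    (seg_mono (by push_cast; omega) (by push_cast; omega)))).add
    (((hφ s hs).analyticIn_d₂ h0 h1).meroIn.mul
      ((hlam q' _ (hS.shift_mem hs 0 1)).shift fun x hx => ?_))
  obtain ⟨a1, a2, a3⟩ := mem_seg.1 (Finset.mem_coe.1 hx)
  exact Finset.mem_coe.2 (mem_seg.2 ⟨by simp only; omega, by simp only; push_cast; omega,
    by simp only; push_cast; omega⟩)

end QuadGraph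

theorem corollary3p3 {𝕜 : Type*} [RCLike 𝕜]
    (D : Set (𝕜 × 𝕜 × 𝕜)) (F : 𝕜 × 𝕜 × 𝕜 → 𝕜) (hF : QuadGraph.IsEquation D F)
    (E : Set (𝕜 × 𝕜)) (φ ψ : 𝕜 × 𝕜 → 𝕜) (hform : QuadGraph.HasForm D F E φ ψ)
    (hsolv : QuadGraph.UniquelySolvable D F)
    (S : Set (ℤ × ℤ → 𝕜)) (hS : QuadGraph.IsBase D F S)
    (hdarboux : QuadGraph.DarbouxIntegrable D F S) :
    QuadGraph.IsMiuraType S φ ∧ QuadGraph.IsMiuraType S ψ := by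
  open QuadGraph in
  obtain ⟨r, n, lam, hlam, h0, hr, hr0, heq⟩ := hdarboux.exists_operator hF hS
  have hφ : ∀ s ∈ S, RegularAt φ s := fun s hs => hform.regularAt_left hF (hS.solves s hs)
  have hψ : ∀ s ∈ S, RegularAt ψ s := fun s hs => hform.regularAt_right hF (hS.solves s hs)
  -- `T_i` of the coefficient for `φ` is the coefficient for `ψ`. The coefficient equation is
  -- inserted for `T_i T_j(λ_{q-1})`; the terms with `T_i(λ_q)` cancel since `φ_w + φ_z F_{u_{1,0}}
  -- = 0`, and the others combine to `ψ_u` and `ψ_{u_{0,1}}`.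
  have hshift : ∀ q, (fun u : ℤ × ℤ → 𝕜 =>
      d₁ φ (shift 1 0 u (0, 0)) (shift 1 0 u (0, 1)) * lam q (shift 1 0 u) +
        d₂ φ (shift 1 0 u (0, 0)) (shift 1 0 u (0, 1)) * lam (q - 1) (shift 0 1 (shift 1 0 u)))
      =ᶠ[solSup D F S] fun u => d₁ ψ (u (0, 0)) (u (0, 1)) * lam q u +
        d₂ ψ (u (0, 0)) (u (0, 1)) * lam (q - 1) (shift 0 1 u) := by
    intro q
    filter_upwards [heq q, eventually_solSup.2 fun s _ => eventually_solvesOn (D := D) (F := F) 0]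
      with u h1 h2
    obtain ⟨h3, h4⟩ := h2 0 0 (by simp) (by simp)
    simp only [corner, zero_add] at h3 h4
    obtain ⟨h5, h6, h7⟩ := hform.deriv_relation hF h3
    rw [← h4] at h5 h6 h7
    rw [shift_shift, zero_add, add_zero]
    simp only [shift_apply, zero_add, add_zero]
    rw [h1, h6, h7, Fu, Fu10, Fu01]
    linear_combination lam q (shift 1 0 u) * h5
  have hcφ := fun q s (hs : s ∈ S) => honest_coefficients hφ hS hlam q (q - 1) hs
  have hcψ := fun q s (hs : s ∈ S) => honest_coefficients hψ hS hlam q (q - 1) hs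
  have hlφ := fun q s (hs : s ∈ S) => solMeroVia_left hF hS hform (hcφ q) (hcψ q) (hshift q) hs
  have hlψ := fun q s (hs : s ∈ S) => solMeroVia_right hF hS hform (hlφ q) (hshift q) hs
  -- So far the coefficients are functions of the substitution variables on solutions only; gluing
  -- replaces them by functions that are such everywhere near `S`.
  choose lamφ hφ1 hφ2 using fun q => exists_meroVia hF hS hφ (hlφ q)
  choose lamψ hψ1 hψ2 using fun q => exists_meroVia hF hS hψ (hlψ q)
  have hlam' : ∀ q, ∀ s ∈ S, MeroIn (seg (-(n + 1 : ℕ)) (n + 1 : ℕ) : Set (ℤ × ℤ)) s (lam q) :=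
    fun q s hs => (hlam q s hs).mono (seg_mono (by push_cast; omega) (by push_cast; omega))
  exact ⟨isMiuraType_of_operator hF hS hφ hlam' h0 hr hr0 hφ1 hφ2,
    isMiuraType_of_operator hF hS hψ hlam' h0 hr hr0 hψ1 hψ2⟩
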